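/- Let $\mathbb K$ be an algebraically closed field of characteristic $p>0$, let $G$ be a connected reductive algebraic group over $\mathbb K$, $T\subseteq B$ a maximal torus and a Borel subgroup of $G$, $X=X(T)$ the character group, $\mathfrak g=\mathrm{Lie}(G)$, $\mathfrak h=\mathrm{Lie}(T)$, $\mathfrak b=\mathrm{Lie}(B)$, $R$, $R^+$ and $\Pi$ the roots, the positive roots (those of $\mathfrak b$) and the simple roots. For $\mu\in X$ let $d\mu\in\mathfrak h^*$ be its differential. Choose root vectors $e_\alpha\in\mathfrak g_\alpha$ ($\alpha\in R$) that together with a basis of $\mathfrak h$ form a basis of $\mathfrak g$, and put $h_\alpha=[e_\alpha,e_{-\alpha}]\in\mathfrak h$. Let $I\subseteq\Pi$ and let $\chi\in\mathfrak g^*$ be in standard Levi form: $\chi(\mathfrak b)=0$ and, for $\alpha\in R^+$, $\chi(e_{-\alpha})=1$ if $\alpha\in I$ and $0$ otherwise. Put $U_\chi=U(\mathfrak g)/\langle e_\alpha^p-\chi(e_\alpha)^p\mid\alpha\in R\rangle$, graded by $X/\mathbb ZI$ with $e_\alpha$ in degree $\alpha+\mathbb ZI$ and $\mathfrak h$ in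 degree $0$; let $U^0=U(\mathfrak h)$, let $U^0U^+\subseteq U_\chi$ be the subalgebra generated by $\mathfrak h$ and the $e_\alpha$, $\alpha\in R^+$, and for $\mu\in X$ let $\widetilde\mu$ be the automorphism of $U^0$ with $\widetilde\mu(h)=h+d\mu(h)$ for $h\in\mathfrak h$. For a commutative Noetherian $U^0$-algebra $A$ with structure map $\pi:U^0\to A$ let $\mathcal C_A$ be the category whose objects are the $U_\chi\otimes_{\mathbb K}A$-modules $M$ with a decomposition into $A$-submodules $M=\bigoplus_{c\in X/\mathbb ZI}M_c$, $M_c=\bigoplus_{d\mu:\ \mu\in c+pX}M_c^{d\mu}$, such that only finitely many $M_c$ are nonzero, each $M_c$ is finitely generated over $A$, $(U_\chi)_bM_c\subseteq M_{b+c}$, $sm=m\,\pi(\widetilde\mu(s))$ for $s\in U^0$, $m\in M_c^{d\mu}$, and $e_\alpha M_c^{d\mu}\subseteq M_{c+\alpha}^{d(\mu+\alpha)}$ for $\alpha\in R$; morphisms are the homomorphisms of $U_\chi\otimes A$-modules that map each $M_c^{d\mu}$ into $N_c^{d\mu}$. For $\lambda\in X$ let $Z_{A,\chi}(\lambda)=U_\chi\otimes_{U^0U^+}A^\lambda\in\mathcal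 C_A$ be the baby Verma module, where $A^\lambda=A$, on which $s\in U^0$ acts as $\pi(\widetilde\lambda(s))$ and each $e_\alpha$ ($\alpha\in R^+$) as $0$, placed in degree $(\lambda+\mathbb ZI,d\lambda)$. Two elements of $X$ lie in the same block over $A$ if they are equivalent under the smallest equivalence relation on $X$ that relates $\lambda$ and $\mu$ whenever $\mathrm{Hom}_{\mathcal C_A}(Z_{A,\chi}(\lambda),Z_{A,\chi}(\mu))\neq0$ or $\mathrm{Ext}^1_{\mathcal C_A}(Z_{A,\chi}(\lambda),Z_{A,\chi}(\mu))\neq0$. Theorem. Let $A$ be a commutative, Noetherian, local $U^0$-algebra with structure map $\pi:U^0\to A$ and residue field $F$, regarded as a $U^0$-algebra via $U^0\to A\to F$. Suppose that $\pi(h_\alpha)=0$ for all $\alpha\in R$. Then $\lambda,\mu\in X$ lie in the same block over $A$ if and only if they lie in the same block over $F$. -/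

import Mathlib

open scoped TensorProduct

universe u v

attribute [local instance 100] LieRing.ofAssociativeRing

/-! ### Linear algebraic groups as Zariski closed subgroups of `GL_n(K)` -/

namespace LinAlg

variable {K : Type u} [Field K] {n : ℕ}

/-- Polynomials in the entries of a matrix (left summand) and in the entries of its inverse
(right summand); they restrict to all the regular functions on `GL_n`. -/
abbrev Coord (K : Type u) [Field K] (n : ℕ) : Type u :=
  MvPolynomial ((Fin n × Fin n) ⊕ (Fin n × Fin n)) K

/-- The value of a regular function at `g`. -/
noncomputable def evalAt (g : GL (Fin n) K) : Coord K n →ₐ[K] K :=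
  MvPolynomial.aeval (Sum.elim (fun ij => (g : Matrix (Fin n) (Fin n) K) ij.1 ij.2)
    (fun ij => ((g⁻¹ : GL (Fin n) K) : Matrix (Fin n) (Fin n) K) ij.1 ij.2))

def IsZariskiClosed (S : Set (GL (Fin n) K)) : Prop :=
  ∃ P : Set (Coord K n), S = {g | ∀ f ∈ P, evalAt g f = 0}

/-- Connectedness in the Zariski topology. -/
def IsZariskiConnected (S : Set (GL (Fin n) K)) : Prop :=
  S.Nonempty ∧ ∀ Z₁ Z₂ : Set (GL (Fin n) K), IsZariskiClosed Z₁ → IsZariskiClosed Z₂ →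
    S ⊆ Z₁ ∪ Z₂ → S ∩ (Z₁ ∩ Z₂) = ∅ → S ⊆ Z₁ ∨ S ⊆ Z₂

/-- Closed connected subgroups of `GL_n(K)`. -/
def IsConnectedAlgGroup (H : Subgroup (GL (Fin n) K)) : Prop :=
  IsZariskiClosed (H : Set (GL (Fin n) K)) ∧ IsZariskiConnected (H : Set (GL (Fin n) K))

def IsUnipotent (H : Subgroup (GL (Fin n) K)) : Prop :=
  ∀ g ∈ H, IsNilpotent ((g : Matrix (Fin n) (Fin n) K) - 1)

/-- Connected reductive: every closed connected normal unipotent subgroup is trivial. -/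
def IsReductive (G : Subgroup (GL (Fin n) K)) : Prop :=
  IsConnectedAlgGroup G ∧ ∀ N : Subgroup (GL (Fin n) K), N ≤ G → IsConnectedAlgGroup N →
    (∀ g ∈ G, ∀ x ∈ N, g * x * g⁻¹ ∈ N) → IsUnipotent N → N = ⊥

/-- Tori: closed connected subgroups that can be diagonalized. -/
def IsTorus (T : Subgroup (GL (Fin n) K)) : Prop :=
  IsConnectedAlgGroup T ∧ ∃ g : GL (Fin n) K, ∀ t ∈ T,
    ((g * t * g⁻¹ : GL (Fin n) K) : Matrix (Fin n) (Fin n) K).IsDiag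

def IsMaximalTorus (G T : Subgroup (GL (Fin n) K)) : Prop :=
  Maximal (fun S : Subgroup (GL (Fin n) K) => S ≤ G ∧ IsTorus S) T

def IsBorel (G B : Subgroup (GL (Fin n) K)) : Prop :=
  Maximal (fun S : Subgroup (GL (Fin n) K) =>
    S ≤ G ∧ IsConnectedAlgGroup S ∧ Group.IsSolvable S) B

/-! ### The Lie algebra -/

/-- The left invariant derivation of the coordinate ring of `GL_n` attached to a matrix `x`:
it sends the generic matrix `g` to `g x`, hence `g⁻¹` to `-x g⁻¹`. -/
noncomputable def invDer (x : Matrix (Fin n) (Fin n) K) :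
    Derivation K (Coord K n) (Coord K n) :=
  MvPolynomial.mkDerivation K (Sum.elim
    (fun ij => ∑ k, x k ij.2 • MvPolynomial.X (Sum.inl (ij.1, k)))
    (fun ij => -∑ k, x ij.1 k • MvPolynomial.X (Sum.inr (k, ij.2))))

/-- The ideal of all regular functions that vanish on `H`. -/
noncomputable def vanishing (H : Subgroup (GL (Fin n) K)) : Ideal (Coord K n) :=
  ⨅ g ∈ H, RingHom.ker (evalAt g)

theorem mem_vanishing {H : Subgroup (GL (Fin n) K)} {f : Coord K n} :
    f ∈ vanishing H ↔ ∀ g ∈ H, evalAt g f = 0 := by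
  simp [vanishing, Submodule.mem_iInf, RingHom.mem_ker]

theorem invDer_add (x y : Matrix (Fin n) (Fin n) K) : invDer (x + y) = invDer x + invDer y := by
  refine MvPolynomial.derivation_ext ?_
  rintro (ij | ij)
  · simp [invDer, MvPolynomial.mkDerivation_X, add_smul, Finset.sum_add_distrib]
  · simp only [invDer, Derivation.add_apply, MvPolynomial.mkDerivation_X, Sum.elim_inr,
      Matrix.add_apply, add_smul, Finset.sum_add_distrib, neg_add]

theorem invDer_smul (c : K) (x : Matrix (Fin n) (Fin n) K) : invDer (c • x) = c • invDer x := by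
  refine MvPolynomial.derivation_ext ?_
  rintro (ij | ij) <;>
  simp [invDer, MvPolynomial.mkDerivation_X, mul_smul, Finset.smul_sum]

theorem invDer_lie (x y : Matrix (Fin n) (Fin n) K) : invDer ⁅x, y⁆ = ⁅invDer x, invDer y⁆ := by
  refine MvPolynomial.derivation_ext ?_
  rintro (ij | ij)
  · simp only [Derivation.commutator_apply, invDer, MvPolynomial.mkDerivation_X, Sum.elim_inl,
      map_sum, Derivation.map_smul, Ring.lie_def, Matrix.sub_apply, Matrix.mul_apply, sub_smul,
      Finset.sum_sub_distrib, Finset.sum_smul, Finset.smul_sum, mul_smul]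
    rw [Finset.sum_comm]
    nth_rw 2 [Finset.sum_comm]
    simp only [smul_smul, mul_comm]
  · simp only [Derivation.commutator_apply, invDer, MvPolynomial.mkDerivation_X, Sum.elim_inr,
      map_sum, map_neg, Derivation.map_smul, Ring.lie_def, Matrix.sub_apply, Matrix.mul_apply,
      sub_smul, Finset.sum_sub_distrib, Finset.sum_smul, Finset.smul_sum, mul_smul, smul_neg,
      Finset.sum_neg_distrib, neg_neg]
    rw [Finset.sum_comm]
    nth_rw 2 [Finset.sum_comm]
    simp only [neg_sub]

/-- Left translation of regular functions. -/
noncomputable def translate (g : GL (Fin n) K) : Coord K n →ₐ[K] Coord K n :=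
  MvPolynomial.aeval (Sum.elim
    (fun ij => ∑ k, (g : Matrix (Fin n) (Fin n) K) ij.1 k • MvPolynomial.X (Sum.inl (k, ij.2)))
    (fun ij => ∑ k, ((g⁻¹ : GL (Fin n) K) : Matrix (Fin n) (Fin n) K) k ij.2 •
      MvPolynomial.X (Sum.inr (ij.1, k))))

theorem evalAt_translate (g h : GL (Fin n) K) (f : Coord K n) :
    evalAt h (translate g f) = evalAt (g * h) f := by
  have : (evalAt h).comp (translate g) = evalAt (g * h) := by
    refine MvPolynomial.algHom_ext ?_
    rintro (ij | ij)
    · simp [evalAt, translate, Matrix.mul_apply]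
    · simp [evalAt, translate, Matrix.mul_apply, mul_comm]
  exact DFunLike.congr_fun this f

theorem invDer_translate (g : GL (Fin n) K) (x : Matrix (Fin n) (Fin n) K) (f : Coord K n) :
    invDer x (translate g f) = translate g (invDer x f) := by
  induction f using MvPolynomial.induction_on with
  | C a =>
    rw [show (MvPolynomial.C a : Coord K n) = algebraMap K _ a from rfl]
    simp
  | add p q hp hq => simp [hp, hq]
  | mul_X p i hp =>
    have key : invDer x (translate g (MvPolynomial.X i)) =
        translate g (invDer x (MvPolynomial.X i)) := by
      rcases i with ij | ij
      · simp only [invDer, translate, MvPolynomial.aeval_X, MvPolynomial.mkDerivation_X,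
          Sum.elim_inl, map_sum, Derivation.map_smul, map_smul, Finset.smul_sum]
        rw [Finset.sum_comm]
        simp only [smul_smul, mul_comm]
      · simp only [invDer, translate, MvPolynomial.aeval_X, MvPolynomial.mkDerivation_X,
          Sum.elim_inr, map_sum, map_neg, Derivation.map_smul, map_smul, Finset.smul_sum,
          smul_neg, Finset.sum_neg_distrib]
        rw [Finset.sum_comm]
        simp only [smul_smul, mul_comm]
    simp [hp, key]

theorem invDer_mem_vanishing {H : Subgroup (GL (Fin n) K)} {x : Matrix (Fin n) (Fin n) K}
    (hx : ∀ f ∈ vanishing H, evalAt 1 (invDer x f) = 0) {f : Coord K n} (hf : f ∈ vanishing H) :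
    invDer x f ∈ vanishing H := by
  rw [mem_vanishing] at hf ⊢
  intro g hg
  have h1 : translate g f ∈ vanishing H := by
    rw [mem_vanishing]
    intro h hh
    rw [evalAt_translate]
    exact hf _ (H.mul_mem hg hh)
  have h2 := hx _ h1
  rwa [invDer_translate, evalAt_translate, mul_one] at h2

/-- The Lie algebra of `H`: the tangent space at the identity, inside `𝔤𝔩_n`. -/
noncomputable def lieAlg (H : Subgroup (GL (Fin n) K)) :
    LieSubalgebra K (Matrix (Fin n) (Fin n) K) where
  carrier := {x | ∀ f ∈ vanishing H, evalAt 1 (invDer x f) = 0}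
  add_mem' := by
    intro x y hx hy f hf
    simp [invDer_add, hx f hf, hy f hf]
  zero_mem' := by
    intro f _
    have : invDer (0 : Matrix (Fin n) (Fin n) K) = 0 := by
      simpa using invDer_smul (0 : K) (0 : Matrix (Fin n) (Fin n) K)
    simp [this]
  smul_mem' := by
    intro c x hx f hf
    simp [invDer_smul, hx f hf]
  lie_mem' := by
    intro x y hx hy f hf
    rw [invDer_lie, Derivation.commutator_apply, map_sub, hx _ (invDer_mem_vanishing hy hf),
      hy _ (invDer_mem_vanishing hx hf), sub_zero]

theorem mem_lieAlg {H : Subgroup (GL (Fin n) K)} {x : Matrix (Fin n) (Fin n) K} :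
    x ∈ lieAlg H ↔ ∀ f ∈ vanishing H, evalAt 1 (invDer x f) = 0 := Iff.rfl

/-! ### Characters and roots -/

/-- The algebraic characters `H → 𝔾_m`. -/
def charGroup (H : Subgroup (GL (Fin n) K)) : Subgroup (H →* Kˣ) where
  carrier := {c | ∃ f : Coord K n, ∀ t : H, (c t : K) = evalAt (t : GL (Fin n) K) f}
  mul_mem' := by
    rintro a b ⟨f, hf⟩ ⟨g, hg⟩
    exact ⟨f * g, fun t => by simp [hf, hg]⟩
  one_mem' := ⟨1, fun t => by simp⟩
  inv_mem' := by
    rintro a ⟨f, hf⟩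
    refine ⟨MvPolynomial.rename Sum.swap f, fun t => ?_⟩
    have h1 : evalAt (t : GL (Fin n) K) (MvPolynomial.rename Sum.swap f) =
        evalAt ((t⁻¹ : H) : GL (Fin n) K) f := by
      rw [evalAt, evalAt, MvPolynomial.aeval_rename]
      congr 2
      funext i
      rcases i with ij | ij <;> simp
    rw [h1, ← hf, map_inv]
    rfl

/-- The character group `X(H)`, written additively. -/
abbrev Chars (H : Subgroup (GL (Fin n) K)) : Type u := Additive (charGroup H)

/-- The value of the character `c` at `t`. -/
def Chars.val {H : Subgroup (GL (Fin n) K)} (c : Chars H) (t : H) : K :=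
  ((c.toMul : H →* Kˣ) t : K)

theorem Chars.exists_poly {H : Subgroup (GL (Fin n) K)} (c : Chars H) :
    ∃ f : Coord K n, ∀ t : H, c.val t = evalAt (t : GL (Fin n) K) f := c.toMul.2

theorem Chars.val_add {H : Subgroup (GL (Fin n) K)} (c d : Chars H) (t : H) :
    (c + d).val t = c.val t * d.val t := by
  simp [Chars.val]

theorem Chars.val_zero {H : Subgroup (GL (Fin n) K)} (t : H) : (0 : Chars H).val t = 1 := by
  simp [Chars.val]

theorem Chars.val_one {H : Subgroup (GL (Fin n) K)} (c : Chars H) : c.val 1 = 1 := by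
  simp [Chars.val]

theorem Chars.ext_val {H : Subgroup (GL (Fin n) K)} {c d : Chars H}
    (h : ∀ t, c.val t = d.val t) : c = d := by
  apply Additive.toMul.injective
  apply Subtype.ext
  ext t
  exact h t

/-- The derivative at the identity, in the direction `x`, of a regular function that
represents the character `c`. -/
noncomputable def diffFun {H : Subgroup (GL (Fin n) K)} (c : Chars H) (x : lieAlg H) : K :=
  evalAt 1 (invDer (x : Matrix (Fin n) (Fin n) K) c.exists_poly.choose)

theorem diffFun_eq {H : Subgroup (GL (Fin n) K)} (c : Chars H) (x : lieAlg H) (f : Coord K n)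
    (hf : ∀ t : H, c.val t = evalAt (t : GL (Fin n) K) f) :
    diffFun c x = evalAt 1 (invDer (x : Matrix (Fin n) (Fin n) K) f) := by
  have h : c.exists_poly.choose - f ∈ vanishing H := by
    rw [mem_vanishing]
    intro g hg
    rw [map_sub, ← hf ⟨g, hg⟩, ← c.exists_poly.choose_spec ⟨g, hg⟩, sub_self]
  have h2 := x.2 _ h
  rw [map_sub, map_sub, sub_eq_zero] at h2
  exact h2

theorem diffFun_add {H : Subgroup (GL (Fin n) K)} (c d : Chars H) (x : lieAlg H) :
    diffFun (c + d) x = diffFun c x + diffFun d x := by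
  obtain ⟨f, hf⟩ := c.exists_poly
  obtain ⟨g, hg⟩ := d.exists_poly
  have h1 := diffFun_eq (c + d) x (f * g)
    (fun t => by rw [Chars.val_add, hf, hg, map_mul])
  have hf1 : evalAt (1 : GL (Fin n) K) f = 1 := by
    rw [← Chars.val_one c]
    exact (hf 1).symm
  have hg1 : evalAt (1 : GL (Fin n) K) g = 1 := by
    rw [← Chars.val_one d]
    exact (hg 1).symm
  rw [h1, diffFun_eq c x f hf, diffFun_eq d x g hg, Derivation.leibniz, map_add, smul_eq_mul,
    smul_eq_mul, map_mul, map_mul, hf1, hg1, one_mul, one_mul, add_comm]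

/-- The differential `dc : Lie(H) → K` of a character `c`. -/
noncomputable def diffLin {H : Subgroup (GL (Fin n) K)} (c : Chars H) :
    Module.Dual K (lieAlg H) where
  toFun := diffFun c
  map_add' x y := by
    rw [diffFun, AddMemClass.coe_add, invDer_add, Derivation.add_apply, map_add]
    rfl
  map_smul' r x := by
    rw [diffFun, SetLike.val_smul, invDer_smul, Derivation.smul_apply, map_smul]
    rfl

/-- The homomorphism `X(H) → Lie(H)^*`, `c ↦ dc`. -/
noncomputable def diff (H : Subgroup (GL (Fin n) K)) :
    Chars H →+ Module.Dual K (lieAlg H) :=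
  AddMonoidHom.mk' diffLin fun c d => LinearMap.ext fun x => diffFun_add c d x

/-- The weight space of weight `c` for the adjoint action of `T` on `Lie(H)`. -/
def weightSpace (H T : Subgroup (GL (Fin n) K)) (c : Chars T) : Submodule K (lieAlg H) where
  carrier := {x | ∀ t : T, ((t : GL (Fin n) K) : Matrix (Fin n) (Fin n) K) * x *
    (((t : GL (Fin n) K)⁻¹ : GL (Fin n) K) : Matrix (Fin n) (Fin n) K) =
      c.val t • (x : Matrix (Fin n) (Fin n) K)}
  add_mem' := by
    intro x y hx hy t
    rw [AddMemClass.coe_add, mul_add, add_mul, smul_add, hx t, hy t]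
  zero_mem' := by
    intro t
    simp
  smul_mem' := by
    intro r x hx t
    rw [SetLike.val_smul, Matrix.mul_smul, Matrix.smul_mul, hx t, smul_comm]

/-- The nonzero weights of `T` on `Lie(H)`. -/
def roots (H T : Subgroup (GL (Fin n) K)) : Set (Chars T) :=
  {c | c ≠ 0 ∧ weightSpace H T c ≠ ⊥}

/-- The simple roots of the positive system that is attached to the Borel subgroup `B`:
the elements of the positive system that are not sums of two elements of it. -/
def simpleRoots (B T : Subgroup (GL (Fin n) K)) : Set (Chars T) :=
  {c | c ∈ roots B T ∧ ¬ ∃ a ∈ roots B T, ∃ b ∈ roots B T, c = a + b}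

/-- `Lie(T)` as a subalgebra of `Lie(H)`. -/
noncomputable def cartan (H T : Subgroup (GL (Fin n) K)) : LieSubalgebra K (lieAlg H) :=
  (lieAlg T).comap (lieAlg H).incl

end LinAlg

open LinAlg

/-! ### The standing data -/

/-- A connected reductive group `G` with a maximal torus `T`, a Borel subgroup `B ⊇ T`, root
vectors `e α` that together with a basis of `Lie(T)` form a basis of `Lie(G)`, and a linear form
`χ` on `Lie(G)` in standard Levi form with respect to a set `I` of simple roots. The values of
`e` outside the set of roots are irrelevant. -/
structure LeviDatum (K : Type u) [Field K] (n : ℕ) where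
  G : Subgroup (GL (Fin n) K)
  T : Subgroup (GL (Fin n) K)
  B : Subgroup (GL (Fin n) K)
  reductive : IsReductive G
  maximalTorus : IsMaximalTorus G T
  borel : IsBorel G B
  T_le_B : T ≤ B
  e : Chars T → lieAlg G
  e_mem : ∀ α ∈ roots G T, e α ∈ weightSpace G T α
  e_linearIndependent : LinearIndependent K (fun α : roots G T => e α)
  e_isCompl : IsCompl (Submodule.span K (e '' roots G T)) (cartan G T).toSubmodule
  I : Set (Chars T)
  I_subset : I ⊆ simpleRoots B T
  χ : Module.Dual K (lieAlg G)
  χ_borel : ∀ x : lieAlg G, (x : Matrix (Fin n) (Fin n) K) ∈ lieAlg B → χ x = 0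
  χ_neg_mem : ∀ α ∈ roots B T, α ∈ I → χ (e (-α)) = 1
  χ_neg_notMem : ∀ α ∈ roots B T, α ∉ I → χ (e (-α)) = 0

namespace LeviDatum

variable {K : Type u} [Field K] {n : ℕ} (D : LeviDatum K n)

/-- The character lattice `X = X(T)`. -/
abbrev X : Type u := Chars D.T

/-- The root system `R`. -/
abbrev R : Set D.X := roots D.G D.T

/-- The positive roots: the nonzero weights of `T` on `Lie(B)`. -/
abbrev Rpos : Set D.X := roots D.B D.T

/-- `𝔤 = Lie(G)`. -/
abbrev g : Type u := lieAlg D.G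

/-- `𝔥 = Lie(T)`, as a subalgebra of `𝔤`. -/
noncomputable abbrev h : LieSubalgebra K D.g := cartan D.G D.T

theorem T_le_G : D.T ≤ D.G := D.maximalTorus.prop.1

/-- The differential `dμ ∈ 𝔥^*` of `μ ∈ X`. -/
noncomputable def d : D.X →+ Module.Dual K D.h where
  toFun μ :=
    { toFun := fun x => diff D.T μ ⟨((x : D.g) : Matrix (Fin n) (Fin n) K), x.2⟩
      map_add' := fun x y => (diff D.T μ).map_add ⟨_, x.2⟩ ⟨_, y.2⟩
      map_smul' := fun r x => (diff D.T μ).map_smul r ⟨_, x.2⟩ }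
  map_zero' := by
    ext x
    simp
  map_add' := by
    intro a b
    refine LinearMap.ext fun x => ?_
    simp only [map_add]
    rfl

theorem torus_comm {s t : GL (Fin n) K} (hs : s ∈ D.T) (ht : t ∈ D.T) : s * t = t * s := by
  obtain ⟨g, hg⟩ := D.maximalTorus.prop.2.2
  have h1 := hg s hs
  have h2 := hg t ht
  have h3 : (g * s * g⁻¹) * (g * t * g⁻¹) = (g * t * g⁻¹) * (g * s * g⁻¹) := by
    apply Units.ext
    rw [Units.val_mul (g * s * g⁻¹), Units.val_mul (g * t * g⁻¹), ← h1.diagonal_diag, ← h2.diagonal_diag,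
      Matrix.diagonal_mul_diagonal, Matrix.diagonal_mul_diagonal]
    congr 1
    funext i
    exact mul_comm _ _
  have h4 : g * (s * t) * g⁻¹ = g * (t * s) * g⁻¹ := by
    calc g * (s * t) * g⁻¹ = (g * s * g⁻¹) * (g * t * g⁻¹) := by group
      _ = (g * t * g⁻¹) * (g * s * g⁻¹) := h3
      _ = g * (t * s) * g⁻¹ := by group
  exact mul_left_cancel (mul_right_cancel h4)

/-- A matrix that commutes with a subgroup commutes with its Lie algebra. -/
theorem commute_lieAlg {H : Subgroup (GL (Fin n) K)} {y : Matrix (Fin n) (Fin n) K}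
    (hy : ∀ t ∈ H, (t : Matrix (Fin n) (Fin n) K) * y = y * t)
    {x : Matrix (Fin n) (Fin n) K} (hx : x ∈ lieAlg H) : x * y = y * x := by
  ext i j
  have hmem : (∑ k, y k j • MvPolynomial.X (Sum.inl (i, k)) -
      ∑ k, y i k • MvPolynomial.X (Sum.inl (k, j)) : Coord K n) ∈ vanishing H := by
    rw [mem_vanishing]
    intro t ht
    have := congrFun (congrFun (hy t ht) i) j
    simp only [Matrix.mul_apply] at this
    simp only [evalAt, map_sub, map_sum, map_smul, MvPolynomial.aeval_X, Sum.elim_inl,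
      smul_eq_mul]
    rw [← this, sub_eq_zero]
    exact Finset.sum_congr rfl fun k _ => mul_comm _ _
  have h2 := hx _ hmem
  simp only [invDer, evalAt, map_sub, map_sum, Derivation.map_smul, map_smul,
    MvPolynomial.mkDerivation_X, MvPolynomial.aeval_X, Sum.elim_inl, smul_eq_mul,
    Units.val_one, Matrix.one_apply, mul_ite, mul_one, mul_zero, Finset.sum_ite_eq,
    Finset.mem_univ, if_true, sub_eq_zero] at h2
  simp only [Matrix.mul_apply]
  rw [← h2]
  exact Finset.sum_congr rfl fun k _ => mul_comm _ _

theorem h_comm_torus {x : D.g} (hx : x ∈ D.h) {t : GL (Fin n) K} (ht : t ∈ D.T) :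
    (t : Matrix (Fin n) (Fin n) K) * (x : Matrix (Fin n) (Fin n) K) =
      (x : Matrix (Fin n) (Fin n) K) * t := by
  refine (commute_lieAlg (H := D.T) (fun s hs => ?_) hx).symm
  exact congrArg Units.val (D.torus_comm hs ht)

theorem h_lie_eq_zero (x y : D.h) : ⁅x, y⁆ = 0 := by
  apply Subtype.ext
  apply Subtype.ext
  have := commute_lieAlg (H := D.T) (fun t ht => D.h_comm_torus y.2 ht) x.2
  simpa [Ring.lie_def, sub_eq_zero] using this

/-- Elements of `𝔤` that are fixed by `T` lie in `𝔥`. -/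
theorem mem_h_of_fixed (x : D.g) (hx : x ∈ weightSpace D.G D.T 0) : x ∈ D.h := by
  have htop : x ∈ Submodule.span K (D.e '' D.R) ⊔ (cartan D.G D.T).toSubmodule := by
    rw [D.e_isCompl.sup_eq_top]
    trivial
  obtain ⟨s, hs, y, hy, rfl⟩ := Submodule.mem_sup.1 htop
  have hy0 : y ∈ weightSpace D.G D.T 0 := by
    intro t
    rw [D.h_comm_torus hy t.2, mul_assoc, ← Units.val_mul, mul_inv_cancel, Units.val_one,
      mul_one, Chars.val_zero, one_smul]
  have hs0 : s ∈ weightSpace D.G D.T 0 := by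
    simpa using (weightSpace D.G D.T 0).sub_mem hx hy0
  rw [Set.image_eq_range, Finsupp.mem_span_range_iff_exists_finsupp] at hs
  obtain ⟨c, rfl⟩ := hs
  have hc : c = 0 := by
    ext α
    by_contra hne
    apply α.2.1
    apply Chars.ext_val
    intro t
    have h1 := hs0 t
    have h2 : c.sum (fun (i : D.R) a => (a * (Chars.val (i : D.X) t - 1)) • D.e i) = 0 := by
      apply Subtype.ext
      simp only [Finsupp.sum, Chars.val_zero, one_smul] at h1 ⊢
      have coe_sum : ∀ (F : D.R → D.g), ((∑ i ∈ c.support, F i : D.g) :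
          Matrix (Fin n) (Fin n) K) = ∑ i ∈ c.support, (F i : Matrix (Fin n) (Fin n) K) :=
        fun F => map_sum (lieAlg D.G).incl F _
      rw [coe_sum] at h1 ⊢
      rw [Finset.mul_sum, Finset.sum_mul] at h1
      have h3 := sub_eq_zero.2 h1
      rw [← Finset.sum_sub_distrib] at h3
      refine Eq.trans (Finset.sum_congr rfl fun i _ => ?_) h3
      have h4 := D.e_mem i i.2 t
      rw [SetLike.val_smul, SetLike.val_smul, Matrix.mul_smul, Matrix.smul_mul, h4, mul_sub, mul_one, sub_smul, smul_smul]
    have h5 := linearIndependent_iff'.1 D.e_linearIndependent c.support _ h2 α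
      (Finsupp.mem_support_iff.2 hne)
    rw [Chars.val_zero]
    exact sub_eq_zero.1 ((mul_eq_zero.1 h5).resolve_left hne)
  subst hc
  simpa using hy

theorem lie_e_mem_h {α : D.X} (hα : α ∈ D.R) (hα' : -α ∈ D.R) : ⁅D.e α, D.e (-α)⁆ ∈ D.h := by
  apply D.mem_h_of_fixed
  intro t
  have h1 := D.e_mem α hα t
  have h2 := D.e_mem _ hα' t
  have h3 : Chars.val α t * Chars.val (-α) t = 1 := by
    rw [← Chars.val_add, add_neg_cancel, Chars.val_zero]
  have conj : ∀ a b : Matrix (Fin n) (Fin n) K,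
      ((t : GL (Fin n) K) : Matrix (Fin n) (Fin n) K) * (a * b) *
        (((t : GL (Fin n) K)⁻¹ : GL (Fin n) K) : Matrix (Fin n) (Fin n) K) =
      (((t : GL (Fin n) K) : Matrix (Fin n) (Fin n) K) * a *
        (((t : GL (Fin n) K)⁻¹ : GL (Fin n) K) : Matrix (Fin n) (Fin n) K)) *
      (((t : GL (Fin n) K) : Matrix (Fin n) (Fin n) K) * b *
        (((t : GL (Fin n) K)⁻¹ : GL (Fin n) K) : Matrix (Fin n) (Fin n) K)) := by
    intro a b
    have : (((t : GL (Fin n) K)⁻¹ : GL (Fin n) K) : Matrix (Fin n) (Fin n) K) *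
        ((t : GL (Fin n) K) : Matrix (Fin n) (Fin n) K) = 1 := by
      rw [← Units.val_mul, inv_mul_cancel, Units.val_one]
    simp only [mul_assoc]
    rw [← mul_assoc _ ((t : GL (Fin n) K) : Matrix (Fin n) (Fin n) K) (b * _), this, one_mul]
  rw [LieSubalgebra.coe_bracket, Ring.lie_def, mul_sub, sub_mul, conj, conj, h1, h2,
    Chars.val_zero, one_smul]
  simp only [Matrix.mul_smul, Matrix.smul_mul, smul_smul]
  rw [mul_comm (Chars.val (-α) t), h3, one_smul, one_smul]

/-! ### The algebras -/

/-- `U⁰ = U(𝔥)`. -/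
abbrev U0 : Type u := UniversalEnvelopingAlgebra K D.h

/-- The relations `e_α ^ p = χ(e_α) ^ p`, `α ∈ R`, in `U(𝔤)`. -/
inductive Rel (p : ℕ) : UniversalEnvelopingAlgebra K D.g → UniversalEnvelopingAlgebra K D.g → Prop
  | pow (α : D.X) (hα : α ∈ D.R) :
      Rel p (UniversalEnvelopingAlgebra.ι K (D.e α) ^ p) (algebraMap K _ (D.χ (D.e α) ^ p))

/-- `U_χ = U(𝔤) / ⟨e_α ^ p - χ(e_α) ^ p | α ∈ R⟩`. -/
abbrev Uχ (p : ℕ) : Type u := RingQuot (D.Rel p)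

/-- The map `𝔤 → U_χ`. -/
noncomputable def gen (p : ℕ) : D.g →ₗ⁅K⁆ D.Uχ p :=
  ((RingQuot.mkAlgHom K (D.Rel p)) : _ →ₗ⁅K⁆ D.Uχ p).comp (UniversalEnvelopingAlgebra.ι K)

/-- The map `U⁰ → U_χ`. -/
noncomputable def ofU0 (p : ℕ) : D.U0 →ₐ[K] D.Uχ p :=
  UniversalEnvelopingAlgebra.lift K ((D.gen p).comp D.h.incl)

/-- The algebra endomorphism of `U⁰` with `x ↦ x + φ(x)` for `x ∈ 𝔥`; for `φ = dμ` it is the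
automorphism usually denoted by `μ` with a tilde. -/
noncomputable def shift (φ : Module.Dual K D.h) : D.U0 →ₐ[K] D.U0 :=
  UniversalEnvelopingAlgebra.lift K
    { toFun := fun x => UniversalEnvelopingAlgebra.ι K x + algebraMap K D.U0 (φ x)
      map_add' := fun x y => by
        simp only [map_add]
        abel
      map_smul' := fun r x => by
        simp [Algebra.smul_def, mul_add]
      map_lie' := by
        intro x y
        have h0 : ⁅UniversalEnvelopingAlgebra.ι K x, UniversalEnvelopingAlgebra.ι K y⁆ =
            (0 : D.U0) := by
          rw [← LieHom.map_lie, D.h_lie_eq_zero, map_zero]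
        have h1 := Algebra.commutes (φ x) (UniversalEnvelopingAlgebra.ι K y : D.U0)
        have h2 := Algebra.commutes (φ y) (UniversalEnvelopingAlgebra.ι K x : D.U0)
        have h3 := Algebra.commutes (φ x) (algebraMap K D.U0 (φ y))
        rw [D.h_lie_eq_zero]
        rw [Ring.lie_def] at h0 ⊢
        simp only [map_zero, add_zero, mul_add, add_mul, h1, h2, h3]
        rw [sub_eq_zero] at h0
        rw [h0]
        abel }

/-- The subgroup `ℤI` of `X`. -/
abbrev ZI : AddSubgroup D.X := AddSubgroup.closure D.I

/-- The grading group `X / ℤI`. -/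
abbrev Gr : Type u := D.X ⧸ D.ZI

/-- The class `λ + ℤI`. -/
abbrev cls (μ : D.X) : D.Gr := QuotientAddGroup.mk μ

/-- `D.Monomial p u c`: the element `u` of `U_χ` is a product of elements of `𝔥` and of root
vectors `e_α`, and `c` is the sum of the classes `α + ℤI` of the latter. -/
inductive Monomial (p : ℕ) : D.Uχ p → D.Gr → Prop
  | one : Monomial p 1 0
  | h_mul (x : D.h) {u : D.Uχ p} {c : D.Gr} : Monomial p u c →
      Monomial p (D.gen p (x : D.g) * u) c
  | e_mul (α : D.X) (hα : α ∈ D.R) {u : D.Uχ p} {c : D.Gr} : Monomial p u c →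
      Monomial p (D.gen p (D.e α) * u) (D.cls α + c)

/-- The graded piece `(U_χ)_c` for `c ∈ X / ℤI`. -/
noncomputable def grade (p : ℕ) (c : D.Gr) : Submodule K (D.Uχ p) :=
  Submodule.span K {u | D.Monomial p u c}

/-- `(U_χ)_c^φ`: the elements of `(U_χ)_c` on which `𝔥` acts, through commutators, with
weight `φ`. -/
noncomputable def gradeWeight (p : ℕ) (c : D.Gr) (φ : Module.Dual K D.h) : Submodule K (D.Uχ p) where
  carrier := {u | u ∈ D.grade p c ∧
    ∀ x : D.h, D.gen p (x : D.g) * u - u * D.gen p (x : D.g) = φ x • u}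
  add_mem' := by
    rintro a b ⟨ha, ha'⟩ ⟨hb, hb'⟩
    refine ⟨add_mem ha hb, fun x => ?_⟩
    rw [smul_add, ← ha' x, ← hb' x, mul_add, add_mul]
    abel
  zero_mem' := ⟨zero_mem _, fun x => by simp⟩
  smul_mem' := by
    rintro r a ⟨ha, ha'⟩
    refine ⟨Submodule.smul_mem _ r ha, fun x => ?_⟩
    rw [smul_comm, ← ha' x, smul_sub, mul_smul_comm, smul_mul_assoc]

/-! ### The category `𝒞_A` -/

variable (p : ℕ) {A : Type v} [CommRing A] [Algebra K A]

/-- A `U_χ ⊗ A`-module (commuting actions of `U_χ` and `A` that agree on `K`) together with a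
family of `A`-submodules `M_c^φ`, `c ∈ X / ℤI`, `φ ∈ 𝔥^*`. -/
structure PreObj (A : Type v) [CommRing A] [Algebra K A] where
  carrier : Type (max u v)
  [addCommGroup : AddCommGroup carrier]
  [moduleU : Module (D.Uχ p) carrier]
  [moduleA : Module A carrier]
  [smulCommClass : SMulCommClass (D.Uχ p) A carrier]
  algebraMap_smul : ∀ (k : K) (m : carrier),
    algebraMap K (D.Uχ p) k • m = algebraMap K A k • m
  piece : D.Gr → Module.Dual K D.h → Submodule A carrier

attribute [instance] PreObj.addCommGroup PreObj.moduleU PreObj.moduleA PreObj.smulCommClass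

variable {D p}

/-- `M_c`, the sum of all the `M_c^φ`. -/
def PreObj.gradePiece (M : D.PreObj p A) (c : D.Gr) : Submodule A M.carrier := ⨆ φ, M.piece c φ

/-- The conditions on the objects of `𝒞_A`, for the structure map `π : U⁰ → A`. -/
structure PreObj.IsObj (π : D.U0 →ₐ[K] A) (M : D.PreObj p A) : Prop where
  /-- `M` is the direct sum of the `M_c^φ`. -/
  indep : iSupIndep fun i : D.Gr × Module.Dual K D.h => M.piece i.1 i.2
  iSup_eq_top : ⨆ i : D.Gr × Module.Dual K D.h, M.piece i.1 i.2 = ⊤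
  /-- In `M_c` only the weights `φ = dμ` with `μ ∈ c + pX` occur. -/
  weights : ∀ c φ, M.piece c φ ≠ ⊥ → ∃ μ τ : D.X, D.cls (μ + p • τ) = c ∧ D.d μ = φ
  finite : {c | M.gradePiece c ≠ ⊥}.Finite
  fg : ∀ c, (M.gradePiece c).FG
  grade_smul : ∀ (b c : D.Gr), ∀ u ∈ D.grade p b, ∀ m ∈ M.gradePiece c,
    u • m ∈ M.gradePiece (b + c)
  U0_smul : ∀ (c : D.Gr) (φ : Module.Dual K D.h) (s : D.U0), ∀ m ∈ M.piece c φ,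
    D.ofU0 p s • m = π (D.shift φ s) • m
  e_smul : ∀ α ∈ D.R, ∀ (c : D.Gr) (φ : Module.Dual K D.h), ∀ m ∈ M.piece c φ,
    D.gen p (D.e α) • m ∈ M.piece (D.cls α + c) (φ + D.d α)

/-- Morphisms: homomorphisms of `U_χ ⊗ A`-modules that preserve the pieces `M_c^φ`. -/
structure PreObj.Mor (M N : D.PreObj p A) where
  toFun : M.carrier →ₗ[A] N.carrier
  map_smulU : ∀ (u : D.Uχ p) (m : M.carrier), toFun (u • m) = u • toFun m
  map_piece : ∀ c φ, ∀ m ∈ M.piece c φ, toFun m ∈ N.piece c φ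

/-! ### Baby Verma modules -/

/-- The left ideal of `U_χ ⊗ A` generated by the `e_α ⊗ 1`, `α ∈ R⁺`, and by the
`s ⊗ 1 - 1 ⊗ π(λ(s))`, `s ∈ U⁰`, where `λ` acts on `U⁰` by `shift (dλ)`. -/
noncomputable def vermaIdeal (π : D.U0 →ₐ[K] A) (l : D.X) : Submodule (D.Uχ p ⊗[K] A) (D.Uχ p ⊗[K] A) :=
  Submodule.span _
    ({z | ∃ α ∈ D.Rpos, z = D.gen p (D.e α) ⊗ₜ[K] (1 : A)} ∪
     {z | ∃ s : D.U0, z = D.ofU0 p s ⊗ₜ[K] (1 : A) - 1 ⊗ₜ[K] π (D.shift (D.d l) s)})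

variable (p) in
/-- The `U_χ ⊗ A`-module `U_χ ⊗_{U⁰U⁺} A^λ`, presented as the quotient of `U_χ ⊗ A` by the left
ideal generated by the relations that define the `U⁰U⁺ ⊗ A`-module `A^λ`. -/
noncomputable def VermaModule (π : D.U0 →ₐ[K] A) (l : D.X) : Type (max u v) :=
  (D.Uχ p ⊗[K] A) ⧸ vermaIdeal (p := p) π l

noncomputable instance (π : D.U0 →ₐ[K] A) (l : D.X) : AddCommGroup (VermaModule p π l) :=
  inferInstanceAs (AddCommGroup ((D.Uχ p ⊗[K] A) ⧸ vermaIdeal (p := p) π l))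

noncomputable instance (π : D.U0 →ₐ[K] A) (l : D.X) :
    Module (D.Uχ p ⊗[K] A) (VermaModule p π l) :=
  inferInstanceAs (Module (D.Uχ p ⊗[K] A) ((D.Uχ p ⊗[K] A) ⧸ vermaIdeal (p := p) π l))

noncomputable instance (π : D.U0 →ₐ[K] A) (l : D.X) : Module (D.Uχ p) (VermaModule p π l) :=
  Module.compHom _
    (Algebra.TensorProduct.includeLeft : D.Uχ p →ₐ[K] D.Uχ p ⊗[K] A).toRingHom

noncomputable instance (π : D.U0 →ₐ[K] A) (l : D.X) : Module A (VermaModule p π l) :=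
  Module.compHom _
    (Algebra.TensorProduct.includeRight : A →ₐ[K] D.Uχ p ⊗[K] A).toRingHom

theorem VermaModule.smulU_def (π : D.U0 →ₐ[K] A) (l : D.X) (x : D.Uχ p)
    (m : VermaModule p π l) : x • m = (x ⊗ₜ[K] (1 : A)) • m := rfl

theorem VermaModule.smulA_def (π : D.U0 →ₐ[K] A) (l : D.X) (a : A)
    (m : VermaModule p π l) : a • m = ((1 : D.Uχ p) ⊗ₜ[K] a) • m := rfl

instance (π : D.U0 →ₐ[K] A) (l : D.X) : SMulCommClass (D.Uχ p) A (VermaModule p π l) where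
  smul_comm x a m := by
    simp only [VermaModule.smulU_def, VermaModule.smulA_def, smul_smul,
      Algebra.TensorProduct.tmul_mul_tmul, one_mul, mul_one]

variable (p) in
/-- The standard generator of the baby Verma module. -/
noncomputable def VermaModule.vec (π : D.U0 →ₐ[K] A) (l : D.X) : VermaModule p π l :=
  Submodule.Quotient.mk (p := vermaIdeal (p := p) π l) 1

variable (p) in
/-- The baby Verma module `Z_{A,χ}(λ)`. -/
noncomputable def babyVerma (π : D.U0 →ₐ[K] A) (l : D.X) : D.PreObj p A where
  carrier := VermaModule p π l
  algebraMap_smul k m := by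
    rw [VermaModule.smulU_def, VermaModule.smulA_def, Algebra.algebraMap_eq_smul_one,
      Algebra.algebraMap_eq_smul_one, TensorProduct.smul_tmul]
  piece c φ := Submodule.span A
    {m | ∃ w ∈ D.gradeWeight p (c - D.cls l) (φ - D.d l), m = w • VermaModule.vec p π l}

/-! ### Blocks -/

variable (p) in
/-- `Hom(Z_{A,χ}(λ), Z_{A,χ}(μ)) ≠ 0` in `𝒞_A`. -/
def HomNonzero (π : D.U0 →ₐ[K] A) (l m : D.X) : Prop :=
  ∃ f : (babyVerma p π l).Mor (babyVerma p π m), f.toFun ≠ 0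

variable (p) in
/-- `Ext¹(Z_{A,χ}(λ), Z_{A,χ}(μ)) ≠ 0` in `𝒞_A`: there is a non-split short exact sequence
`0 → Z_{A,χ}(μ) → E → Z_{A,χ}(λ) → 0` in `𝒞_A`. -/
def ExtNonzero (π : D.U0 →ₐ[K] A) (l m : D.X) : Prop :=
  ∃ (E : D.PreObj p A) (_ : E.IsObj π) (i : (babyVerma p π m).Mor E) (q : E.Mor (babyVerma p π l)),
    Function.Injective i.toFun ∧ LinearMap.range i.toFun = LinearMap.ker q.toFun ∧
    Function.Surjective q.toFun ∧
    ¬ ∃ s : (babyVerma p π l).Mor E, q.toFun ∘ₗ s.toFun = LinearMap.id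

variable (p) in
/-- `λ` and `μ` lie in the same block over `A`: they are equivalent under the smallest
equivalence relation on `X` that relates `λ` and `μ` whenever `Hom(Z_{A,χ}(λ), Z_{A,χ}(μ))` or
`Ext¹(Z_{A,χ}(λ), Z_{A,χ}(μ))`, formed in `𝒞_A`, is nonzero. -/
def SameBlock (π : D.U0 →ₐ[K] A) : D.X → D.X → Prop :=
  Relation.EqvGen fun l m => HomNonzero p π l m ∨ ExtNonzero p π l m

/-- The structure map `U⁰ → A → F` of the residue field `F` of `A`. -/
noncomputable def residueMap [IsLocalRing A] (π : D.U0 →ₐ[K] A) :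
    D.U0 →ₐ[K] IsLocalRing.ResidueField A :=
  (IsScalarTower.toAlgHom K A (IsLocalRing.ResidueField A)).comp π

end LeviDatum

/-! Both sides are compared with a third block relation, over the ground field `K` with the
augmentation `aug : U⁰ → K` as structure map. Since `π` kills every `h_α`, the map `x ↦ π(x)` on `𝔥`
extends to a linear form `ε : 𝔤 → A` that vanishes on root vectors and on brackets
(`exists_extension`). Adding the scalars `ε(x)` to the operators of `x ∈ 𝔤` turns an action of `U_χ`
into another one: commutators do not change because `ε` kills brackets, and the relations for `e_α ^
p` do not change because `ε(e_α) = 0` (`Action.exists_twist`). The twist shifts the action of `𝔥` by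
`π` and leaves root vectors and pieces alone. Hence `Z_{A,χ}(λ)` is the twist by `ε` of `A ⊗
Z_{K,χ}(λ)` (`exists_verma_equiv`).

It remains to see that Hom and Ext¹ between such modules are nonzero over `A` exactly when they are
over `K`. Morphically, this is base change along the faithfully flat map `K → A`; concretely,
everything is expressed by maximal vectors. A nonzero morphism out of `Z(λ)` is a nonzero maximal
vector of weight `λ`, and an extension of `Z(λ)` splits iff the generator lifts to a maximal vector.
These are `K`-linear conditions, so they pass from `A ⊗ V` to `V` through the slices `s ⊗ id`, `s` a
linear form on `A`, and back through `v ↦ 1 ⊗ v`. This settles Hom (`homNonzero_iff_aug`) and the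
base change of non-split extensions (`extNonzero_of_aug`).

Conversely, let `E` be a non-split extension over `A` (`extNonzero_aug`). A graded `K`-linear
section defined on `Z_{K,χ}(λ)` gives a cocycle with values in `A ⊗ Z_{K,χ}(μ)`. Each slice of it is
a cocycle over `K`. If all the resulting extensions split, the corrections for the coordinate forms
of a basis of `A` assemble to a correction of the section, and `E` splits.

No basis theorem for `U_χ` is used. Finiteness of the baby Verma modules and independence of their
pieces are instead read off from the object `E` in which they occur; `exists_homogeneous_lift` is
the delicate point. -/

/-! ### Independent families of submodules -/

/-- The projections that belong to a direct sum decomposition into submodules. -/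
theorem exists_projections {ι R W : Type*} [Ring R] [AddCommGroup W] [Module R W]
    {Q : ι → Submodule R W} (hind : iSupIndep Q) (htop : ⨆ j, Q j = ⊤) :
    ∃ pr : ι → W →ₗ[R] W, (∀ j w, pr j w ∈ Q j) ∧ (∀ j, ∀ w ∈ Q j, pr j w = w) ∧
      (∀ i j, i ≠ j → ∀ w ∈ Q j, pr i w = 0) ∧
      (∀ w, ∃ s : Finset ι, (∀ j ∉ s, pr j w = 0) ∧ ∑ j ∈ s, pr j w = w) := by
  classical
  have hint : DirectSum.IsInternal Q :=
    DirectSum.isInternal_submodule_of_iSupIndep_of_iSup_eq_top hind htop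
  obtain ⟨e, he⟩ : ∃ e : (DirectSum ι fun i => Q i) ≃ₗ[R] W, ∀ z, e z = DirectSum.coeLinearMap Q z :=
    ⟨LinearEquiv.ofBijective (DirectSum.coeLinearMap Q) hint, fun _ => rfl⟩
  have hsymm : ∀ (j : ι) (w : W) (hw : w ∈ Q j),
      e.symm w = DirectSum.lof R ι (fun i => Q i) j ⟨w, hw⟩ := by
    intro j w hw
    rw [LinearEquiv.symm_apply_eq, he, DirectSum.coeLinearMap_lof]
  refine ⟨fun j => (Q j).subtype ∘ₗ DirectSum.component R ι (fun i => Q i) j ∘ₗ e.symm.toLinearMap,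
    fun j w => ?_, fun j w hw => ?_, fun i j hij w hw => ?_, fun w => ?_⟩
  · simp
  · simp [hsymm j w hw, DirectSum.component.lof_self]
  · simp [hsymm j w hw, DirectSum.component.of, hij.symm]
  · refine ⟨(e.symm w).support, fun j hj => ?_, ?_⟩
    · have : DirectSum.component R ι (fun i => Q i) j (e.symm w) = 0 := DFinsupp.notMem_support_iff.1 hj
      simp [this]
    · have h1 : e (e.symm w) = w := e.apply_symm_apply w
      rw [he, DirectSum.coeLinearMap_eq_dfinsuppSum, DFinsupp.sum] at h1
      exact h1

/-- Vectors on which commuting scalars act through pairwise distinct linear forms are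
independent. -/
theorem eq_zero_of_sum_weights {ι k V W : Type*} [Field k] [AddCommGroup V] [Module k V]
    [AddCommGroup W] [Module k W] (φ : ι → Module.Dual k V) (hφ : Function.Injective φ)
    (T : V → W →ₗ[k] W) (s : Finset ι) (w : ι → W)
    (hT : ∀ j ∈ s, ∀ x, T x (w j) = φ j x • w j) (hsum : ∑ j ∈ s, w j = 0) :
    ∀ j ∈ s, w j = 0 := by
  classical
  induction s using Finset.induction_on generalizing w with
  | empty => simp
  | insert a s ha ih =>
    have key : ∀ j ∈ s, w j = 0 := by
      intro j hj
      have hne : φ j ≠ φ a := fun h => ha (hφ h ▸ hj)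
      obtain ⟨x, hx⟩ : ∃ x, φ j x ≠ φ a x := by
        by_contra! h
        exact hne (LinearMap.ext h)
      -- Applying `T x - φ a x` to the relation removes the term of `a` and multiplies the term of
      -- `j` by a nonzero scalar.
      have h1 : ∑ i ∈ s, (φ i x - φ a x) • w i = 0 := by
        have h2 := congrArg (fun z => T x z - φ a x • z) hsum
        simp only [map_sum, map_zero, smul_zero, sub_zero, Finset.smul_sum] at h2
        rw [← Finset.sum_sub_distrib, Finset.sum_insert ha,
          hT a (Finset.mem_insert_self a s), sub_self, zero_add] at h2
        rw [← h2]
        refine Finset.sum_congr rfl fun i hi => ?_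
        rw [hT i (Finset.mem_insert_of_mem hi), sub_smul]
      have h3 := ih (fun i => (φ i x - φ a x) • w i)
        (fun i hi y => by rw [map_smul, hT i (Finset.mem_insert_of_mem hi), smul_comm]) h1 j hj
      exact (smul_eq_zero.1 h3).resolve_left (sub_ne_zero.2 hx)
    intro j hj
    rcases Finset.mem_insert.1 hj with rfl | hj
    · rw [Finset.sum_insert ha, Finset.sum_eq_zero key, add_zero] at hsum
      exact hsum
    · exact key j hj

namespace LeviDatum

variable {K : Type u} [Field K] {n : ℕ} (D : LeviDatum K n)

/-! ### Brackets of root vectors -/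

/-- The matrix identity `t Y = α(t) Y t` on `T` is differentiated at the identity in the direction
`x`: each entry gives a regular function vanishing on `T`, where `α` is represented by a polynomial
`F` with `F(1) = 1`. -/
theorem lie_h_weightSpace {α : D.X} {y : D.g} (hy : y ∈ weightSpace D.G D.T α) (x : D.h) :
    ⁅(x : D.g), y⁆ = D.d α x • y := by
  obtain ⟨F, hF⟩ := α.exists_poly
  have hF1 : evalAt (1 : GL (Fin n) K) F = 1 := by
    rw [← Chars.val_one α]
    exact (hF 1).symm
  have hd : D.d α x = evalAt 1 (invDer ((x : D.g) : Matrix (Fin n) (Fin n) K) F) :=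
    diffFun_eq α ⟨((x : D.g) : Matrix (Fin n) (Fin n) K), x.2⟩ F hF
  apply Subtype.ext
  set Y : Matrix (Fin n) (Fin n) K := (y : Matrix (Fin n) (Fin n) K) with hY
  set x' : Matrix (Fin n) (Fin n) K := ((x : D.g) : Matrix (Fin n) (Fin n) K) with hx'
  rw [LieSubalgebra.coe_bracket, SetLike.val_smul, Ring.lie_def, ← hY, ← hx']
  have hcomm : ∀ t : D.T, ((t : GL (Fin n) K) : Matrix (Fin n) (Fin n) K) * Y =
      α.val t • (Y * ((t : GL (Fin n) K) : Matrix (Fin n) (Fin n) K)) := by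
    intro t
    have h1 := hy t
    rw [← Matrix.smul_mul, ← h1, mul_assoc, ← Units.val_mul, inv_mul_cancel, Units.val_one,
      mul_one]
  ext i j
  have hmem : (∑ k, Y k j • MvPolynomial.X (Sum.inl (i, k)) -
      F * ∑ k, Y i k • MvPolynomial.X (Sum.inl (k, j)) : Coord K n) ∈ vanishing D.T := by
    rw [mem_vanishing]
    intro t ht
    have := congrFun (congrFun (hcomm ⟨t, ht⟩) i) j
    simp only [Matrix.mul_apply, Matrix.smul_apply, smul_eq_mul] at this
    simp only [map_sub, map_mul, ← hF ⟨t, ht⟩]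
    simp only [evalAt, map_sum, map_smul, MvPolynomial.aeval_X, Sum.elim_inl, smul_eq_mul]
    rw [← this, sub_eq_zero]
    exact Finset.sum_congr rfl fun k _ => mul_comm _ _
  have h2 := x.2 _ hmem
  rw [map_sub, Derivation.leibniz, map_sub, map_add, smul_eq_mul, smul_eq_mul, map_mul, map_mul,
    hF1, one_mul] at h2
  change _ - (_ + _ * evalAt 1 (invDer x' F)) = (0 : K) at h2
  rw [← hd] at h2
  simp only [invDer, evalAt, map_sum, Derivation.map_smul, map_smul,
    MvPolynomial.mkDerivation_X, MvPolynomial.aeval_X, Sum.elim_inl, smul_eq_mul,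
    Units.val_one, Matrix.one_apply, mul_ite, mul_one, mul_zero,
    Finset.sum_ite_eq, Finset.sum_ite_eq', Finset.mem_univ, if_true] at h2
  simp only [Matrix.sub_apply, Matrix.mul_apply, Matrix.smul_apply, smul_eq_mul]
  rw [sub_eq_zero] at h2
  have h3 : ∑ k, x' i k * Y k j = ∑ k, Y k j * x' i k :=
    Finset.sum_congr rfl fun k _ => mul_comm _ _
  rw [h3]
  refine sub_eq_iff_eq_add.2 (Eq.trans h2 ?_)
  rw [mul_comm (Y i j)]
  exact add_comm _ _

theorem lie_h_e {α : D.X} (hα : α ∈ D.R) (x : D.h) :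
    ⁅(x : D.g), D.e α⁆ = D.d α x • D.e α :=
  D.lie_h_weightSpace (D.e_mem α hα) x

theorem lie_mem_weightSpace {α β : D.X} {x y : D.g} (hx : x ∈ weightSpace D.G D.T α)
    (hy : y ∈ weightSpace D.G D.T β) : ⁅x, y⁆ ∈ weightSpace D.G D.T (α + β) := by
  intro t
  have h1 := hx t
  have h2 := hy t
  have conj : ∀ a b : Matrix (Fin n) (Fin n) K,
      ((t : GL (Fin n) K) : Matrix (Fin n) (Fin n) K) * (a * b) *
        (((t : GL (Fin n) K)⁻¹ : GL (Fin n) K) : Matrix (Fin n) (Fin n) K) =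
      (((t : GL (Fin n) K) : Matrix (Fin n) (Fin n) K) * a *
        (((t : GL (Fin n) K)⁻¹ : GL (Fin n) K) : Matrix (Fin n) (Fin n) K)) *
      (((t : GL (Fin n) K) : Matrix (Fin n) (Fin n) K) * b *
        (((t : GL (Fin n) K)⁻¹ : GL (Fin n) K) : Matrix (Fin n) (Fin n) K)) := by
    intro a b
    have : (((t : GL (Fin n) K)⁻¹ : GL (Fin n) K) : Matrix (Fin n) (Fin n) K) *
        ((t : GL (Fin n) K) : Matrix (Fin n) (Fin n) K) = 1 := by
      rw [← Units.val_mul, inv_mul_cancel, Units.val_one]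
    simp only [mul_assoc]
    rw [← mul_assoc _ ((t : GL (Fin n) K) : Matrix (Fin n) (Fin n) K) (b * _), this, one_mul]
  rw [LieSubalgebra.coe_bracket, Ring.lie_def, mul_sub, sub_mul, conj, conj, h1, h2,
    Chars.val_add, smul_sub]
  simp only [Matrix.mul_smul, Matrix.smul_mul, smul_smul]
  rw [mul_comm (Chars.val β t)]

/-- Weight spaces of nonzero weight lie in the span of the root vectors. -/
theorem weightSpace_le_span {β : D.X} (hβ : β ≠ 0) :
    weightSpace D.G D.T β ≤ Submodule.span K (D.e '' D.R) := by
  intro x hx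
  have htop : x ∈ Submodule.span K (D.e '' D.R) ⊔ (cartan D.G D.T).toSubmodule := by
    rw [D.e_isCompl.sup_eq_top]
    trivial
  obtain ⟨s, hs, y, hy, rfl⟩ := Submodule.mem_sup.1 htop
  -- Conjugation by `t` preserves the span of the root vectors and fixes `𝔥` pointwise. For `x = s +
  -- y` of weight `β` this puts `(β(t) - 1) y` into the intersection of the two complements, so `y =
  -- 0`.
  obtain ⟨t, ht⟩ : ∃ t, β.val t ≠ 1 := by
    by_contra! h
    exact hβ (Chars.ext_val fun t => by rw [h t, Chars.val_zero])
  have hconj : ∀ s ∈ Submodule.span K (D.e '' D.R), ∃ s' ∈ Submodule.span K (D.e '' D.R),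
      ((t : GL (Fin n) K) : Matrix (Fin n) (Fin n) K) * s *
        (((t : GL (Fin n) K)⁻¹ : GL (Fin n) K) : Matrix (Fin n) (Fin n) K) =
          (s' : Matrix (Fin n) (Fin n) K) := by
    intro s hs
    induction hs using Submodule.span_induction with
    | mem z hz =>
      obtain ⟨α, hα, rfl⟩ := hz
      exact ⟨α.val t • D.e α, Submodule.smul_mem _ _ (Submodule.subset_span ⟨α, hα, rfl⟩),
        D.e_mem α hα t⟩
    | zero => exact ⟨0, zero_mem _, by simp⟩
    | add a b _ _ ha hb =>
      obtain ⟨a', ha', ha⟩ := ha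
      obtain ⟨b', hb', hb⟩ := hb
      exact ⟨a' + b', add_mem ha' hb', by
        rw [AddMemClass.coe_add, AddMemClass.coe_add, mul_add, add_mul, ha, hb]⟩
    | smul r a _ ha =>
      obtain ⟨a', ha', ha⟩ := ha
      exact ⟨r • a', Submodule.smul_mem _ _ ha', by
        rw [SetLike.val_smul, SetLike.val_smul, Matrix.mul_smul, Matrix.smul_mul, ha]⟩
  obtain ⟨s', hs', hss'⟩ := hconj s hs
  have hy0 : ((t : GL (Fin n) K) : Matrix (Fin n) (Fin n) K) * (y : Matrix (Fin n) (Fin n) K) *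
      (((t : GL (Fin n) K)⁻¹ : GL (Fin n) K) : Matrix (Fin n) (Fin n) K) = y := by
    rw [D.h_comm_torus hy t.2, mul_assoc, ← Units.val_mul, mul_inv_cancel, Units.val_one, mul_one]
  have h1 := hx t
  rw [AddMemClass.coe_add, mul_add, add_mul, hss', hy0] at h1
  have h2 : s' + y = β.val t • (s + y) := Subtype.ext h1
  have h3 : (β.val t - 1) • y = s' - β.val t • s := by
    rw [sub_smul, one_smul, sub_eq_sub_iff_add_eq_add, ← smul_add, add_comm y, h2.symm]
  have h4 : (β.val t - 1) • y ∈ Submodule.span K (D.e '' D.R) ⊓ (cartan D.G D.T).toSubmodule :=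
    ⟨h3 ▸ sub_mem hs' (Submodule.smul_mem _ _ hs), Submodule.smul_mem _ _ hy⟩
  rw [D.e_isCompl.inf_eq_bot, Submodule.mem_bot, smul_eq_zero] at h4
  rw [h4.resolve_left (sub_ne_zero.2 ht), add_zero]
  exact hs

theorem mem_weightSpace {H T : Subgroup (GL (Fin n) K)} {c : Chars T} {x : lieAlg H} :
    x ∈ weightSpace H T c ↔ ∀ t : T, ((t : GL (Fin n) K) : Matrix (Fin n) (Fin n) K) * x *
      (((t : GL (Fin n) K)⁻¹ : GL (Fin n) K) : Matrix (Fin n) (Fin n) K) =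
        c.val t • (x : Matrix (Fin n) (Fin n) K) := Iff.rfl

theorem lieAlg_mono {H H' : Subgroup (GL (Fin n) K)} (h : H ≤ H') : lieAlg H ≤ lieAlg H' := by
  intro x hx
  rw [mem_lieAlg] at hx ⊢
  intro f hf
  refine hx f ?_
  rw [mem_vanishing] at hf ⊢
  exact fun g hg => hf g (h hg)

theorem Rpos_subset_R : D.Rpos ⊆ D.R := by
  rintro α ⟨h0, hα⟩
  refine ⟨h0, ?_⟩
  obtain ⟨x, hx, hx0⟩ := (Submodule.ne_bot_iff _).1 hα
  refine (Submodule.ne_bot_iff _).2 ⟨⟨x, lieAlg_mono D.borel.prop.1 x.2⟩, ?_, fun h => hx0 ?_⟩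
  · rw [mem_weightSpace] at hx ⊢
    exact hx
  · have h1 : (x : Matrix (Fin n) (Fin n) K) = 0 := by
      rw [Subtype.ext_iff, ZeroMemClass.coe_zero] at h
      exact h
    rw [Subtype.ext_iff, ZeroMemClass.coe_zero, h1]

theorem finite_R : D.R.Finite := by
  have : Finite D.R := D.e_linearIndependent.finite_of_isNoetherian
  exact Set.toFinite _

/-- Induction along `𝔤 = 𝔥 ⊕ ⨁ K e_α`. -/
theorem g_induction {P : D.g → Prop} (hh : ∀ x : D.h, P x) (he : ∀ α ∈ D.R, P (D.e α))
    (hadd : ∀ x y, P x → P y → P (x + y)) (hsmul : ∀ (k : K) x, P x → P (k • x)) (x : D.g) :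
    P x := by
  have htop : x ∈ Submodule.span K (D.e '' D.R) ⊔ (cartan D.G D.T).toSubmodule := by
    rw [D.e_isCompl.sup_eq_top]
    trivial
  obtain ⟨s, hs, y, hy, rfl⟩ := Submodule.mem_sup.1 htop
  refine hadd _ _ ?_ (hh ⟨y, hy⟩)
  clear htop
  induction hs using Submodule.span_induction with
  | mem z hz =>
    obtain ⟨α, hα, rfl⟩ := hz
    exact he α hα
  | zero => simpa using hh 0
  | add a b _ _ ha hb => exact hadd _ _ ha hb
  | smul r a _ ha => exact hsmul _ _ ha

/-- A linear map on `𝔥` that vanishes on all `h_α` extends to a linear map on `𝔤` that vanishes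
on all root vectors and on all brackets. -/
theorem exists_extension {V : Type*} [AddCommGroup V] [Module K V] (f : D.h →ₗ[K] V)
    (hf : ∀ (α : D.X) (hα : α ∈ D.R) (hα' : -α ∈ D.R),
      f ⟨⁅D.e α, D.e (-α)⁆, D.lie_e_mem_h hα hα'⟩ = 0) :
    ∃ ε : D.g →ₗ[K] V, (∀ x : D.h, ε x = f x) ∧ (∀ α ∈ D.R, ε (D.e α) = 0) ∧
      ∀ x y : D.g, ε ⁅x, y⁆ = 0 := by
  let q := Submodule.projectionOnto _ _ D.e_isCompl.symm
  let ε : D.g →ₗ[K] V := f ∘ₗ q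
  have h1 : ∀ x : D.h, ε x = f x := fun x =>
    congrArg f (Submodule.projectionOnto_apply_left D.e_isCompl.symm x)
  have h2 : ∀ y ∈ Submodule.span K (D.e '' D.R), ε y = 0 := fun y hy => by
    have : q y = 0 := Submodule.projectionOnto_apply_right D.e_isCompl.symm ⟨y, hy⟩
    simp [ε, this]
  have h3 : ∀ α ∈ D.R, ε (D.e α) = 0 := fun α hα => h2 _ (Submodule.subset_span ⟨α, hα, rfl⟩)
  -- Brackets are checked on the decomposition of `𝔤`: those inside `𝔥` are zero, `[x, e_β]` is a
  -- multiple of `e_β`, and `[e_α, e_β]` either has nonzero weight and lies in the span of root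
  -- vectors, or equals `h_α`. Only this last case uses `hf`.
  refine ⟨ε, h1, h3, fun x => ?_⟩
  refine D.g_induction (P := fun x => ∀ y, ε ⁅x, y⁆ = 0) (fun x => ?_) (fun α hα => ?_)
    (fun x x' hx hx' y => by rw [add_lie, map_add, hx, hx', add_zero])
    (fun k x hx y => by rw [smul_lie, map_smul, hx, smul_zero]) x
  · refine D.g_induction (fun y => ?_) (fun β hβ => ?_)
      (fun y y' hy hy' => by rw [lie_add, map_add, hy, hy', add_zero])
      (fun k y hy => by rw [lie_smul, map_smul, hy, smul_zero])
    · have := congrArg Subtype.val (D.h_lie_eq_zero x y)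
      rw [LieSubalgebra.coe_bracket] at this
      rw [this]
      exact map_zero ε
    · rw [D.lie_h_e hβ, map_smul, h3 β hβ, smul_zero]
  · refine D.g_induction (fun y => ?_) (fun β hβ => ?_)
      (fun y y' hy hy' => by rw [lie_add, map_add, hy, hy', add_zero])
      (fun k y hy => by rw [lie_smul, map_smul, hy, smul_zero])
    · rw [← lie_skew, D.lie_h_e hα, map_neg, map_smul, h3 α hα, smul_zero, neg_zero]
    · by_cases hαβ : α + β = 0
      · obtain rfl : β = -α := (neg_eq_of_add_eq_zero_right hαβ).symm
        have := h1 ⟨⁅D.e α, D.e (-α)⁆, D.lie_e_mem_h hα hβ⟩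
        exact this.trans (hf α hα hβ)
      · exact h2 _ (D.weightSpace_le_span hαβ
          (D.lie_mem_weightSpace (D.e_mem α hα) (D.e_mem β hβ)))

end LeviDatum

/-! ### Induction on enveloping algebras -/

/-- The elements satisfying `P` form a subalgebra through which `ι` factors; by the universal
property the identity factors through it as well. -/
theorem UniversalEnvelopingAlgebra.induction_adjoin {k L : Type*} [CommRing k] [LieRing L]
    [LieAlgebra k L] {P : UniversalEnvelopingAlgebra k L → Prop}
    (halg : ∀ r, P (algebraMap k _ r)) (hι : ∀ x, P (UniversalEnvelopingAlgebra.ι k x))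
    (hadd : ∀ a b, P a → P b → P (a + b)) (hmul : ∀ a b, P a → P b → P (a * b))
    (u : UniversalEnvelopingAlgebra k L) : P u := by
  let S : Subalgebra k (UniversalEnvelopingAlgebra k L) :=
    { carrier := {u | P u}
      mul_mem' := fun ha hb => hmul _ _ ha hb
      add_mem' := fun ha hb => hadd _ _ ha hb
      algebraMap_mem' := halg }
  let f : L →ₗ⁅k⁆ S :=
    { toFun := fun x => ⟨UniversalEnvelopingAlgebra.ι k x, hι x⟩
      map_add' := fun x y => Subtype.ext (by simp)
      map_smul' := fun r x => Subtype.ext (by simp)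
      map_lie' := fun {x y} => Subtype.ext (by
        change UniversalEnvelopingAlgebra.ι k ⁅x, y⁆ = _
        rw [LieHom.map_lie, Ring.lie_def, Ring.lie_def]
        rfl) }
  have h1 : S.val.comp (UniversalEnvelopingAlgebra.lift k f) = AlgHom.id k _ := by
    ext x
    simp [f]
  have h2 := DFunLike.congr_fun h1 u
  rw [AlgHom.id_apply] at h2
  rw [← h2]
  exact (UniversalEnvelopingAlgebra.lift k f u).2

namespace LeviDatum

variable {K : Type u} [Field K] {n : ℕ} {D : LeviDatum K n} {p : ℕ}

/-! ### Generation of `U_χ` by words -/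

theorem Uχ_induction {P : D.Uχ p → Prop} (halg : ∀ r : K, P (algebraMap K _ r))
    (hgen : ∀ x, P (D.gen p x)) (hadd : ∀ a b, P a → P b → P (a + b))
    (hmul : ∀ a b, P a → P b → P (a * b)) (u : D.Uχ p) : P u := by
  obtain ⟨w, rfl⟩ := RingQuot.mkAlgHom_surjective K (D.Rel p) u
  induction w using UniversalEnvelopingAlgebra.induction_adjoin with
  | halg r => simpa using halg r
  | hι x => exact hgen x
  | hadd a b ha hb => simpa using hadd _ _ ha hb
  | hmul a b ha hb => simpa using hmul _ _ ha hb

theorem gen_e_pow {α : D.X} (hα : α ∈ D.R) :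
    D.gen p (D.e α) ^ p = algebraMap K _ (D.χ (D.e α) ^ p) := by
  have := RingQuot.mkAlgHom_rel K (Rel.pow (p := p) α hα)
  rw [map_pow, AlgHom.commutes] at this
  exact this

variable (D p) in
/-- Products of elements of `𝔥` and of root vectors, with the classes in `X / ℤI` and the
differentials of the roots summed up. -/
inductive Word : D.Uχ p → D.Gr → Module.Dual K D.h → Prop
  | one : Word 1 0 0
  | h_mul (x : D.h) {u : D.Uχ p} {c : D.Gr} {φ : Module.Dual K D.h} : Word u c φ →
      Word (D.gen p (x : D.g) * u) c φ
  | e_mul (α : D.X) (hα : α ∈ D.R) {u : D.Uχ p} {c : D.Gr} {φ : Module.Dual K D.h} : Word u c φ →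
      Word (D.gen p (D.e α) * u) (D.cls α + c) (φ + D.d α)

/-- The action is a bare function because the lemma serves both the given action on an object and a
twisted action on the same carrier. -/
theorem Word.mem {W : Type*} {act : D.Uχ p → W → W} (h1 : ∀ w, act 1 w = w)
    (hmul : ∀ u v w, act (u * v) w = act u (act v w)) {Q : D.Gr → Module.Dual K D.h → Set W}
    (hh : ∀ (x : D.h) c φ, ∀ w ∈ Q c φ, act (D.gen p (x : D.g)) w ∈ Q c φ)
    (he : ∀ α ∈ D.R, ∀ c φ, ∀ w ∈ Q c φ,
      act (D.gen p (D.e α)) w ∈ Q (D.cls α + c) (φ + D.d α))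
    {u : D.Uχ p} {c : D.Gr} {φ : Module.Dual K D.h} (hu : D.Word p u c φ)
    {c' : D.Gr} {φ' : Module.Dual K D.h} {w : W} (hw : w ∈ Q c' φ') :
    act u w ∈ Q (c + c') (φ + φ') := by
  induction hu with
  | one => rwa [h1, zero_add, zero_add]
  | h_mul x _ ih =>
    rw [hmul]
    exact hh x _ _ _ ih
  | e_mul α hα _ ih =>
    rw [hmul, add_assoc, add_right_comm]
    exact he α hα _ _ _ ih

theorem Word.monomial {u : D.Uχ p} {c : D.Gr} {φ : Module.Dual K D.h} (hu : D.Word p u c φ) :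
    D.Monomial p u c := by
  induction hu with
  | one => exact .one
  | h_mul x _ ih => exact .h_mul x ih
  | e_mul α hα _ ih => exact .e_mul α hα ih

theorem Monomial.exists_word {u : D.Uχ p} {c : D.Gr} (hu : D.Monomial p u c) :
    ∃ φ, D.Word p u c φ := by
  induction hu with
  | one => exact ⟨_, .one⟩
  | h_mul x _ ih => exact ih.imp fun _ h => .h_mul x h
  | e_mul α hα _ ih =>
    obtain ⟨φ, h⟩ := ih
    exact ⟨_, .e_mul α hα h⟩

theorem gen_h_mul_gen (x : D.h) (y : D.g) :
    D.gen p (x : D.g) * D.gen p y = D.gen p y * D.gen p (x : D.g) + D.gen p ⁅(x : D.g), y⁆ := by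
  rw [LieHom.map_lie, Ring.lie_def]
  abel

/-- The commutator with `x ∈ 𝔥` is a derivation of `U_χ` that kills `𝔥` and multiplies `e_α` by
`dα(x)`. -/
theorem Word.mem_gradeWeight {u : D.Uχ p} {c : D.Gr} {φ : Module.Dual K D.h}
    (hu : D.Word p u c φ) : u ∈ D.gradeWeight p c φ := by
  refine ⟨Submodule.subset_span hu.monomial, fun x => ?_⟩
  induction hu with
  | one => simp
  | h_mul y _ ih =>
    have h0 : ⁅(x : D.g), (y : D.g)⁆ = 0 := by
      rw [← LieSubalgebra.coe_bracket, D.h_lie_eq_zero]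
      rfl
    rw [← mul_assoc, gen_h_mul_gen, h0, map_zero, add_zero, mul_assoc, mul_assoc, ← mul_sub, ih,
      mul_smul_comm]
  | e_mul α hα _ ih =>
    rw [← mul_assoc, gen_h_mul_gen, D.lie_h_e hα, map_smul, add_mul, mul_assoc, mul_assoc,
      add_sub_right_comm, ← mul_sub, ih, mul_smul_comm, smul_mul_assoc, LinearMap.add_apply,
      add_smul]

/-- The pieces of `U_χ` are spanned by words. -/
theorem gradeWeight_eq_span (c : D.Gr) (φ : Module.Dual K D.h) :
    D.gradeWeight p c φ = Submodule.span K {u | D.Word p u c φ} := by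
  classical
  apply le_antisymm
  · rintro u ⟨hu, hφ⟩
    have key : ∀ u ∈ D.grade p c, ∃ (s : Finset (Module.Dual K D.h))
        (w : Module.Dual K D.h → D.Uχ p), (∀ ψ, w ψ ∈ Submodule.span K {u | D.Word p u c ψ}) ∧
        (∀ ψ ∉ s, w ψ = 0) ∧ u = ∑ ψ ∈ s, w ψ := by
      intro u hu
      induction hu using Submodule.span_induction with
      | mem u hu =>
        obtain ⟨ψ, h⟩ := Monomial.exists_word hu
        refine ⟨{ψ}, Pi.single ψ u, fun ψ' => ?_, fun ψ' h' => ?_, by simp⟩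
        · by_cases h' : ψ' = ψ
          · subst h'
            rw [Pi.single_eq_same]
            exact Submodule.subset_span h
          · simp [h']
        · have : ψ' ≠ ψ := by simpa using h'
          simp [this]
      | zero => exact ⟨∅, 0, fun _ => zero_mem _, fun _ _ => rfl, by simp⟩
      | add a b _ _ ha hb =>
        obtain ⟨s, w, h1, h2, h3⟩ := ha
        obtain ⟨s', w', h1', h2', h3'⟩ := hb
        refine ⟨s ∪ s', w + w', fun ψ => add_mem (h1 ψ) (h1' ψ), fun ψ hψ => ?_, ?_⟩
        · rw [Finset.mem_union, not_or] at hψ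
          simp [h2 ψ hψ.1, h2' ψ hψ.2]
        · rw [h3, h3', Finset.sum_subset (Finset.subset_union_left (s₂ := s'))
            (fun ψ _ h => h2 ψ h), Finset.sum_subset (Finset.subset_union_right (s₁ := s))
            (fun ψ _ h => h2' ψ h), ← Finset.sum_add_distrib]
          rfl
      | smul r a _ ha =>
        obtain ⟨s, w, h1, h2, h3⟩ := ha
        refine ⟨s, r • w, fun ψ => Submodule.smul_mem (Submodule.span K {u | D.Word p u c ψ}) r (h1 ψ), fun ψ hψ => ?_, ?_⟩
        · simp [h2 ψ hψ]
        · simp [h3, Finset.smul_sum]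
    obtain ⟨s, w, h1, h2, h3⟩ := key u hu
    have h4 : ∀ ψ, w ψ ∈ D.gradeWeight p c ψ := fun ψ =>
      Submodule.span_le.2 (fun u hu => Word.mem_gradeWeight hu) (h1 ψ)
    -- Subtracting `u` in weight `φ` makes this a vanishing sum of weight vectors for the
    -- commutators with `𝔥`, so each term is zero and `u = w φ`. Inserting `φ` covers the case that
    -- it does not occur in `s`; then `w φ = 0`.
    have h5 : ∑ ψ ∈ insert φ s, (w ψ - if ψ = φ then u else 0) = 0 := by
      rw [Finset.sum_sub_distrib, Finset.sum_ite_eq', if_pos (Finset.mem_insert_self _ _),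
        ← Finset.sum_subset (Finset.subset_insert φ s) (fun ψ _ h => h2 ψ h), ← h3, sub_self]
    let T : D.h → D.Uχ p →ₗ[K] D.Uχ p := fun x =>
      LinearMap.mulLeft K (D.gen p (x : D.g)) - LinearMap.mulRight K (D.gen p (x : D.g))
    have h6 := eq_zero_of_sum_weights (fun ψ : Module.Dual K D.h => ψ) (fun _ _ h => h) T _ _
      (fun ψ _ x => by
        have := (h4 ψ).2 x
        simp only [T, LinearMap.sub_apply, LinearMap.mulLeft_apply, LinearMap.mulRight_apply]
        by_cases h : ψ = φ
        · subst h
          rw [if_pos rfl, smul_sub, ← this, ← hφ x, mul_sub, sub_mul]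
          abel
        · rw [if_neg h, sub_zero, this]) h5 φ (Finset.mem_insert_self _ _)
    rw [if_pos rfl, sub_eq_zero] at h6
    exact h6 ▸ h1 φ
  · exact Submodule.span_le.2 fun u hu => Word.mem_gradeWeight hu

/-- `U_χ` is spanned by words. -/
theorem span_words : Submodule.span K {u | ∃ c φ, D.Word p u c φ} = ⊤ := by
  set S := Submodule.span K {u | ∃ c φ, D.Word p u c φ} with hS
  -- The span of the words is stable under left multiplication by generators, hence is a left ideal,
  -- and it contains `1`.
  have hgen : ∀ x : D.g, ∀ u ∈ S, D.gen p x * u ∈ S := by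
    have hw : ∀ a : D.Uχ p, (∀ u c φ, D.Word p u c φ → ∃ c' φ', D.Word p (a * u) c' φ') →
        ∀ u ∈ S, a * u ∈ S := by
      intro a ha u hu
      have : S ≤ S.comap (LinearMap.mulLeft K a) := by
        rw [hS, Submodule.span_le]
        rintro u ⟨c, φ, h⟩
        exact Submodule.subset_span (ha u c φ h)
      exact this hu
    intro x
    refine D.g_induction (P := fun x => ∀ u ∈ S, D.gen p x * u ∈ S)
      (fun x => hw _ fun u c φ h => ⟨_, _, .h_mul x h⟩)
      (fun α hα => hw _ fun u c φ h => ⟨_, _, .e_mul α hα h⟩)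
      (fun x y hx hy u hu => ?_) (fun k x hx u hu => ?_) x
    · rw [map_add, add_mul]
      exact add_mem (hx u hu) (hy u hu)
    · rw [map_smul, smul_mul_assoc]
      exact S.smul_mem k (hx u hu)
  rw [eq_top_iff]
  rintro a -
  have : ∀ u ∈ S, a * u ∈ S := by
    induction a using Uχ_induction with
    | halg r =>
      intro u hu
      rw [← Algebra.smul_def]
      exact S.smul_mem r hu
    | hgen x => exact hgen x
    | hadd a b ha hb =>
      intro u hu
      rw [add_mul]
      exact add_mem (ha u hu) (hb u hu)
    | hmul a b ha hb =>
      intro u hu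
      rw [mul_assoc]
      exact ha _ (hb u hu)
  simpa using this 1 (Submodule.subset_span ⟨_, _, .one⟩)

/-! ### Actions of `U_χ` -/

variable (D p) in
/-- An action of `U_χ` on an `A`-module by `A`-linear maps. -/
structure Action (A W : Type*) [CommRing A] [Algebra K A] [AddCommGroup W] [Module A W] where
  hom : D.Uχ p →+* Module.End A W
  hom_algebraMap : ∀ k : K, hom (algebraMap K _ k) = algebraMap A _ (algebraMap K A k)

namespace Action

variable {A W : Type*} [CommRing A] [Algebra K A] [AddCommGroup W] [Module A W]

/-- The action that is given by the operators of the elements of `𝔤`. -/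
theorem exists_of_lie (r : D.g → Module.End A W) (hadd : ∀ x y, r (x + y) = r x + r y)
    (hsmul : ∀ (k : K) x, r (k • x) = algebraMap K A k • r x)
    (hlie : ∀ x y : D.g, r ⁅x, y⁆ = r x * r y - r y * r x)
    (hpow : ∀ α ∈ D.R, r (D.e α) ^ p = algebraMap A _ (algebraMap K A (D.χ (D.e α) ^ p))) :
    ∃ a : D.Action p A W, ∀ x, a.hom (D.gen p x) = r x := by
  let _ : Module K W := Module.compHom W (algebraMap K A)
  have : IsScalarTower K A W := ⟨fun k a w => by
    rw [Algebra.smul_def, mul_smul]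
    rfl⟩
  have halg : ∀ k : K, algebraMap K (Module.End A W) k = algebraMap A _ (algebraMap K A k) := by
    intro k
    rfl
  let f : D.g →ₗ⁅K⁆ Module.End A W :=
    { toFun := r
      map_add' := hadd
      map_smul' := hsmul
      map_lie' := fun {x y} => by rw [hlie, Ring.lie_def] }
  let F : D.Uχ p →ₐ[K] Module.End A W := RingQuot.liftAlgHom K
    ⟨UniversalEnvelopingAlgebra.lift K f, fun x y h => by
      obtain ⟨α, hα⟩ := h
      rw [map_pow, UniversalEnvelopingAlgebra.lift_ι_apply, AlgHom.commutes, halg]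
      exact hpow α hα⟩
  refine ⟨⟨F, fun k => ?_⟩, fun x => ?_⟩
  · exact (F.commutes k).trans (halg k)
  · change F (D.gen p x) = r x
    have : F (D.gen p x) = UniversalEnvelopingAlgebra.lift K f (UniversalEnvelopingAlgebra.ι K x) :=
      RingQuot.liftAlgHom_mkAlgHom_apply ..
    rw [this, UniversalEnvelopingAlgebra.lift_ι_apply]
    rfl

/-- Twisting an action by a linear form on `𝔤` that vanishes on brackets and root vectors. -/
theorem exists_twist [Fact p.Prime] (a : D.Action p A W) (ε : D.g →ₗ[K] A)
    (he : ∀ α ∈ D.R, ε (D.e α) = 0) (hlie : ∀ x y : D.g, ε ⁅x, y⁆ = 0) :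
    ∃ b : D.Action p A W,
      ∀ x, b.hom (D.gen p x) = a.hom (D.gen p x) + algebraMap A _ (ε x) := by
  -- The added operators are scalars, so they drop out of commutators, in accordance with `ε ⁅x, y⁆
  -- = 0`; they are zero for root vectors, so the relations for p-th powers persist.
  refine exists_of_lie (fun x => a.hom (D.gen p x) + algebraMap A _ (ε x)) (fun x y => ?_)
    (fun k x => ?_) (fun x y => ?_) (fun α hα => ?_)
  · simp only [map_add]
    abel
  · have : D.gen p (k • x) = algebraMap K _ k * D.gen p x := by
      rw [map_smul, Algebra.smul_def]
    rw [this, map_mul, a.hom_algebraMap, map_smul, Algebra.smul_def k, map_mul,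
      Algebra.smul_def, mul_add]
  · have h1 := Algebra.commutes (ε x) (a.hom (D.gen p y))
    have h2 := Algebra.commutes (ε y) (a.hom (D.gen p x))
    have h3 := Algebra.commutes (ε x) (algebraMap A (Module.End A W) (ε y))
    rw [hlie, map_zero, add_zero, LieHom.map_lie, Ring.lie_def, map_sub, map_mul, map_mul]
    simp only [mul_add, add_mul, h1, h2, h3]
    abel
  · rw [he α hα, map_zero, add_zero, ← map_pow, gen_e_pow hα, a.hom_algebraMap]

/-- A map that is compatible with the operators of `𝔥` and of the root vectors is compatible with
the whole actions. -/
theorem map_hom {A' W' : Type*} [CommRing A'] [Algebra K A'] [AddCommGroup W'] [Module A' W']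
    (a : D.Action p A W) (a' : D.Action p A' W') (f : W →+ W')
    (hK : ∀ (k : K) w, f (algebraMap K A k • w) = algebraMap K A' k • f w)
    (hh : ∀ (x : D.h) w, f (a.hom (D.gen p (x : D.g)) w) = a'.hom (D.gen p (x : D.g)) (f w))
    (he : ∀ α ∈ D.R, ∀ w, f (a.hom (D.gen p (D.e α)) w) = a'.hom (D.gen p (D.e α)) (f w))
    (u : D.Uχ p) (w : W) : f (a.hom u w) = a'.hom u (f w) := by
  induction u using Uχ_induction generalizing w with
  | halg r =>
    rw [a.hom_algebraMap, a'.hom_algebraMap]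
    exact hK r w
  | hgen x =>
    refine D.g_induction (P := fun x => ∀ w, f (a.hom (D.gen p x) w) = a'.hom (D.gen p x) (f w))
      hh he (fun x y hx hy w => ?_) (fun k x hx w => ?_) x w
    · simp only [map_add, LinearMap.add_apply, hx, hy]
    · have : D.gen p (k • x) = algebraMap K _ k * D.gen p x := by
        rw [map_smul, Algebra.smul_def]
      rw [this, map_mul, map_mul, Module.End.mul_apply, Module.End.mul_apply, a.hom_algebraMap,
        a'.hom_algebraMap, ← hx]
      exact hK k _
  | hadd u v hu hv => simp only [map_add, LinearMap.add_apply, hu, hv]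
  | hmul u v hu hv => simp only [map_mul, Module.End.mul_apply, hu, hv]

/-- The action on the base change of a vector space. -/
noncomputable def baseChange (A : Type*) [CommRing A] [Algebra K A] {V : Type*} [AddCommGroup V]
    [Module K V] (a : D.Action p K V) : D.Action p A (A ⊗[K] V) where
  hom := (Module.End.baseChangeHom K A V).toRingHom.comp a.hom
  hom_algebraMap k := by
    rw [RingHom.comp_apply, a.hom_algebraMap]
    refine LinearMap.ext fun z => ?_
    induction z with
    | zero => simp
    | add z w hz hw => simp only [map_add, hz, hw]
    | tmul b v =>
      simp [Module.algebraMap_end_apply]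

@[simp]
theorem baseChange_hom_tmul (A : Type*) [CommRing A] [Algebra K A] {V : Type*} [AddCommGroup V]
    [Module K V] (a : D.Action p K V) (x : D.Uχ p) (b : A) (v : V) :
    (a.baseChange A).hom x (b ⊗ₜ v) = b ⊗ₜ a.hom x v := rfl

/-- Restriction of scalars to the ground field. -/
noncomputable def restrict [Module K W] [IsScalarTower K A W] (a : D.Action p A W) : D.Action p K W where
  hom :=
    { toFun := fun x => (a.hom x).restrictScalars K
      map_one' := by rw [map_one]; rfl
      map_mul' := fun x y => by rw [map_mul]; rfl
      map_zero' := by rw [map_zero]; rfl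
      map_add' := fun x y => by rw [map_add]; rfl }
  hom_algebraMap k := by
    refine LinearMap.ext fun w => ?_
    change a.hom (algebraMap K _ k) w = k • w
    rw [a.hom_algebraMap, Module.algebraMap_end_apply, algebraMap_smul]

/-- `U⁰` acts on a weight vector through the structure map. -/
theorem hom_ofU0 (a : D.Action p A W) (π : D.U0 →ₐ[K] A) (φ : Module.Dual K D.h) (w : W)
    (hw : ∀ x : D.h, a.hom (D.gen p (x : D.g)) w =
      (π (UniversalEnvelopingAlgebra.ι K x) + algebraMap K A (φ x)) • w) (s : D.U0) :
    a.hom (D.ofU0 p s) w = π (D.shift φ s) • w := by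
  induction s using UniversalEnvelopingAlgebra.induction_adjoin with
  | halg r =>
    rw [AlgHom.commutes, AlgHom.commutes, AlgHom.commutes, a.hom_algebraMap]
    rfl
  | hι x =>
    rw [ofU0, shift, UniversalEnvelopingAlgebra.lift_ι_apply,
      UniversalEnvelopingAlgebra.lift_ι_apply]
    have h1 : π (UniversalEnvelopingAlgebra.ι K x + algebraMap K D.U0 (φ x)) =
        π (UniversalEnvelopingAlgebra.ι K x) + algebraMap K A (φ x) := by
      rw [map_add, AlgHom.commutes]
    exact (hw x).trans (by rw [← h1]; rfl)
  | hadd s t hs ht => simp only [map_add, LinearMap.add_apply, hs, ht, add_smul]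
  | hmul s t hs ht =>
    rw [map_mul, map_mul, Module.End.mul_apply, ht, map_smul, hs, map_mul, map_mul, smul_smul,
      mul_comm]

end Action

end LeviDatum

namespace LeviDatum

variable {K : Type u} [Field K] {n : ℕ} {D : LeviDatum K n} {p : ℕ}
variable {A : Type v} [CommRing A] [Algebra K A]

theorem π_shift_ι (π : D.U0 →ₐ[K] A) (φ : Module.Dual K D.h) (x : D.h) :
    π (D.shift φ (UniversalEnvelopingAlgebra.ι K x)) =
      π (UniversalEnvelopingAlgebra.ι K x) + algebraMap K A (φ x) := by
  rw [shift, UniversalEnvelopingAlgebra.lift_ι_apply, ← AlgHom.commutes π, ← map_add]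
  rfl

theorem ofU0_ι (x : D.h) :
    D.ofU0 p (UniversalEnvelopingAlgebra.ι K x) = D.gen p (x : D.g) := by
  rw [ofU0, UniversalEnvelopingAlgebra.lift_ι_apply]
  rfl

/-! ### Weight conditions on objects -/

/-- The action of `U_χ` on an object. -/
noncomputable def PreObj.action (M : D.PreObj p A) : D.Action p A M.carrier where
  hom := Module.toModuleEnd A M.carrier
  hom_algebraMap k := LinearMap.ext fun m => M.algebraMap_smul k m

@[simp]
theorem PreObj.action_hom_apply (M : D.PreObj p A) (u : D.Uχ p) (m : M.carrier) :
    M.action.hom u m = u • m := rfl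

/-- The conditions on the action of `𝔥` and of the root vectors on the pieces of an object. -/
structure PreObj.IsWeight (π : D.U0 →ₐ[K] A) (M : D.PreObj p A) : Prop where
  h_smul : ∀ (c : D.Gr) (φ : Module.Dual K D.h) (x : D.h), ∀ m ∈ M.piece c φ,
    D.gen p (x : D.g) • m = (π (UniversalEnvelopingAlgebra.ι K x) + algebraMap K A (φ x)) • m
  e_smul : ∀ α ∈ D.R, ∀ (c : D.Gr) (φ : Module.Dual K D.h), ∀ m ∈ M.piece c φ,
    D.gen p (D.e α) • m ∈ M.piece (D.cls α + c) (φ + D.d α)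

theorem PreObj.IsObj.isWeight {π : D.U0 →ₐ[K] A} {M : D.PreObj p A} (hM : M.IsObj π) :
    M.IsWeight π where
  h_smul c φ x m hm := by
    have h := hM.U0_smul c φ (UniversalEnvelopingAlgebra.ι K x) m hm
    rwa [ofU0_ι, π_shift_ι] at h
  e_smul := hM.e_smul

namespace PreObj.IsWeight

variable {π : D.U0 →ₐ[K] A} {M : D.PreObj p A}

theorem word_smul_mem (hM : M.IsWeight π) {u : D.Uχ p} {c : D.Gr} {φ : Module.Dual K D.h}
    (hu : D.Word p u c φ) {c' : D.Gr} {φ' : Module.Dual K D.h} {m : M.carrier}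
    (hm : m ∈ M.piece c' φ') : u • m ∈ M.piece (c + c') (φ + φ') := by
  refine Word.mem (act := fun u (m : M.carrier) => u • m)
    (Q := fun c φ => (M.piece c φ : Set M.carrier)) (one_smul _) mul_smul ?_ hM.e_smul hu hm
  intro x c φ m hm
  change D.gen p (x : D.g) • m ∈ M.piece c φ
  rw [hM.h_smul c φ x m hm]
  exact Submodule.smul_mem _ _ hm

/-- The remaining conditions on an object follow from the weight conditions. -/
theorem isObj (hM : M.IsWeight π)
    (indep : iSupIndep fun i : D.Gr × Module.Dual K D.h => M.piece i.1 i.2)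
    (iSup_eq_top : ⨆ i : D.Gr × Module.Dual K D.h, M.piece i.1 i.2 = ⊤)
    (weights : ∀ c φ, M.piece c φ ≠ ⊥ → ∃ μ τ : D.X, D.cls (μ + p • τ) = c ∧ D.d μ = φ)
    (finite : {c | M.gradePiece c ≠ ⊥}.Finite) (fg : ∀ c, (M.gradePiece c).FG) : M.IsObj π where
  indep := indep
  iSup_eq_top := iSup_eq_top
  weights := weights
  finite := finite
  fg := fg
  grade_smul b c u hu m hm := by
    induction hu using Submodule.span_induction generalizing m with
    | mem u hu =>
      obtain ⟨ψ, hψ⟩ := Monomial.exists_word hu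
      have hle : M.gradePiece c ≤ (M.gradePiece (b + c)).comap (M.action.hom u) :=
        iSup_le fun φ m hm => (le_iSup (fun φ => M.piece (b + c) φ) (ψ + φ))
          (hM.word_smul_mem hψ hm)
      exact hle hm
    | zero =>
      rw [zero_smul]
      exact zero_mem _
    | add u v _ _ hu hv =>
      rw [add_smul]
      exact add_mem (hu m hm) (hv m hm)
    | smul r u _ hu =>
      rw [Algebra.smul_def, mul_smul, M.algebraMap_smul]
      exact Submodule.smul_mem _ _ (hu m hm)
  U0_smul c φ s m hm := M.action.hom_ofU0 π φ m (fun x => hM.h_smul c φ x m hm) s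
  e_smul := hM.e_smul

end PreObj.IsWeight

/-! ### The universal property of baby Verma modules -/

/-- The standard generator of a baby Verma module, as an element of the object. -/
noncomputable def hwVec (p : ℕ) (π : D.U0 →ₐ[K] A) (l : D.X) : (babyVerma p π l).carrier :=
  VermaModule.vec p π l

theorem span_smul_hwVec (π : D.U0 →ₐ[K] A) (l : D.X) :
    Submodule.span A {m | ∃ u : D.Uχ p, m = u • hwVec p π l} = ⊤ := by
  have key : ∀ m : VermaModule p π l,
      m ∈ Submodule.span A {m | ∃ u : D.Uχ p, m = u • VermaModule.vec p π l} := by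
    intro m
    obtain ⟨z, rfl⟩ := Submodule.Quotient.mk_surjective (vermaIdeal (p := p) π l) m
    induction z with
    | zero => exact zero_mem _
    | add z w hz hw => exact add_mem hz hw
    | tmul u a =>
      have h : (Submodule.Quotient.mk (u ⊗ₜ[K] a) : VermaModule p π l) =
          a • (u • VermaModule.vec p π l) := by
        rw [VermaModule.smulA_def, VermaModule.smulU_def, smul_smul,
          Algebra.TensorProduct.tmul_mul_tmul, one_mul, mul_one, VermaModule.vec]
        change _ = Submodule.Quotient.mk ((u ⊗ₜ[K] a) • (1 : D.Uχ p ⊗[K] A))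
        rw [smul_eq_mul, mul_one]
      exact h ▸ Submodule.smul_mem _ a (Submodule.subset_span ⟨u, rfl⟩)
  exact eq_top_iff.2 fun m _ => key m

theorem smul_vec_eq_zero (π : D.U0 →ₐ[K] A) (l : D.X) {z : D.Uχ p ⊗[K] A}
    (hz : z ∈ vermaIdeal (p := p) π l) : z • VermaModule.vec p π l = 0 := by
  change Submodule.Quotient.mk (z • (1 : D.Uχ p ⊗[K] A)) = _
  rw [smul_eq_mul, mul_one]
  exact (Submodule.Quotient.mk_eq_zero _).2 hz

theorem e_smul_hwVec (π : D.U0 →ₐ[K] A) (l : D.X) {α : D.X} (hα : α ∈ D.Rpos) :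
    D.gen p (D.e α) • hwVec p π l = 0 :=
  smul_vec_eq_zero π l (Submodule.subset_span (Or.inl ⟨α, hα, rfl⟩))

theorem h_smul_hwVec (π : D.U0 →ₐ[K] A) (l : D.X) (x : D.h) :
    D.gen p (x : D.g) • hwVec p π l =
      (π (UniversalEnvelopingAlgebra.ι K x) + algebraMap K A (D.d l x)) • hwVec p π l := by
  have h := smul_vec_eq_zero (p := p) π l
    (Submodule.subset_span (Or.inr ⟨UniversalEnvelopingAlgebra.ι K x, rfl⟩))
  rw [sub_smul, sub_eq_zero, ofU0_ι, π_shift_ι] at h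
  exact h

/-- The commuting actions of `U_χ` and `A` make `W` a module over the tensor product, and the
hypotheses say that `w` is annihilated by the generators of `vermaIdeal`. No grading of `W` is
involved: the lemma is also needed for twisted actions and for vectors whose class in `X / ℤI` is
not that of `l`. -/
theorem exists_verma_lift (π : D.U0 →ₐ[K] A) (l : D.X) {W : Type*} [AddCommGroup W]
    [Module A W] (a : D.Action p A W) (w : W)
    (he : ∀ α ∈ D.Rpos, a.hom (D.gen p (D.e α)) w = 0)
    (hh : ∀ x : D.h, a.hom (D.gen p (x : D.g)) w =
      (π (UniversalEnvelopingAlgebra.ι K x) + algebraMap K A (D.d l x)) • w) :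
    ∃ f : (babyVerma p π l).carrier →ₗ[A] W, f (hwVec p π l) = w ∧
      ∀ (u : D.Uχ p) m, f (u • m) = a.hom u (f m) := by
  let _ : Module K W := Module.compHom W (algebraMap K A)
  have : IsScalarTower K A W := ⟨fun k a w => by
    rw [Algebra.smul_def, mul_smul]
    rfl⟩
  let ρ : D.Uχ p →ₐ[K] Module.End A W :=
    { a.hom with commutes' := fun k => a.hom_algebraMap k }
  have hcomm : ∀ (u : D.Uχ p) (b : A),
      Commute (ρ u) (IsScalarTower.toAlgHom K A (Module.End A W) b) :=
    fun u b => (Algebra.commutes b (ρ u)).symm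
  obtain ⟨T, hT⟩ : ∃ T : D.Uχ p ⊗[K] A →ₐ[K] Module.End A W,
      ∀ (u : D.Uχ p) (b : A) (w : W), T (u ⊗ₜ b) w = a.hom u (b • w) := by
    refine ⟨Algebra.TensorProduct.lift ρ (IsScalarTower.toAlgHom K A (Module.End A W)) hcomm,
      fun u b w => ?_⟩
    rw [Algebra.TensorProduct.lift_tmul]
    rfl
  let _ : Module (D.Uχ p ⊗[K] A) W := Module.compHom W T.toRingHom
  have hsmul : ∀ (z : D.Uχ p ⊗[K] A) (w : W), z • w = T z w := fun _ _ => rfl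
  let f₀ : (D.Uχ p ⊗[K] A) →ₗ[D.Uχ p ⊗[K] A] W := LinearMap.toSpanSingleton _ W w
  have hker : vermaIdeal (p := p) π l ≤ LinearMap.ker f₀ := by
    rw [vermaIdeal, Submodule.span_le]
    rintro z (⟨α, hα, rfl⟩ | ⟨s, rfl⟩)
    · rw [SetLike.mem_coe, LinearMap.mem_ker, LinearMap.toSpanSingleton_apply, hsmul, hT, one_smul]
      exact he α hα
    · rw [SetLike.mem_coe, LinearMap.mem_ker, LinearMap.toSpanSingleton_apply, hsmul, map_sub,
        LinearMap.sub_apply, hT, hT, one_smul, map_one, Module.End.one_apply, sub_eq_zero]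
      exact a.hom_ofU0 π (D.d l) w hh s
  let f₁ : VermaModule p π l →ₗ[D.Uχ p ⊗[K] A] W := Submodule.liftQ _ f₀ hker
  have hA : ∀ (b : A) (m : VermaModule p π l), f₁ (b • m) = b • f₁ m := by
    intro b m
    rw [VermaModule.smulA_def, map_smul, hsmul, hT, map_one]
    rfl
  have hU : ∀ (u : D.Uχ p) (m : VermaModule p π l), f₁ (u • m) = a.hom u (f₁ m) := by
    intro u m
    rw [VermaModule.smulU_def, map_smul, hsmul, hT, one_smul]
  have hv : f₁ (VermaModule.vec p π l) = w := by
    change f₀ 1 = w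
    rw [LinearMap.toSpanSingleton_apply, one_smul]
  exact ⟨{ toFun := f₁, map_add' := f₁.map_add, map_smul' := hA }, hv, hU⟩

/-! ### The pieces of baby Verma modules -/

theorem babyVerma_piece_def (π : D.U0 →ₐ[K] A) (l : D.X) (c : D.Gr) (φ : Module.Dual K D.h) :
    (babyVerma p π l).piece c φ = Submodule.span A
      {m | ∃ w ∈ D.gradeWeight p (c - D.cls l) (φ - D.d l), m = w • hwVec p π l} := rfl

theorem PreObj.smul_smul_K (M : D.PreObj p A) (r : K) (u : D.Uχ p) (m : M.carrier) :
    (r • u) • m = algebraMap K A r • (u • m) := by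
  rw [Algebra.smul_def, mul_smul, M.algebraMap_smul]

/-- With words in place of weight elements, membership in a piece can be followed letter by letter.
-/
theorem babyVerma_piece (π : D.U0 →ₐ[K] A) (l : D.X) (c : D.Gr) (φ : Module.Dual K D.h) :
    (babyVerma p π l).piece c φ = Submodule.span A
      {m | ∃ w, D.Word p w (c - D.cls l) (φ - D.d l) ∧ m = w • hwVec p π l} := by
  rw [babyVerma_piece_def]
  apply le_antisymm
  · refine Submodule.span_le.2 ?_
    rintro m ⟨w, hw, rfl⟩
    rw [gradeWeight_eq_span] at hw
    induction hw using Submodule.span_induction with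
    | mem w hw => exact Submodule.subset_span ⟨w, hw, rfl⟩
    | zero =>
      rw [zero_smul]
      exact zero_mem _
    | add w w' _ _ h h' =>
      rw [add_smul]
      exact add_mem h h'
    | smul r w _ h =>
      rw [PreObj.smul_smul_K]
      exact Submodule.smul_mem _ _ h
  · refine Submodule.span_mono ?_
    rintro m ⟨w, hw, rfl⟩
    exact ⟨w, hw.mem_gradeWeight, rfl⟩

theorem word_smul_hwVec_mem (π : D.U0 →ₐ[K] A) (l : D.X) {u : D.Uχ p} {c : D.Gr}
    {φ : Module.Dual K D.h} (hu : D.Word p u c φ) :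
    u • hwVec p π l ∈ (babyVerma p π l).piece (c + D.cls l) (φ + D.d l) := by
  rw [babyVerma_piece, add_sub_cancel_right, add_sub_cancel_right]
  exact Submodule.subset_span ⟨u, hu, rfl⟩

theorem hwVec_mem_piece (π : D.U0 →ₐ[K] A) (l : D.X) :
    hwVec p π l ∈ (babyVerma p π l).piece (D.cls l) (D.d l) := by
  have := word_smul_hwVec_mem (p := p) π l .one
  rwa [one_smul, zero_add, zero_add] at this

/-- Commuting `x ∈ 𝔥` past a word adds the weight of the word to that of the generator. This needs
neither finiteness nor independence of the pieces. -/
theorem babyVerma_isWeight (π : D.U0 →ₐ[K] A) (l : D.X) : (babyVerma p π l).IsWeight π where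
  h_smul c φ x m hm := by
    rw [babyVerma_piece] at hm
    induction hm using Submodule.span_induction with
    | mem m hm =>
      obtain ⟨w, hw, rfl⟩ := hm
      have h1 := hw.mem_gradeWeight.2 x
      rw [sub_eq_iff_eq_add] at h1
      rw [smul_smul, h1, add_smul, PreObj.smul_smul_K, mul_smul, h_smul_hwVec, smul_comm w,
        ← add_smul, LinearMap.sub_apply, map_sub]
      congr 1
      abel
    | zero => rw [smul_zero, smul_zero]
    | add a b _ _ ha hb => rw [smul_add, smul_add, ha, hb]
    | smul r a _ ha => rw [smul_comm, ha, smul_comm]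
  e_smul α hα c φ m hm := by
    rw [babyVerma_piece] at hm
    induction hm using Submodule.span_induction with
    | mem m hm =>
      obtain ⟨w, hw, rfl⟩ := hm
      have := word_smul_hwVec_mem π l (Word.e_mul α hα hw)
      rw [mul_smul, add_assoc, sub_add_cancel, add_right_comm, sub_add_cancel] at this
      exact this
    | zero =>
      rw [smul_zero]
      exact zero_mem _
    | add a b _ _ ha hb =>
      rw [smul_add]
      exact add_mem ha hb
    | smul r a _ ha =>
      rw [smul_comm]
      exact Submodule.smul_mem _ _ ha

theorem babyVerma_iSup_eq_top (π : D.U0 →ₐ[K] A) (l : D.X) :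
    ⨆ i : D.Gr × Module.Dual K D.h, (babyVerma p π l).piece i.1 i.2 = ⊤ := by
  rw [eq_top_iff]
  refine (span_smul_hwVec (p := p) π l).ge.trans (Submodule.span_le.2 ?_)
  rintro m ⟨u, rfl⟩
  have hu : u ∈ Submodule.span K {u | ∃ c φ, D.Word p u c φ} := by
    rw [span_words]
    exact Submodule.mem_top
  induction hu using Submodule.span_induction with
  | mem u hu =>
    obtain ⟨c, φ, h⟩ := hu
    exact Submodule.mem_iSup_of_mem (c + D.cls l, φ + D.d l) (word_smul_hwVec_mem π l h)
  | zero =>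
    rw [zero_smul]
    exact zero_mem _
  | add w w' _ _ h h' =>
    rw [add_smul]
    exact add_mem h h'
  | smul r w _ h =>
    rw [PreObj.smul_smul_K]
    exact Submodule.smul_mem _ _ h

/-! ### Maximal vectors -/

/-- Vectors of weight `l` that are annihilated by the positive root vectors. -/
def PreObj.IsMaxVec (M : D.PreObj p A) (l : D.X) (v : M.carrier) : Prop :=
  v ∈ M.piece (D.cls l) (D.d l) ∧ ∀ α ∈ D.Rpos, D.gen p (D.e α) • v = 0

theorem hwVec_isMaxVec (π : D.U0 →ₐ[K] A) (l : D.X) :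
    (babyVerma p π l).IsMaxVec l (hwVec p π l) :=
  ⟨hwVec_mem_piece π l, fun _ hα => e_smul_hwVec π l hα⟩

theorem PreObj.IsMaxVec.map {M N : D.PreObj p A} {l : D.X} {v : M.carrier} (hv : M.IsMaxVec l v)
    (f : M.Mor N) : N.IsMaxVec l (f.toFun v) :=
  ⟨f.map_piece _ _ _ hv.1, fun α hα => by rw [← f.map_smulU, hv.2 α hα, map_zero]⟩

/-- The universal property gives the linear map; it preserves pieces because words shift the degrees
of the generator and of `v` in the same way. -/
theorem PreObj.IsMaxVec.exists_mor {π : D.U0 →ₐ[K] A} {M : D.PreObj p A} (hM : M.IsWeight π)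
    {l : D.X} {v : M.carrier} (hv : M.IsMaxVec l v) :
    ∃ f : (babyVerma p π l).Mor M, f.toFun (hwVec p π l) = v := by
  obtain ⟨f, hf, hfu⟩ := exists_verma_lift π l M.action v hv.2
    (fun x => hM.h_smul _ _ x v hv.1)
  refine ⟨⟨f, hfu, fun c φ m hm => ?_⟩, hf⟩
  have hle : (babyVerma p π l).piece c φ ≤ (M.piece c φ).comap f := by
    rw [babyVerma_piece, Submodule.span_le]
    rintro m ⟨w, hw, rfl⟩
    have := hM.word_smul_mem hw hv.1
    rw [sub_add_cancel, sub_add_cancel] at this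
    rw [SetLike.mem_coe, Submodule.mem_comap, hfu, hf]
    exact this
  exact hle hm

theorem babyVerma_hom_ext {π : D.U0 →ₐ[K] A} {l : D.X} {M : D.PreObj p A}
    {f g : (babyVerma p π l).carrier →ₗ[A] M.carrier}
    (hf : ∀ (u : D.Uχ p) m, f (u • m) = u • f m)
    (hg : ∀ (u : D.Uχ p) m, g (u • m) = u • g m)
    (h : f (hwVec p π l) = g (hwVec p π l)) : f = g := by
  refine LinearMap.ext_on (span_smul_hwVec (p := p) π l) ?_
  rintro _ ⟨u, rfl⟩
  rw [hf, hg, h]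

/-- Morphisms out of `Z(l)` are determined by the image of the generator, which may be any maximal
vector of weight `l`. -/
theorem homNonzero_iff (π : D.U0 →ₐ[K] A) (l m : D.X) :
    HomNonzero p π l m ↔ ∃ v, v ≠ 0 ∧ (babyVerma p π m).IsMaxVec l v := by
  constructor
  · rintro ⟨f, hf⟩
    refine ⟨f.toFun (hwVec p π l), fun h => hf ?_, (hwVec_isMaxVec π l).map f⟩
    refine babyVerma_hom_ext f.map_smulU (g := 0) (fun u m => ?_) h
    rw [LinearMap.zero_apply, LinearMap.zero_apply, smul_zero]
  · rintro ⟨v, hv0, hv⟩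
    obtain ⟨f, hf⟩ := hv.exists_mor (babyVerma_isWeight π m)
    refine ⟨f, fun h => hv0 ?_⟩
    rw [← hf, h]
    rfl

/-- Splitting becomes a system of linear conditions on one vector, the form in which it can be
sliced and assembled. -/
theorem exists_section_iff {π : D.U0 →ₐ[K] A} {l : D.X} {E : D.PreObj p A} (hE : E.IsWeight π)
    (q : E.Mor (babyVerma p π l)) :
    (∃ s : (babyVerma p π l).Mor E, q.toFun ∘ₗ s.toFun = LinearMap.id) ↔
      ∃ v, q.toFun v = hwVec p π l ∧ E.IsMaxVec l v := by
  constructor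
  · rintro ⟨s, hs⟩
    exact ⟨s.toFun (hwVec p π l), LinearMap.congr_fun hs _, (hwVec_isMaxVec π l).map s⟩
  · rintro ⟨v, hqv, hv⟩
    obtain ⟨s, hs⟩ := hv.exists_mor hE
    refine ⟨s, babyVerma_hom_ext (M := babyVerma p π l) (fun u m => ?_) (fun u m => rfl) ?_⟩
    · exact (congrArg q.toFun (s.map_smulU u m)).trans (q.map_smulU u _)
    · exact (congrArg q.toFun hs).trans hqv

end LeviDatum

/-! ### Slices of tensors -/

section Slice

variable {K : Type*} [Field K] {A : Type*} [CommRing A] [Algebra K A]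
  {V : Type*} [AddCommGroup V] [Module K V]

/-- The map `A ⊗ V → V` that is induced by a linear form on `A`. -/
noncomputable def slice (s : Module.Dual K A) (V : Type*) [AddCommGroup V] [Module K V] :
    A ⊗[K] V →ₗ[K] V :=
  (TensorProduct.lid K V).toLinearMap ∘ₗ s.rTensor V

@[simp]
theorem slice_tmul (s : Module.Dual K A) (b : A) (v : V) : slice s V (b ⊗ₜ v) = s b • v := rfl

theorem exists_eq_sum_slice {ι : Type*} (b : Module.Basis ι K A) (t : A ⊗[K] V) :
    ∃ J : Finset ι, (∀ i ∉ J, slice (b.coord i) V t = 0) ∧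
      ∑ i ∈ J, b i ⊗ₜ slice (b.coord i) V t = t := by
  classical
  induction t with
  | zero => exact ⟨∅, by simp⟩
  | tmul a v =>
    refine ⟨(b.repr a).support, fun i hi => ?_, ?_⟩
    · simp [Finsupp.notMem_support_iff.1 hi]
    · simp only [slice_tmul, Module.Basis.coord_apply, ← TensorProduct.smul_tmul,
        ← TensorProduct.sum_tmul]
      congr 1
      exact b.linearCombination_repr a
  | add t t' h h' =>
    obtain ⟨J, h1, h2⟩ := h
    obtain ⟨J', h1', h2'⟩ := h'
    refine ⟨J ∪ J', fun i hi => ?_, ?_⟩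
    · rw [Finset.mem_union, not_or] at hi
      rw [map_add, h1 i hi.1, h1' i hi.2, add_zero]
    · simp only [map_add, TensorProduct.tmul_add, Finset.sum_add_distrib]
      rw [← Finset.sum_subset (Finset.subset_union_left (s₂ := J'))
          (fun i _ h => by rw [h1 i h, TensorProduct.tmul_zero]),
        ← Finset.sum_subset (Finset.subset_union_right (s₁ := J))
          (fun i _ h => by rw [h1' i h, TensorProduct.tmul_zero]), h2, h2']

/-- The coordinate slices with respect to a basis of `A` are the coefficients of `t`. -/
theorem eq_zero_of_slice {t : A ⊗[K] V} (h : ∀ s, slice s V t = 0) : t = 0 := by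
  obtain ⟨J, -, h2⟩ := exists_eq_sum_slice (Module.Basis.ofVectorSpace K A) t
  rw [← h2]
  exact Finset.sum_eq_zero fun i _ => by rw [h, TensorProduct.tmul_zero]

theorem slice_smul (s : Module.Dual K A) (b : A) (t : A ⊗[K] V) :
    slice s V (b • t) = slice (s ∘ₗ LinearMap.mulLeft K b) V t := by
  induction t with
  | zero => simp
  | tmul a v => simp [TensorProduct.smul_tmul']
  | add t t' h h' => rw [smul_add, map_add, map_add, h, h']

theorem baseChange_le_of_tmul_mem {Q : Submodule K V} {P : Submodule A (A ⊗[K] V)}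
    (h : ∀ v ∈ Q, 1 ⊗ₜ v ∈ P) : Q.baseChange A ≤ P := by
  rw [Submodule.baseChange_eq_span, Submodule.span_le]
  rintro _ ⟨v, hv, rfl⟩
  exact h v hv

/-- A scalar from `A` can be absorbed into the linear form, so the induction runs over all `s` at
once. -/
theorem slice_mem {Q : Submodule K V} {t : A ⊗[K] V} (ht : t ∈ Q.baseChange A)
    (s : Module.Dual K A) : slice s V t ∈ Q := by
  rw [Submodule.baseChange_eq_span] at ht
  induction ht using Submodule.span_induction generalizing s with
  | mem t ht =>
    obtain ⟨v, hv, rfl⟩ := ht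
    exact Q.smul_mem _ hv
  | zero => simp
  | add t t' _ _ h h' =>
    rw [map_add]
    exact add_mem (h s) (h' s)
  | smul b t _ h =>
    rw [slice_smul]
    exact h _

theorem iSupIndep_baseChange {ι : Type*} {Q : ι → Submodule K V} (h : iSupIndep Q) :
    iSupIndep fun i => (Q i).baseChange A := by
  rw [iSupIndep_iff_finsetSum_eq_zero_imp_eq_zero] at h ⊢
  intro s v hv hsum i hi
  refine eq_zero_of_slice fun f => h s (fun i => slice f V (v i))
    (fun i hi => slice_mem (hv i hi) f) ?_ i hi
  rw [← map_sum, hsum, map_zero]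

theorem baseChange_iSup {ι : Type*} (Q : ι → Submodule K V) :
    (⨆ i, Q i).baseChange A = ⨆ i, (Q i).baseChange A := by
  apply le_antisymm
  · refine baseChange_le_of_tmul_mem fun v hv => ?_
    have : (⨆ i, Q i) ≤ ((⨆ i, (Q i).baseChange A).restrictScalars K).comap
        (TensorProduct.mk K A V 1) :=
      iSup_le fun i v hv => Submodule.mem_iSup_of_mem i
        (Submodule.tmul_mem_baseChange_of_mem (1 : A) hv)
    exact this hv
  · exact iSup_le fun i => baseChange_le_of_tmul_mem fun v hv =>
      Submodule.tmul_mem_baseChange_of_mem _ (le_iSup Q i hv)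

end Slice

namespace LeviDatum

variable {K : Type u} [Field K] {n : ℕ} {D : LeviDatum K n} {p : ℕ}
variable {A : Type v} [CommRing A] [Algebra K A]

/-! ### Base change from the ground field, with a twist -/

variable (D) in
/-- The augmentation `U⁰ → K`. -/
noncomputable def aug : D.U0 →ₐ[K] K := UniversalEnvelopingAlgebra.lift K 0

@[simp]
theorem aug_ι (x : D.h) : aug D (UniversalEnvelopingAlgebra.ι K x) = 0 := by
  rw [aug, UniversalEnvelopingAlgebra.lift_ι_apply]
  rfl

/-- The object that is given by an action and a family of submodules. -/
noncomputable def PreObj.ofAction {W : Type (max u v)} [AddCommGroup W] [Module A W]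
    (a : D.Action p A W) (piece : D.Gr → Module.Dual K D.h → Submodule A W) : D.PreObj p A :=
  letI : Module (D.Uχ p) W := Module.compHom W a.hom
  { carrier := W
    smulCommClass := ⟨fun u b m => (a.hom u).map_smul b m⟩
    algebraMap_smul := fun k m => LinearMap.congr_fun (a.hom_algebraMap k) m
    piece := piece }

theorem PreObj.ofAction_isWeight {π : D.U0 →ₐ[K] A} {W : Type (max u v)} [AddCommGroup W]
    [Module A W] {a : D.Action p A W} {piece : D.Gr → Module.Dual K D.h → Submodule A W}
    (hh : ∀ (c : D.Gr) (φ : Module.Dual K D.h) (x : D.h), ∀ m ∈ piece c φ,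
      a.hom (D.gen p (x : D.g)) m =
        (π (UniversalEnvelopingAlgebra.ι K x) + algebraMap K A (φ x)) • m)
    (he : ∀ α ∈ D.R, ∀ (c : D.Gr) (φ : Module.Dual K D.h), ∀ m ∈ piece c φ,
      a.hom (D.gen p (D.e α)) m ∈ piece (D.cls α + c) (φ + D.d α)) :
    (PreObj.ofAction a piece).IsWeight π := ⟨hh, he⟩

/-- `b` is obtained from the action `a` by base change and twisting by `ε`. -/
def IsTwistedBaseChange (ε : D.g →ₗ[K] A) {V : Type*} [AddCommGroup V] [Module K V]
    (a : D.Action p K V) (b : D.Action p A (A ⊗[K] V)) : Prop :=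
  ∀ x, b.hom (D.gen p x) = (a.baseChange A).hom (D.gen p x) + algebraMap A _ (ε x)

/-- Over the augmentation `x ∈ 𝔥` acts on a piece by the scalar `φ(x)`; the twist contributes
exactly the missing `π(x)` and leaves root vectors unchanged. -/
theorem baseChange_isWeight {π : D.U0 →ₐ[K] A} {ε : D.g →ₗ[K] A}
    (hεh : ∀ x : D.h, ε x = π (UniversalEnvelopingAlgebra.ι K x))
    (hεe : ∀ α ∈ D.R, ε (D.e α) = 0) {M : D.PreObj p K} (hM : M.IsWeight (aug D))
    {b : D.Action p A (A ⊗[K] M.carrier)} (hb : IsTwistedBaseChange ε M.action b) :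
    (PreObj.ofAction b fun c φ => (M.piece c φ).baseChange A).IsWeight π := by
  refine PreObj.ofAction_isWeight (fun c φ x m hm => ?_) (fun α hα c φ => ?_)
  · rw [hb, LinearMap.add_apply, hεh, Module.algebraMap_end_apply, add_smul, add_comm]
    congr 1
    rw [Submodule.baseChange_eq_span] at hm
    induction hm using Submodule.span_induction with
    | mem m hm =>
      obtain ⟨v, hv, rfl⟩ := hm
      rw [TensorProduct.mk_apply, Action.baseChange_hom_tmul, PreObj.action_hom_apply,
        hM.h_smul c φ x v hv, aug_ι, zero_add, Algebra.algebraMap_self_apply,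
        TensorProduct.tmul_smul, algebraMap_smul]
    | zero => simp
    | add z w _ _ hz hw => rw [map_add, hz, hw, smul_add]
    | smul r z _ hz => rw [map_smul, hz, smul_comm]
  · rw [hb, hεe α hα, map_zero, add_zero]
    have hle : (M.piece c φ).baseChange A ≤ ((M.piece (D.cls α + c) (φ + D.d α)).baseChange A).comap
        ((M.action.baseChange A).hom (D.gen p (D.e α))) :=
      baseChange_le_of_tmul_mem fun v hv =>
        Submodule.tmul_mem_baseChange_of_mem _ (hM.e_smul α hα c φ v hv)
    exact fun m hm => hle hm

/-- Baby Verma modules over `A` are twisted base changes of baby Verma modules over `K`. -/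
theorem exists_verma_equiv [Fact p.Prime] {π : D.U0 →ₐ[K] A} {ε : D.g →ₗ[K] A}
    (hεh : ∀ x : D.h, ε x = π (UniversalEnvelopingAlgebra.ι K x))
    (hεe : ∀ α ∈ D.R, ε (D.e α) = 0) (hεl : ∀ x y : D.g, ε ⁅x, y⁆ = 0) (l : D.X) :
    ∃ Ψ : A ⊗[K] (babyVerma p (aug D) l).carrier ≃ₗ[A] (babyVerma p π l).carrier,
      Ψ (1 ⊗ₜ hwVec p (aug D) l) = hwVec p π l ∧
      (∀ (x : D.g) t, Ψ (((babyVerma p (aug D) l).action.baseChange A).hom (D.gen p x) t) =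
        D.gen p x • Ψ t - ε x • Ψ t) ∧
      ∀ c φ t, Ψ t ∈ (babyVerma p π l).piece c φ ↔
        t ∈ ((babyVerma p (aug D) l).piece c φ).baseChange A := by
  set M := babyVerma p (aug D) l with hM
  set N := babyVerma p π l with hN
  have hMw : M.IsWeight (aug D) := babyVerma_isWeight _ _
  have hNw : N.IsWeight π := babyVerma_isWeight _ _
  -- The map `f` comes from the universal property over `A`, applied to `1 ⊗ v` in the twisted base
  -- change.
  obtain ⟨b, hb⟩ := (M.action.baseChange A).exists_twist ε hεe hεl
  obtain ⟨f, hf1, hfu⟩ := exists_verma_lift π l b ((1 : A) ⊗ₜ[K] hwVec p (aug D) l)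
    (fun α hα => by
      rw [hb, hεe α (D.Rpos_subset_R hα), map_zero, add_zero, Action.baseChange_hom_tmul,
        PreObj.action_hom_apply, e_smul_hwVec _ _ hα, TensorProduct.tmul_zero])
    (fun x => by
      rw [hb, LinearMap.add_apply, hεh, Module.algebraMap_end_apply, Action.baseChange_hom_tmul,
        PreObj.action_hom_apply, h_smul_hwVec, aug_ι, zero_add, Algebra.algebraMap_self_apply,
        TensorProduct.tmul_smul, add_smul, algebraMap_smul, add_comm])
  -- For the inverse, twisting by `-ε` removes `π` from the weight of the generator. The universal
  -- property over `K` then gives `g₀`, and `g` is its `A`-linear extension; `f` and `g` are inverse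
  -- to each other because they match generators.
  obtain ⟨b', hb'⟩ := N.action.exists_twist (-ε) (fun α hα => by simp [hεe α hα])
    (fun x y => by simp [hεl x y])
  let _ : Module K N.carrier := Module.compHom N.carrier (algebraMap K A)
  have : IsScalarTower K A N.carrier := ⟨fun k a w => by
    rw [Algebra.smul_def, mul_smul]
    rfl⟩
  obtain ⟨g₀, hg1, hgu⟩ := exists_verma_lift (aug D) l b'.restrict (hwVec p π l)
    (fun α hα => by
      change b'.hom _ _ = 0
      rw [hb', LinearMap.neg_apply, hεe α (D.Rpos_subset_R hα), neg_zero, map_zero, add_zero,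
        PreObj.action_hom_apply, e_smul_hwVec _ _ hα])
    (fun x => by
      change b'.hom _ _ = _
      rw [hb', LinearMap.add_apply, LinearMap.neg_apply, hεh, Module.algebraMap_end_apply,
        PreObj.action_hom_apply, h_smul_hwVec, aug_ι, zero_add, Algebra.algebraMap_self_apply,
        ← add_smul, add_neg_cancel_comm, algebraMap_smul])
  let g : A ⊗[K] M.carrier →ₗ[A] N.carrier := g₀.liftBaseChange A
  have hg : ∀ (r : A) (z : M.carrier), g (r ⊗ₜ z) = r • g₀ z := fun r z => by
    simp [g]
  have hggen : ∀ (x : D.g) t, g ((M.action.baseChange A).hom (D.gen p x) t) =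
      D.gen p x • g t - ε x • g t := by
    intro x t
    induction t with
    | zero => simp
    | add t t' h h' => simp only [map_add, h, h', smul_add]; abel
    | tmul r z =>
      rw [Action.baseChange_hom_tmul, hg, hg, PreObj.action_hom_apply, hgu]
      change r • b'.hom _ _ = _
      rw [hb', LinearMap.add_apply, LinearMap.neg_apply, Module.algebraMap_end_apply,
        PreObj.action_hom_apply, smul_add, neg_smul, smul_neg,
        smul_comm (D.gen p x) r, smul_comm (ε x) r, ← sub_eq_add_neg]
  have hgb : ∀ (u : D.Uχ p) t, g (b.hom u t) = u • g t := by
    have h0 : ∀ (x : D.g) t, g (b.hom (D.gen p x) t) = D.gen p x • g t := by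
      intro x t
      rw [hb, LinearMap.add_apply, map_add, hggen, Module.algebraMap_end_apply, map_smul,
        sub_add_cancel]
    exact Action.map_hom b N.action g.toAddMonoidHom (fun k w => g.map_smul _ w)
      (fun x w => h0 x w) (fun α _ w => h0 _ w)
  have hfb' : ∀ (u : D.Uχ p) m, f (b'.hom u m) = (M.action.baseChange A).hom u (f m) := by
    have h0 : ∀ (x : D.g) m, f (b'.hom (D.gen p x) m) =
        (M.action.baseChange A).hom (D.gen p x) (f m) := by
      intro x m
      rw [hb', LinearMap.add_apply, map_add, PreObj.action_hom_apply, hfu, hb,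
        LinearMap.add_apply, LinearMap.neg_apply, Module.algebraMap_end_apply,
        Module.algebraMap_end_apply, map_smul, neg_smul, add_neg_cancel_right]
    exact Action.map_hom b' (M.action.baseChange A) f.toAddMonoidHom (fun k w => f.map_smul _ w)
      (fun x w => h0 x w) (fun α _ w => h0 _ w)
  have hgf : g ∘ₗ f = LinearMap.id := by
    refine LinearMap.ext_on (span_smul_hwVec (p := p) π l) ?_
    rintro _ ⟨u, rfl⟩
    rw [LinearMap.comp_apply, hfu, hgb, hf1, hg, one_smul, hg1]
    rfl
  have hfg₀ : ∀ z, f (g₀ z) = 1 ⊗ₜ z := by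
    have : (f.restrictScalars K) ∘ₗ g₀ = TensorProduct.mk K A M.carrier 1 := by
      refine LinearMap.ext_on (span_smul_hwVec (p := p) (aug D) l) ?_
      rintro _ ⟨u, rfl⟩
      rw [LinearMap.comp_apply, hgu, hg1]
      change f (b'.hom u _) = _
      rw [hfb', hf1]
      rfl
    exact fun z => LinearMap.congr_fun this z
  have hfg : f ∘ₗ g = LinearMap.id := by
    refine LinearMap.ext fun t => ?_
    induction t with
    | zero => simp
    | add t t' h h' => rw [map_add, h, h', map_add]
    | tmul r z =>
      rw [LinearMap.comp_apply, hg, map_smul, hfg₀, TensorProduct.smul_tmul', smul_eq_mul, mul_one]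
      rfl
  have hgmem : ∀ c φ, (M.piece c φ).baseChange A ≤ (N.piece c φ).comap g := by
    intro c φ
    have hle : (babyVerma p (aug D) l).piece c φ ≤ ((N.piece c φ).restrictScalars K).comap g₀ := by
      rw [babyVerma_piece, Submodule.span_le]
      rintro _ ⟨w, hw, rfl⟩
      rw [SetLike.mem_coe, Submodule.mem_comap, hgu, hg1]
      -- Words act here through the untwisted action, which still respects the pieces since the two
      -- actions of `𝔥` differ by scalars.
      have := Word.mem (act := fun u (m : N.carrier) => b'.hom u m)
        (Q := fun c φ => (N.piece c φ : Set N.carrier)) (fun m => by simp)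
        (fun u v m => by simp) (fun x c φ m hm => ?_) (fun α hα c φ m hm => ?_) hw
        (hwVec_mem_piece π l)
      · rw [sub_add_cancel, sub_add_cancel] at this
        exact this
      · change b'.hom _ _ ∈ N.piece c φ
        rw [hb', LinearMap.add_apply, Module.algebraMap_end_apply, PreObj.action_hom_apply,
          hNw.h_smul c φ x m hm]
        exact add_mem (Submodule.smul_mem _ _ hm) (Submodule.smul_mem _ _ hm)
      · change b'.hom _ _ ∈ N.piece _ _
        rw [hb', LinearMap.neg_apply, hεe α hα, neg_zero, map_zero, add_zero]
        exact hNw.e_smul α hα c φ m hm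
    refine baseChange_le_of_tmul_mem fun z hz => ?_
    rw [Submodule.mem_comap, hg, one_smul]
    exact hle hz
  have hfmem : ∀ c φ, (babyVerma p π l).piece c φ ≤ ((M.piece c φ).baseChange A).comap f := by
    intro c φ
    have hBw := baseChange_isWeight hεh hεe hMw hb
    rw [babyVerma_piece, Submodule.span_le]
    rintro _ ⟨w, hw, rfl⟩
    rw [SetLike.mem_coe, Submodule.mem_comap, hfu, hf1]
    have := hBw.word_smul_mem hw (c' := D.cls l) (φ' := D.d l)
      (Submodule.tmul_mem_baseChange_of_mem (1 : A) (hwVec_mem_piece (aug D) l))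
    rw [sub_add_cancel, sub_add_cancel] at this
    exact this
  refine ⟨LinearEquiv.ofLinearMap g f hgf hfg, ?_, hggen,
    fun c φ t => ⟨fun h => ?_, fun h => hgmem c φ h⟩⟩
  · rw [LinearEquiv.coe_ofLinearMap, hg, one_smul, hg1]
  · have h1 := hfmem c φ h
    rwa [Submodule.mem_comap,
      show f (LinearEquiv.ofLinearMap g f hgf hfg t) = t from LinearMap.congr_fun hfg t] at h1

end LeviDatum

theorem slice_baseChange {K A V V' : Type*} [Field K] [CommRing A] [Algebra K A] [AddCommGroup V]
    [Module K V] [AddCommGroup V'] [Module K V'] (s : Module.Dual K A) (f : V →ₗ[K] V')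
    (t : A ⊗[K] V) : slice s V' (f.baseChange A t) = f (slice s V t) := by
  induction t with
  | zero => simp
  | add t t' h h' => simp only [map_add, h, h']
  | tmul a v => simp

namespace LeviDatum

variable {K : Type u} [Field K] {n : ℕ} {D : LeviDatum K n} {p : ℕ}
variable {A : Type v} [CommRing A] [Algebra K A]

theorem slice_baseChange_hom {V : Type*} [AddCommGroup V] [Module K V] (a : D.Action p K V)
    (s : Module.Dual K A) (u : D.Uχ p) (t : A ⊗[K] V) :
    slice s V ((a.baseChange A).hom u t) = a.hom u (slice s V t) :=
  slice_baseChange s (a.hom u) t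

/-! ### Homomorphisms -/

/-- Slices of a maximal vector are maximal vectors, and some slice of a nonzero tensor is nonzero;
conversely `1 ⊗ v` is maximal if `v` is. -/
theorem homNonzero_iff_aug [Fact p.Prime] [Nontrivial A] {π : D.U0 →ₐ[K] A} {ε : D.g →ₗ[K] A}
    (hεh : ∀ x : D.h, ε x = π (UniversalEnvelopingAlgebra.ι K x))
    (hεe : ∀ α ∈ D.R, ε (D.e α) = 0) (hεl : ∀ x y : D.g, ε ⁅x, y⁆ = 0) (l m : D.X) :
    HomNonzero p π l m ↔ HomNonzero p (aug D) l m := by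
  obtain ⟨Ψ, -, hΨ2, hΨ3⟩ := exists_verma_equiv (p := p) hεh hεe hεl m
  have hΨe : ∀ α ∈ D.Rpos, ∀ t,
      Ψ (((babyVerma p (aug D) m).action.baseChange A).hom (D.gen p (D.e α)) t) =
        D.gen p (D.e α) • Ψ t := by
    intro α hα t
    rw [hΨ2, hεe α (D.Rpos_subset_R hα), zero_smul, sub_zero]
  rw [homNonzero_iff, homNonzero_iff]
  constructor
  · rintro ⟨v, hv0, hv1, hv2⟩
    obtain ⟨t, rfl⟩ := Ψ.surjective v
    obtain ⟨s, hs⟩ : ∃ s, slice s _ t ≠ 0 := by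
      by_contra! h
      exact hv0 (by rw [eq_zero_of_slice h, map_zero])
    refine ⟨slice s _ t, hs, slice_mem ((hΨ3 _ _ _).1 hv1) s, fun α hα => ?_⟩
    have h1 := hv2 α hα
    rw [← hΨe α hα, LinearEquiv.map_eq_zero_iff] at h1
    have h2 := slice_baseChange_hom (babyVerma p (aug D) m).action s (D.gen p (D.e α)) t
    rw [h1, map_zero] at h2
    exact h2.symm
  · rintro ⟨v, hv0, hv1, hv2⟩
    refine ⟨Ψ (1 ⊗ₜ v), fun h => hv0 ?_,
      (hΨ3 _ _ _).2 (Submodule.tmul_mem_baseChange_of_mem _ hv1), fun α hα => ?_⟩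
    · obtain ⟨s, hs⟩ := Module.Projective.exists_dual_eq_one K (one_ne_zero (α := A))
      rw [LinearEquiv.map_eq_zero_iff] at h
      have := slice_tmul s (1 : A) v
      rw [h, map_zero, hs, one_smul] at this
      exact this.symm
    · rw [← hΨe α hα, Action.baseChange_hom_tmul, PreObj.action_hom_apply, hv2 α hα,
        TensorProduct.tmul_zero, map_zero]

/-! ### Base change of extensions -/

theorem baseChange_isObj {π : D.U0 →ₐ[K] A} {ε : D.g →ₗ[K] A}
    (hεh : ∀ x : D.h, ε x = π (UniversalEnvelopingAlgebra.ι K x))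
    (hεe : ∀ α ∈ D.R, ε (D.e α) = 0) {M : D.PreObj p K} (hM : M.IsObj (aug D))
    {b : D.Action p A (A ⊗[K] M.carrier)} (hb : IsTwistedBaseChange ε M.action b) :
    (PreObj.ofAction b fun c φ => (M.piece c φ).baseChange A).IsObj π := by
  have hgp : ∀ c, (PreObj.ofAction b fun c φ => (M.piece c φ).baseChange A).gradePiece c =
      (M.gradePiece c).baseChange A := fun c => (baseChange_iSup _).symm
  refine (baseChange_isWeight hεh hεe hM.isWeight hb).isObj (iSupIndep_baseChange hM.indep) ?_
    (fun c φ h => hM.weights c φ fun h0 => h ?_) (hM.finite.subset fun c h h0 => h ?_)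
    (fun c => ?_)
  · refine (baseChange_iSup fun i : D.Gr × Module.Dual K D.h => M.piece i.1 i.2).symm.trans ?_
    rw [hM.iSup_eq_top, Submodule.baseChange_top]
    rfl
  · change (M.piece c φ).baseChange A = ⊥
    rw [h0, Submodule.baseChange_bot]
  · rw [hgp, h0, Submodule.baseChange_bot]
    rfl
  · obtain ⟨S, hS⟩ := hM.fg c
    rw [hgp, ← hS, Submodule.baseChange_span]
    exact Submodule.fg_span (S.finite_toSet.image _)

/-- Twisted base change keeps the sequence exact because `A` is flat over `K`. A splitting over `A`
would give a maximal vector over `1 ⊗ v`, and its slice by a form with `s(1) = 1` would split the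
original sequence. -/
theorem extNonzero_of_aug [Fact p.Prime] [Nontrivial A] {π : D.U0 →ₐ[K] A} {ε : D.g →ₗ[K] A}
    (hεh : ∀ x : D.h, ε x = π (UniversalEnvelopingAlgebra.ι K x))
    (hεe : ∀ α ∈ D.R, ε (D.e α) = 0) (hεl : ∀ x y : D.g, ε ⁅x, y⁆ = 0) {l m : D.X}
    (h : ExtNonzero p (aug D) l m) : ExtNonzero p π l m := by
  obtain ⟨E, hE, i, q, hi, hiq, hq, hns⟩ := h
  obtain ⟨Ψl, hΨl1, hΨl2, hΨl3⟩ := exists_verma_equiv (p := p) hεh hεe hεl l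
  obtain ⟨Ψm, -, hΨm2, hΨm3⟩ := exists_verma_equiv (p := p) hεh hεe hεl m
  obtain ⟨b, hb⟩ := (E.action.baseChange A).exists_twist ε hεe hεl
  have hE' := baseChange_isObj hεh hεe hE hb
  have hmap : ∀ {M N : D.PreObj p K} (f : M.Mor N) (u : D.Uχ p) t,
      f.toFun.baseChange A ((M.action.baseChange A).hom u t) =
        (N.action.baseChange A).hom u (f.toFun.baseChange A t) := by
    intro M N f u t
    induction t with
    | zero => simp
    | add t t' h h' => simp only [map_add, h, h']
    | tmul a v =>
      rw [Action.baseChange_hom_tmul, LinearMap.baseChange_tmul, LinearMap.baseChange_tmul,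
        Action.baseChange_hom_tmul, PreObj.action_hom_apply, f.map_smulU]
      rfl
  have hmem : ∀ {M N : D.PreObj p K} (f : M.Mor N) (c : D.Gr) (φ : Module.Dual K D.h),
      (M.piece c φ).baseChange A ≤ ((N.piece c φ).baseChange A).comap (f.toFun.baseChange A) :=
    fun f c φ => baseChange_le_of_tmul_mem fun v hv =>
      Submodule.tmul_mem_baseChange_of_mem _ (f.map_piece c φ v hv)
  let i₁ : (babyVerma p π m).carrier →ₗ[A] A ⊗[K] E.carrier :=
    i.toFun.baseChange A ∘ₗ Ψm.symm.toLinearMap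
  let q₁ : A ⊗[K] E.carrier →ₗ[A] (babyVerma p π l).carrier :=
    Ψl.toLinearMap ∘ₗ q.toFun.baseChange A
  -- The twists of source and target by the same `ε` cancel, so the base changed maps stay
  -- equivariant.
  have hi₁ : ∀ (u : D.Uχ p) z, i₁ (u • z) = b.hom u (i₁ z) := by
    have h0 : ∀ (x : D.g) z, i₁ (D.gen p x • z) = b.hom (D.gen p x) (i₁ z) := by
      intro x z
      obtain ⟨t, rfl⟩ := Ψm.surjective z
      have h1 : D.gen p x • Ψm t =
          Ψm (((babyVerma p (aug D) m).action.baseChange A).hom (D.gen p x) t + ε x • t) := by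
        rw [map_add, hΨm2, map_smul, sub_add_cancel]
      rw [h1, hb]
      simp only [i₁, LinearMap.comp_apply, LinearEquiv.coe_coe, LinearEquiv.symm_apply_apply,
        map_add, map_smul, hmap, LinearMap.add_apply, Module.algebraMap_end_apply]
    exact Action.map_hom (babyVerma p π m).action b i₁.toAddMonoidHom (fun k w => i₁.map_smul _ w)
      (fun x w => h0 x w) (fun α _ w => h0 _ w)
  have hq₁ : ∀ (u : D.Uχ p) t, q₁ (b.hom u t) = u • q₁ t := by
    have h0 : ∀ (x : D.g) t, q₁ (b.hom (D.gen p x) t) = D.gen p x • q₁ t := by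
      intro x t
      rw [hb]
      simp only [q₁, LinearMap.comp_apply, LinearEquiv.coe_coe, LinearMap.add_apply,
        map_add, hmap, hΨl2, Module.algebraMap_end_apply, map_smul, sub_add_cancel]
    exact Action.map_hom b (babyVerma p π l).action q₁.toAddMonoidHom (fun k w => q₁.map_smul _ w)
      (fun x w => h0 x w) (fun α _ w => h0 _ w)
  let E' := PreObj.ofAction b fun c φ => (E.piece c φ).baseChange A
  let i' : (babyVerma p π m).Mor E' := ⟨i₁, hi₁, fun c φ z hz => by
    obtain ⟨t, rfl⟩ := Ψm.surjective z
    have := hmem i c φ ((hΨm3 c φ t).1 hz)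
    change i.toFun.baseChange A (Ψm.symm (Ψm t)) ∈ (E.piece c φ).baseChange A
    rwa [LinearEquiv.symm_apply_apply]⟩
  let q' : E'.Mor (babyVerma p π l) := ⟨q₁, hq₁, fun c φ t ht =>
    (hΨl3 c φ _).2 (hmem q c φ ht)⟩
  have hex : Function.Exact (i.toFun.baseChange A) (q.toFun.baseChange A) := by
    have h1 : Function.Exact i.toFun q.toFun := LinearMap.exact_iff.2 hiq.symm
    exact lTensor_exact A h1 hq
  refine ⟨E', hE', i', q', ?_, ?_, ?_, ?_⟩
  · have h1 : Function.Injective (i.toFun.baseChange A) :=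
      Module.Flat.lTensor_preserves_injective_linearMap (M := A) i.toFun hi
    exact h1.comp Ψm.symm.injective
  · have h1 : LinearMap.range i₁ = LinearMap.ker q₁ := by
      rw [LinearMap.range_comp_of_range_eq_top _ (LinearEquiv.range _), LinearEquiv.ker_comp]
      exact (LinearMap.exact_iff.1 hex).symm
    exact h1
  · have h1 : Function.Surjective (q.toFun.baseChange A) := LinearMap.lTensor_surjective A hq
    exact Ψl.surjective.comp h1
  · rw [exists_section_iff hE'.isWeight]
    rintro ⟨v, hqv, hv1, hv2⟩
    refine hns ((exists_section_iff hE.isWeight q).2 ?_)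
    obtain ⟨s, hs⟩ := Module.Projective.exists_dual_eq_one K (one_ne_zero (α := A))
    have hv : ∃ t : A ⊗[K] E.carrier, q₁ t = hwVec p π l ∧
        t ∈ (E.piece (D.cls l) (D.d l)).baseChange A ∧
        ∀ α ∈ D.Rpos, b.hom (D.gen p (D.e α)) t = 0 := ⟨v, hqv, hv1, hv2⟩
    obtain ⟨t, ht1, ht2, ht3⟩ := hv
    refine ⟨slice s _ t, ?_, slice_mem ht2 s, fun α hα => ?_⟩
    · rw [← hΨl1] at ht1
      have h2 := slice_baseChange s q.toFun t
      rw [Ψl.injective ht1, slice_tmul, hs, one_smul] at h2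
      exact h2.symm
    · have h1 := ht3 α hα
      rw [hb, hεe α (D.Rpos_subset_R hα), map_zero, add_zero] at h1
      have h2 := slice_baseChange_hom E.action s (D.gen p (D.e α)) t
      rw [h1, map_zero] at h2
      exact h2.symm

end LeviDatum

namespace LeviDatum

variable {K : Type u} [Field K] {n : ℕ} {D : LeviDatum K n} {p : ℕ}
variable {A : Type v} [CommRing A] [Algebra K A]

/-! ### Gradings on extensions of baby Verma modules -/

section Extension

variable {π : D.U0 →ₐ[K] A} {l m : D.X} {E : D.PreObj p A}
  {i : (babyVerma p π m).Mor E} {q : E.Mor (babyVerma p π l)}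

/-- The kernel of an epimorphism is homogeneous if it is the image of a baby Verma module. -/
theorem exists_graded_projections (hE : E.IsObj π)
    (hiq : LinearMap.range i.toFun = LinearMap.ker q.toFun) :
    ∃ pr : D.Gr × Module.Dual K D.h → E.carrier →ₗ[A] E.carrier,
      (∀ j e, pr j e ∈ E.piece j.1 j.2) ∧ (∀ j, ∀ e ∈ E.piece j.1 j.2, pr j e = e) ∧
      (∀ k j, k ≠ j → ∀ e ∈ E.piece j.1 j.2, pr k e = 0) ∧
      (∀ e, ∃ s : Finset (D.Gr × Module.Dual K D.h), (∀ j ∉ s, pr j e = 0) ∧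
        ∑ j ∈ s, pr j e = e) ∧
      ∀ j e, q.toFun e = 0 → q.toFun (pr j e) = 0 := by
  obtain ⟨pr, h1, h2, h3, h4⟩ := exists_projections hE.indep hE.iSup_eq_top
  refine ⟨pr, h1, h2, h3, h4, fun j e he => ?_⟩
  have hqi : ∀ z, q.toFun (i.toFun z) = 0 := fun z =>
    LinearMap.mem_ker.1 (hiq ▸ LinearMap.mem_range_self i.toFun z)
  obtain ⟨z, rfl⟩ : e ∈ LinearMap.range i.toFun := hiq ▸ LinearMap.mem_ker.2 he
  -- The image of `i` is spanned by homogeneous elements, since the pieces of the baby Verma module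
  -- span it.
  have hle : (⊤ : Submodule A (babyVerma p π m).carrier) ≤
      LinearMap.ker (q.toFun ∘ₗ pr j ∘ₗ i.toFun) := by
    rw [← babyVerma_iSup_eq_top]
    refine iSup_le fun k z hz => ?_
    rw [LinearMap.mem_ker, LinearMap.comp_apply, LinearMap.comp_apply]
    have hz' := i.map_piece _ _ z hz
    by_cases hjk : j = k
    · subst hjk
      rw [h2 j _ hz', hqi]
    · rw [h3 j k hjk _ hz', map_zero]
  exact LinearMap.mem_ker.1 (hle (Submodule.mem_top (x := z)))

/-- The standard generator lifts to a vector of the same weight. -/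
theorem exists_homogeneous_lift (hE : E.IsObj π)
    (hiq : LinearMap.range i.toFun = LinearMap.ker q.toFun) (hq : Function.Surjective q.toFun) :
    ∃ v ∈ E.piece (D.cls l) (D.d l), q.toFun v = hwVec p π l := by
  classical
  obtain ⟨pr, h1, h2, h3, h4, h5⟩ := exists_graded_projections hE hiq
  -- The pieces of `Z(l)` are not known to be independent. The submodules `q(E_j)`, however, do
  -- grade the quotient, as the kernel of `q` is homogeneous. It has to be shown that the generator
  -- is homogeneous of degree `(l + ℤI, dl)` for this grading.
  obtain ⟨e, he⟩ := hq (hwVec p π l)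
  obtain ⟨s, hs0, hs⟩ := h4 e
  have hEw := hE.isWeight
  -- the components of the generator
  have hker : ∀ j e₁ e₂, q.toFun e₁ = q.toFun e₂ → q.toFun (pr j e₁) = q.toFun (pr j e₂) := by
    intro j e₁ e₂ h
    have := h5 j (e₁ - e₂) (by rw [map_sub, h, sub_self])
    rwa [map_sub, map_sub, sub_eq_zero] at this
  have hpr_h : ∀ j (x : D.h), pr j (D.gen p (x : D.g) • e) =
      (π (UniversalEnvelopingAlgebra.ι K x) + algebraMap K A (j.2 x)) • pr j e := by
    intro j x
    conv_lhs => rw [← hs, Finset.smul_sum, map_sum]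
    rw [Finset.sum_congr rfl (g := fun k => (π (UniversalEnvelopingAlgebra.ι K x) +
      algebraMap K A (j.2 x)) • pr j (pr k e)) (fun k _ => ?_), ← Finset.smul_sum, ← map_sum, hs]
    rw [hEw.h_smul _ _ x _ (h1 k e), map_smul]
    by_cases hjk : j = k
    · subst hjk
      rfl
    · rw [h3 j k hjk _ (h1 k e), smul_zero, smul_zero]
  have hpr_e : ∀ α ∈ D.R, ∀ j : D.Gr × Module.Dual K D.h,
      pr (D.cls α + j.1, j.2 + D.d α) (D.gen p (D.e α) • e) = D.gen p (D.e α) • pr j e := by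
    intro α hα j
    conv_lhs => rw [← hs, Finset.smul_sum, map_sum]
    have key : ∀ k, pr (D.cls α + j.1, j.2 + D.d α) (D.gen p (D.e α) • pr k e) =
        D.gen p (D.e α) • pr j (pr k e) := by
      intro k
      have hk := hEw.e_smul α hα _ _ _ (h1 k e)
      by_cases hjk : j = k
      · subst hjk
        rw [h2 j _ (h1 j e)]
        exact h2 (D.cls α + j.1, j.2 + D.d α) _ hk
      · rw [h3 j k hjk _ (h1 k e), smul_zero]
        refine h3 _ (D.cls α + k.1, k.2 + D.d α) (fun h => hjk ?_) _ hk
        rw [Prod.mk.injEq] at h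
        exact Prod.ext (add_left_cancel h.1) (add_right_cancel h.2)
    rw [Finset.sum_congr rfl (fun k _ => key k), ← Finset.smul_sum, ← map_sum, hs]
  have hye : ∀ j, ∀ α ∈ D.Rpos, D.gen p (D.e α) • q.toFun (pr j e) = 0 := by
    intro j α hα
    rw [← q.map_smulU, ← hpr_e α (D.Rpos_subset_R hα)]
    exact h5 _ _ (by rw [q.map_smulU, he, e_smul_hwVec _ _ hα])
  have hy0 : ∀ j : D.Gr × Module.Dual K D.h, j.2 ≠ D.d l → q.toFun (pr j e) = 0 := by
    intro j hj
    obtain ⟨x, hx⟩ : ∃ x, j.2 x ≠ D.d l x := by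
      by_contra! h
      exact hj (LinearMap.ext h)
    -- The generator has weight `dl`, so on its component of weight `j.2` the scalar `j.2 x - dl x`
    -- acts as zero; it is a nonzero element of `K`, hence a unit in `A`.
    have h6 := hker j (D.gen p (x : D.g) • e)
      ((π (UniversalEnvelopingAlgebra.ι K x) + algebraMap K A (D.d l x)) • e)
      (by rw [q.map_smulU, he, map_smul, he, h_smul_hwVec])
    rw [hpr_h, map_smul, map_smul, map_smul, ← sub_eq_zero, ← sub_smul, add_sub_add_left_eq_sub,
      ← map_sub] at h6
    have hu : IsUnit (algebraMap K A (j.2 x - D.d l x)) :=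
      (sub_ne_zero.2 hx).isUnit.map (algebraMap K A)
    exact hu.smul_eq_zero.1 h6
  let y : D.Gr → (babyVerma p π l).carrier := fun c => q.toFun (pr (c, D.d l) e)
  let S : Finset D.Gr := insert (D.cls l) (s.image Prod.fst)
  have hsum : ∑ c ∈ S, y c = hwVec p π l := by
    have hsub : s ⊆ S ×ˢ insert (D.d l) (s.image Prod.snd) := by
      intro j hj
      exact Finset.mem_product.2 ⟨Finset.mem_insert_of_mem (Finset.mem_image_of_mem _ hj),
        Finset.mem_insert_of_mem (Finset.mem_image_of_mem _ hj)⟩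
    rw [← he]
    conv_rhs => rw [← hs, map_sum]
    rw [Finset.sum_subset hsub (fun j _ hj => by rw [hs0 j hj, map_zero]), Finset.sum_product]
    refine Finset.sum_congr rfl fun c _ => ?_
    rw [Finset.sum_eq_single (D.d l) (fun φ _ hφ => hy0 (c, φ) hφ)
      (fun h => absurd (Finset.mem_insert_self _ _) h)]
  -- the endomorphisms that send the generator to its components
  have hf : ∀ c, ∃ f : (babyVerma p π l).carrier →ₗ[A] (babyVerma p π l).carrier,
      f (hwVec p π l) = y c ∧ ∀ (u : D.Uχ p) z, f (u • z) = u • f z := fun c =>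
    exists_verma_lift π l (babyVerma p π l).action (y c) (hye (c, D.d l))
      (fun x => (babyVerma_isWeight π l).h_smul c (D.d l) x _
        (q.map_piece _ _ _ (h1 (c, D.d l) e)))
  choose f hf1 hfu using hf
  have hfsum : ∑ c ∈ S, f c = LinearMap.id := by
    refine babyVerma_hom_ext (M := babyVerma p π l) (fun u z => ?_) (fun u z => rfl) ?_
    · simp only [LinearMap.sum_apply, hfu, Finset.smul_sum]
    · rw [LinearMap.sum_apply, Finset.sum_congr rfl (fun c _ => hf1 c), hsum]
      rfl
  -- An element of class `b` is a combination of words of class `b - l` on the generator; `f c`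
  -- replaces the generator by a vector of class `c`, which gives class `b - l + c` in the quotient
  -- grading.
  have hfpiece : ∀ c b, (babyVerma p π l).piece b (D.d l) ≤
      ((E.piece (b - D.cls l + c) (D.d l)).map q.toFun).comap (f c) := by
    intro c b
    rw [babyVerma_piece, Submodule.span_le]
    rintro _ ⟨w, hw, rfl⟩
    rw [SetLike.mem_coe, Submodule.mem_comap, hfu, hf1, ← q.map_smulU]
    have := hEw.word_smul_mem hw (h1 (c, D.d l) e)
    rw [sub_add_cancel] at this
    exact Submodule.mem_map_of_mem this
  -- In `y b = ∑ c, f c (y b)` the left side has degree `b` and the summand of `c` has degree `b - l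
  -- + c`; comparison in degree `b` leaves only `c = l`.
  have hfl : ∀ b, f (D.cls l) (y b) = y b := by
    intro b
    have hyb : y b ∈ (babyVerma p π l).piece b (D.d l) := q.map_piece _ _ _ (h1 (b, D.d l) e)
    have hex : ∀ c, ∃ e' ∈ E.piece (b - D.cls l + c) (D.d l), q.toFun e' = f c (y b) :=
      fun c => hfpiece c b hyb
    choose e' he' hqe' using hex
    have h6 : q.toFun (∑ c ∈ S, e' c) = q.toFun (pr (b, D.d l) e) := by
      rw [map_sum, Finset.sum_congr rfl (fun c _ => hqe' c), ← LinearMap.sum_apply, hfsum]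
      rfl
    have h7 := hker (b, D.d l) _ _ h6
    have hbl : b - D.cls l + D.cls l = b := sub_add_cancel _ _
    rw [map_sum, Finset.sum_eq_single (D.cls l), h2 (b, D.d l) _ (h1 (b, D.d l) e),
      h2 (b, D.d l) (e' (D.cls l)) (by simpa only [hbl] using he' (D.cls l)), hqe'] at h7
    · exact h7
    · intro c _ hc
      refine h3 _ (b - D.cls l + c, D.d l) (fun h => hc ?_) _ (he' c)
      rw [Prod.mk.injEq] at h
      have h8 := h.1
      rw [← hbl, add_sub_cancel_right] at h8
      exact (add_left_cancel h8).symm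
    · exact fun h => absurd (Finset.mem_insert_self _ _) h
  refine ⟨pr (D.cls l, D.d l) e, h1 (D.cls l, D.d l) e, ?_⟩
  -- The generator is the sum of the `y b`, so `f (D.cls l)` fixes it, whereas by definition it
  -- sends it to `y (D.cls l)`.
  have h6 : f (D.cls l) (hwVec p π l) = hwVec p π l := by
    conv_lhs => rw [← hsum, map_sum]
    rw [Finset.sum_congr rfl (fun b _ => hfl b), hsum]
  rw [hf1] at h6
  exact h6

theorem exists_lift_of_mem_piece (hE : E.IsObj π)
    (hiq : LinearMap.range i.toFun = LinearMap.ker q.toFun) (hq : Function.Surjective q.toFun)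
    {c : D.Gr} {φ : Module.Dual K D.h} {z : (babyVerma p π l).carrier}
    (hz : z ∈ (babyVerma p π l).piece c φ) : ∃ e ∈ E.piece c φ, q.toFun e = z := by
  obtain ⟨v, hv, hqv⟩ := exists_homogeneous_lift hE hiq hq
  have hle : (babyVerma p π l).piece c φ ≤ (E.piece c φ).map q.toFun := by
    rw [babyVerma_piece, Submodule.span_le]
    rintro _ ⟨w, hw, rfl⟩
    have := hE.isWeight.word_smul_mem hw hv
    rw [sub_add_cancel, sub_add_cancel] at this
    exact ⟨w • v, this, by rw [q.map_smulU, hqv]⟩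
  exact hle hz

/-- A relation between homogeneous elements lifts to a sum of homogeneous elements in the kernel of
`q`; by homogeneity of the kernel each summand lies in it. -/
theorem iSupIndep_of_quotient (hE : E.IsObj π)
    (hiq : LinearMap.range i.toFun = LinearMap.ker q.toFun) (hq : Function.Surjective q.toFun) :
    iSupIndep fun j : D.Gr × Module.Dual K D.h => (babyVerma p π l).piece j.1 j.2 := by
  classical
  obtain ⟨pr, h1, h2, h3, h4, h5⟩ := exists_graded_projections hE hiq
  rw [iSupIndep_iff_finsetSum_eq_zero_imp_eq_zero]
  intro s z hz hsum j hj
  have hex : ∀ k, ∃ e, k ∈ s → e ∈ E.piece k.1 k.2 ∧ q.toFun e = z k := by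
    intro k
    by_cases hk : k ∈ s
    · obtain ⟨e, he⟩ := exists_lift_of_mem_piece hE hiq hq (hz k hk)
      exact ⟨e, fun _ => he⟩
    · exact ⟨0, fun h => absurd h hk⟩
  choose e he using hex
  have h6 := h5 j (∑ k ∈ s, e k) (by
    rw [map_sum, Finset.sum_congr rfl (fun k hk => (he k hk).2), hsum])
  rw [map_sum, Finset.sum_eq_single j, h2 j _ (he j hj).1, (he j hj).2] at h6
  · exact h6
  · exact fun k hk hkj => h3 j k (Ne.symm hkj) _ (he k hk).1
  · exact fun h => absurd hj h

theorem iSupIndep_of_sub (hE : E.IsObj π) (hi : Function.Injective i.toFun) :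
    iSupIndep fun j : D.Gr × Module.Dual K D.h => (babyVerma p π m).piece j.1 j.2 := by
  have hind := hE.indep
  rw [iSupIndep_iff_finsetSum_eq_zero_imp_eq_zero] at hind ⊢
  intro s z hz hsum j hj
  refine (map_eq_zero_iff i.toFun hi).1 (hind s (fun k => i.toFun (z k))
    (fun k hk => i.map_piece _ _ _ (hz k hk)) ?_ j hj)
  rw [← map_sum, hsum, map_zero]

/-- Decomposing `z` into pieces shows that the `(c, φ)` component of `i z` comes from the piece of
degree `(c, φ)`; when `i z` is homogeneous of that degree, this component is `i z` itself. -/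
theorem mem_piece_of_map_mem (hE : E.IsObj π) (hi : Function.Injective i.toFun) {c : D.Gr}
    {φ : Module.Dual K D.h} {z : (babyVerma p π m).carrier} (hz : i.toFun z ∈ E.piece c φ) :
    z ∈ (babyVerma p π m).piece c φ := by
  obtain ⟨pr, h1, h2, h3, h4⟩ := exists_projections hE.indep hE.iSup_eq_top
  have hle : (⊤ : Submodule A (babyVerma p π m).carrier) ≤
      (((babyVerma p π m).piece c φ).map i.toFun).comap (pr (c, φ) ∘ₗ i.toFun) := by
    rw [← babyVerma_iSup_eq_top]
    refine iSup_le fun k z hz => ?_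
    rw [Submodule.mem_comap, LinearMap.comp_apply]
    have hz' := i.map_piece _ _ z hz
    by_cases hk : (c, φ) = k
    · subst hk
      rw [h2 (c, φ) _ hz']
      exact Submodule.mem_map_of_mem hz
    · rw [h3 _ k hk _ hz']
      exact zero_mem _
  obtain ⟨z', hz', h⟩ := hle (Submodule.mem_top (x := z))
  rw [LinearMap.comp_apply, h2 (c, φ) _ hz] at h
  exact hi h ▸ hz'

theorem PreObj.IsObj.module_finite (hE : E.IsObj π) : Module.Finite A E.carrier := by
  have h1 : (⊤ : Submodule A E.carrier) = ⨆ c ∈ hE.finite.toFinset, E.gradePiece c := by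
    refine le_antisymm ?_ le_top
    rw [← hE.iSup_eq_top]
    refine iSup_le fun j => ?_
    by_cases hj : E.gradePiece j.1 = ⊥
    · have : E.piece j.1 j.2 ≤ E.gradePiece j.1 := le_iSup (fun φ => E.piece j.1 φ) j.2
      rw [hj] at this
      exact this.trans bot_le
    · refine (le_iSup (fun φ => E.piece j.1 φ) j.2).trans ?_
      exact le_biSup (fun c => E.gradePiece c) (hE.finite.mem_toFinset.2 hj)
  refine ⟨?_⟩
  rw [h1]
  exact Submodule.fg_biSup _ _ fun c _ => hE.fg c

end Extension

end LeviDatum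

namespace LeviDatum

variable {K : Type u} [Field K] {n : ℕ} {D : LeviDatum K n} {p : ℕ}
variable {A : Type v} [CommRing A] [Algebra K A]

/-! ### Extensions that are given by cocycles -/

/-- The action on `Y × Z` that is given by a cocycle. -/
noncomputable def Action.ofCocycle {Y Z : Type*} [AddCommGroup Y] [Module K Y] [AddCommGroup Z]
    [Module K Z] (a : D.Action p K Y) (a' : D.Action p K Z) (c : D.Uχ p → Z →ₗ[K] Y)
    (hadd : ∀ u w, c (u + w) = c u + c w)
    (hmul : ∀ u w z, c (u * w) z = a.hom u (c w z) + c u (a'.hom w z))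
    (halg : ∀ k : K, c (algebraMap K _ k) = 0) : D.Action p K (Y × Z) where
  hom :=
    { toFun := fun u => (a.hom u ∘ₗ LinearMap.fst K Y Z + c u ∘ₗ LinearMap.snd K Y Z).prod
        (a'.hom u ∘ₗ LinearMap.snd K Y Z)
      map_one' := by
        have h1 : c 1 = 0 := by rw [← map_one (algebraMap K (D.Uχ p)), halg]
        refine LinearMap.ext fun x => Prod.ext ?_ ?_ <;> simp [h1]
      map_mul' := fun u w => by
        refine LinearMap.ext fun x => Prod.ext ?_ ?_
        · simp [hmul, add_assoc]
        · simp
      map_zero' := by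
        have h0 : c 0 = 0 := by rw [← map_zero (algebraMap K (D.Uχ p)), halg]
        refine LinearMap.ext fun x => Prod.ext ?_ ?_ <;> simp [h0]
      map_add' := fun u w => by
        refine LinearMap.ext fun x => Prod.ext ?_ ?_
        · change a.hom (u + w) x.1 + c (u + w) x.2 =
            (a.hom u x.1 + c u x.2) + (a.hom w x.1 + c w x.2)
          rw [map_add, hadd, LinearMap.add_apply, LinearMap.add_apply, add_add_add_comm]
        · simp }
  hom_algebraMap k := by
    refine LinearMap.ext fun x => Prod.ext ?_ ?_
    · simp [halg, a.hom_algebraMap, Module.algebraMap_end_apply]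
    · simp [a'.hom_algebraMap, Module.algebraMap_end_apply]

theorem iSupIndep_prod {ι R V W : Type*} [Ring R] [AddCommGroup V] [Module R V] [AddCommGroup W]
    [Module R W] {P : ι → Submodule R V} {Q : ι → Submodule R W} (hP : iSupIndep P)
    (hQ : iSupIndep Q) : iSupIndep fun i => (P i).prod (Q i) := by
  rw [iSupIndep_iff_finsetSum_eq_zero_imp_eq_zero] at hP hQ ⊢
  intro s v hv hsum i hi
  refine Prod.ext (hP s (fun i => (v i).1) (fun i hi => (hv i hi).1) ?_ i hi)
    (hQ s (fun i => (v i).2) (fun i hi => (hv i hi).2) ?_ i hi)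
  · rw [← Prod.fst_sum, hsum]
    rfl
  · rw [← Prod.snd_sum, hsum]
    rfl

theorem iSup_prod_eq_top {ι R V W : Type*} [Ring R] [AddCommGroup V] [Module R V] [AddCommGroup W]
    [Module R W] {P : ι → Submodule R V} {Q : ι → Submodule R W} (hP : ⨆ i, P i = ⊤)
    (hQ : ⨆ i, Q i = ⊤) : ⨆ i, (P i).prod (Q i) = ⊤ := by
  rw [eq_top_iff]
  rintro ⟨v, w⟩ -
  have h1 : (⊤ : Submodule R V) ≤ (⨆ i, (P i).prod (Q i)).comap (LinearMap.inl R V W) := by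
    rw [← hP]
    exact iSup_le fun i v hv => Submodule.mem_iSup_of_mem i ⟨hv, zero_mem _⟩
  have h2 : (⊤ : Submodule R W) ≤ (⨆ i, (P i).prod (Q i)).comap (LinearMap.inr R V W) := by
    rw [← hQ]
    exact iSup_le fun i v hv => Submodule.mem_iSup_of_mem i ⟨zero_mem _, hv⟩
  have h3 : LinearMap.inl R V W v ∈ ⨆ i, (P i).prod (Q i) := h1 Submodule.mem_top
  have h4 : LinearMap.inr R V W w ∈ ⨆ i, (P i).prod (Q i) := h2 Submodule.mem_top
  simpa using add_mem h3 h4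

/-- The criterion for the extension of finite dimensional objects that is given by a cocycle to
be an object. -/
theorem ofCocycle_isObj {M N : D.PreObj p K} (hM : M.IsWeight (aug D)) (hN : N.IsWeight (aug D))
    [Module.Finite K M.carrier] [Module.Finite K N.carrier]
    (hMi : iSupIndep fun j : D.Gr × Module.Dual K D.h => M.piece j.1 j.2)
    (hMt : ⨆ j : D.Gr × Module.Dual K D.h, M.piece j.1 j.2 = ⊤)
    (hNi : iSupIndep fun j : D.Gr × Module.Dual K D.h => N.piece j.1 j.2)
    (hNt : ⨆ j : D.Gr × Module.Dual K D.h, N.piece j.1 j.2 = ⊤)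
    (hMw : ∀ c φ, M.piece c φ ≠ ⊥ → ∃ μ τ : D.X, D.cls (μ + p • τ) = c ∧ D.d μ = φ)
    (hNw : ∀ c φ, N.piece c φ ≠ ⊥ → ∃ μ τ : D.X, D.cls (μ + p • τ) = c ∧ D.d μ = φ)
    {c : D.Uχ p → N.carrier →ₗ[K] M.carrier} (hadd : ∀ u w, c (u + w) = c u + c w)
    (hmul : ∀ u w z, c (u * w) z = M.action.hom u (c w z) + c u (N.action.hom w z))
    (halg : ∀ k : K, c (algebraMap K _ k) = 0)
    (hh : ∀ (b : D.Gr) (φ : Module.Dual K D.h) (x : D.h), ∀ z ∈ N.piece b φ,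
      c (D.gen p (x : D.g)) z = 0)
    (he : ∀ α ∈ D.R, ∀ (b : D.Gr) (φ : Module.Dual K D.h), ∀ z ∈ N.piece b φ,
      c (D.gen p (D.e α)) z ∈ M.piece (D.cls α + b) (φ + D.d α)) :
    (PreObj.ofAction (Action.ofCocycle M.action N.action c hadd hmul halg)
      fun b φ => (M.piece b φ).prod (N.piece b φ)).IsObj (aug D) := by
  have hind := iSupIndep_prod hMi hNi
  refine (PreObj.ofAction_isWeight ?_ ?_).isObj hind (iSup_prod_eq_top hMt hNt) ?_ ?_ ?_
  · rintro b φ x ⟨y, z⟩ ⟨hy, hz⟩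
    refine Prod.ext ?_ ?_
    · change D.gen p (x : D.g) • y + c (D.gen p (x : D.g)) z = _ • y
      rw [hh b φ x z hz, add_zero, hM.h_smul b φ x y hy]
    · exact hN.h_smul b φ x z hz
  · rintro α hα b φ ⟨y, z⟩ ⟨hy, hz⟩
    exact ⟨add_mem (hM.e_smul α hα b φ y hy) (he α hα b φ z hz), hN.e_smul α hα b φ z hz⟩
  · intro b φ h
    by_contra hcon
    have h1 : M.piece b φ = ⊥ := by
      by_contra h0
      exact hcon (hMw b φ h0)
    have h2 : N.piece b φ = ⊥ := by
      by_contra h0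
      exact hcon (hNw b φ h0)
    refine h ?_
    change (M.piece b φ).prod (N.piece b φ) = ⊥
    rw [h1, h2, Submodule.prod_bot]
  -- In a finite dimensional space an independent family has only finitely many nonzero members.
  · have hfin := WellFoundedGT.finite_ne_bot_of_iSupIndep hind
    refine (hfin.image Prod.fst).subset fun b hb => ?_
    by_contra hcon
    refine hb (iSup_eq_bot.2 fun φ => ?_)
    by_contra h0
    exact hcon ⟨(b, φ), h0, rfl⟩
  · intro b
    have : IsNoetherian K (M.carrier × N.carrier) := inferInstance
    exact this.noetherian _

/-! ### Descent of gradings and finiteness along the twisted base change -/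

theorem iSupIndep_of_verma_equiv {π : D.U0 →ₐ[K] A} {l : D.X} [Nontrivial A]
    (Ψ : A ⊗[K] (babyVerma p (aug D) l).carrier ≃ₗ[A] (babyVerma p π l).carrier)
    (hΨ : ∀ c φ t, Ψ t ∈ (babyVerma p π l).piece c φ ↔
      t ∈ ((babyVerma p (aug D) l).piece c φ).baseChange A)
    (h : iSupIndep fun j : D.Gr × Module.Dual K D.h => (babyVerma p π l).piece j.1 j.2) :
    iSupIndep fun j : D.Gr × Module.Dual K D.h => (babyVerma p (aug D) l).piece j.1 j.2 := by
  rw [iSupIndep_iff_finsetSum_eq_zero_imp_eq_zero] at h ⊢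
  intro s z hz hsum j hj
  have h1 := h s (fun k => Ψ (1 ⊗ₜ z k))
    (fun k hk => (hΨ _ _ _).2 (Submodule.tmul_mem_baseChange_of_mem _ (hz k hk)))
    (by rw [← map_sum, ← TensorProduct.tmul_sum, hsum, TensorProduct.tmul_zero, map_zero]) j hj
  obtain ⟨s, hs⟩ := Module.Projective.exists_dual_eq_one K (one_ne_zero (α := A))
  rw [LinearEquiv.map_eq_zero_iff] at h1
  have := slice_tmul s (1 : A) (z j)
  rw [h1, map_zero, hs, one_smul] at this
  exact this.symm

theorem finite_of_verma_equiv {π : D.U0 →ₐ[K] A} {l : D.X} [Nontrivial A]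
    (Ψ : A ⊗[K] (babyVerma p (aug D) l).carrier ≃ₗ[A] (babyVerma p π l).carrier)
    [Module.Finite A (babyVerma p π l).carrier] :
    Module.Finite K (babyVerma p (aug D) l).carrier := by
  have : Module.Finite A (A ⊗[K] (babyVerma p (aug D) l).carrier) := Module.Finite.equiv Ψ.symm
  exact Module.Finite.of_finite_tensorProduct_of_faithfullyFlat (T := A)

/-! ### Descent of extensions to the ground field -/

/-- A graded linear section of an extension of baby Verma modules, over the ground field. -/
theorem exists_graded_section {π : D.U0 →ₐ[K] A} {l m : D.X} {E : D.PreObj p A} (hE : E.IsObj π)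
    {i : (babyVerma p π m).Mor E} {q : E.Mor (babyVerma p π l)}
    (hiq : LinearMap.range i.toFun = LinearMap.ker q.toFun) (hq : Function.Surjective q.toFun)
    {V : Type*} [AddCommGroup V] [Module K V] [Module.Finite K V]
    [Module K E.carrier] [IsScalarTower K A E.carrier]
    [Module K (babyVerma p π l).carrier] [IsScalarTower K A (babyVerma p π l).carrier]
    {Q : D.Gr × Module.Dual K D.h → Submodule K V} (hQi : iSupIndep Q) (hQt : ⨆ j, Q j = ⊤)
    (θ : V →ₗ[K] (babyVerma p π l).carrier)
    (hθ : ∀ j, ∀ z ∈ Q j, θ z ∈ (babyVerma p π l).piece j.1 j.2) :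
    ∃ σ : V →ₗ[K] E.carrier, (∀ z, q.toFun (σ z) = θ z) ∧
      ∀ j, ∀ z ∈ Q j, σ z ∈ E.piece j.1 j.2 := by
  classical
  obtain ⟨pr, h1, h2, h3, -, h5⟩ := exists_graded_projections hE hiq
  obtain ⟨prV, v1, v2, v3, v4⟩ := exists_projections hQi hQt
  obtain ⟨r, hr⟩ := (q.toFun.restrictScalars K).exists_rightInverse_of_surjective
    (LinearMap.range_eq_top.2 hq)
  have hr' : ∀ z, q.toFun (r z) = z := fun z => LinearMap.congr_fun hr z
  have hfin : {j | Q j ≠ ⊥}.Finite := WellFoundedGT.finite_ne_bot_of_iSupIndep hQi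
  have hout : ∀ j ∉ hfin.toFinset, ∀ z, prV j z = 0 := by
    intro j hj z
    have h0 : Q j = ⊥ := by
      by_contra h
      exact hj (hfin.mem_toFinset.2 h)
    have := v1 j z
    rwa [h0, Submodule.mem_bot] at this
  -- An arbitrary linear section `r` is made graded by projecting on both sides. The result still
  -- lifts `θ`: on each piece `r` differs from a homogeneous lift by an element of the homogeneous
  -- kernel of `q`.
  refine ⟨∑ j ∈ hfin.toFinset, (pr j).restrictScalars K ∘ₗ r ∘ₗ θ ∘ₗ prV j, fun z => ?_,
    fun j z hz => ?_⟩
  · rw [LinearMap.sum_apply, map_sum]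
    have hterm : ∀ j ∈ hfin.toFinset,
        q.toFun (((pr j).restrictScalars K ∘ₗ r ∘ₗ θ ∘ₗ prV j) z) = θ (prV j z) := by
      intro j _
      change q.toFun (pr j (r (θ (prV j z)))) = _
      obtain ⟨e, he, hqe⟩ := exists_lift_of_mem_piece hE hiq hq (hθ j _ (v1 j z))
      have h6 := h5 j (r (θ (prV j z)) - e) (by rw [map_sub, hr', hqe, sub_self])
      rw [map_sub, map_sub, h2 j e he, hqe, sub_eq_zero] at h6
      exact h6
    rw [Finset.sum_congr rfl hterm, ← map_sum]
    congr 1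
    obtain ⟨s, hs0, hs⟩ := v4 z
    conv_rhs => rw [← hs]
    rw [Finset.sum_subset (Finset.subset_union_left (s₂ := s)) (fun j _ h => hout j h z),
      Finset.sum_subset (Finset.subset_union_right (s₁ := hfin.toFinset)) (fun j _ h => hs0 j h)]
  · rw [LinearMap.sum_apply]
    refine sum_mem fun k _ => ?_
    change pr k (r (θ (prV k z))) ∈ _
    by_cases hkj : k = j
    · subst hkj
      exact h1 _ _
    · rw [v3 k j hkj z hz, map_zero, map_zero, map_zero]
      exact zero_mem _

/-- The failure of a graded section to be equivariant is a cocycle over `K` with values in `A ⊗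
Z_K(m)`. If every slice of it were a coboundary, then so would be the cocycle itself, and the given
extension would split. -/
theorem extNonzero_aug [Fact p.Prime] [Nontrivial A] [IsNoetherianRing A] {π : D.U0 →ₐ[K] A}
    {ε : D.g →ₗ[K] A} (hεh : ∀ x : D.h, ε x = π (UniversalEnvelopingAlgebra.ι K x))
    (hεe : ∀ α ∈ D.R, ε (D.e α) = 0) (hεl : ∀ x y : D.g, ε ⁅x, y⁆ = 0) {l m : D.X}
    (h : ExtNonzero p π l m) : ExtNonzero p (aug D) l m := by
  classical
  obtain ⟨E, hE, i, q, hi, hiq, hq, hns⟩ := h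
  obtain ⟨Ψl, hΨl1, hΨl2, hΨl3⟩ := exists_verma_equiv (p := p) hεh hεe hεl l
  obtain ⟨Ψm, -, hΨm2, hΨm3⟩ := exists_verma_equiv (p := p) hεh hεe hεl m
  -- finiteness and gradings over the ground field
  have hEfin := hE.module_finite
  have hlfin : Module.Finite A (babyVerma p π l).carrier := Module.Finite.of_surjective q.toFun hq
  -- Here `A` has to be Noetherian: the kernel is a submodule of the finitely generated module `E`.
  have hmfin : Module.Finite A (babyVerma p π m).carrier := Module.Finite.of_injective i.toFun hi
  have hZfin := finite_of_verma_equiv Ψl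
  have hYfin := finite_of_verma_equiv Ψm
  have hZi := iSupIndep_of_verma_equiv Ψl hΨl3 (iSupIndep_of_quotient hE hiq hq)
  have hYi := iSupIndep_of_verma_equiv Ψm hΨm3 (iSupIndep_of_sub hE hi)
  have hZt := babyVerma_iSup_eq_top (p := p) (aug D) l
  have hYt := babyVerma_iSup_eq_top (p := p) (aug D) m
  have hZw := babyVerma_isWeight (p := p) (aug D) l
  have hYw := babyVerma_isWeight (p := p) (aug D) m
  -- the ground field acts on the objects over `A`
  let _ : Module K E.carrier := Module.compHom E.carrier (algebraMap K A)
  have : IsScalarTower K A E.carrier := ⟨fun k a w => by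
    rw [Algebra.smul_def, mul_smul]
    rfl⟩
  let _ : Module K (babyVerma p π l).carrier :=
    Module.compHom (babyVerma p π l).carrier (algebraMap K A)
  have : IsScalarTower K A (babyVerma p π l).carrier := ⟨fun k a w => by
    rw [Algebra.smul_def, mul_smul]
    rfl⟩
  let θ : (babyVerma p (aug D) l).carrier →ₗ[K] (babyVerma p π l).carrier :=
    Ψl.toLinearMap.restrictScalars K ∘ₗ TensorProduct.mk K A _ 1
  have hθ : ∀ z, θ z = Ψl (1 ⊗ₜ z) := fun _ => rfl
  have hθ0 : ∀ z, θ z = 0 → z = 0 := by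
    intro z hz
    obtain ⟨s, hs⟩ := Module.Projective.exists_dual_eq_one K (one_ne_zero (α := A))
    rw [hθ, LinearEquiv.map_eq_zero_iff] at hz
    have := slice_tmul s (1 : A) z
    rw [hz, map_zero, hs, one_smul] at this
    exact this.symm
  have hθp : ∀ (c : D.Gr) (φ : Module.Dual K D.h), ∀ z ∈ (babyVerma p (aug D) l).piece c φ,
      θ z ∈ (babyVerma p π l).piece c φ := fun c φ z hz =>
    (hΨl3 c φ _).2 (Submodule.tmul_mem_baseChange_of_mem _ hz)
  obtain ⟨σ, hqσ, hσp⟩ := exists_graded_section hE hiq hq hZi hZt θ (fun j => hθp j.1 j.2)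
  -- the untwisted action on `E` and the embedding of the kernel
  obtain ⟨ρ, hρ⟩ := E.action.exists_twist (-ε) (fun α hα => by simp [hεe α hα])
    (fun x y => by simp [hεl x y])
  have hρgen : ∀ (x : D.g) e, ρ.hom (D.gen p x) e = D.gen p x • e - ε x • e := by
    intro x e
    rw [hρ, LinearMap.add_apply, LinearMap.neg_apply, Module.algebraMap_end_apply, neg_smul,
      PreObj.action_hom_apply, sub_eq_add_neg]
  let j : A ⊗[K] (babyVerma p (aug D) m).carrier →ₗ[A] E.carrier := i.toFun ∘ₗ Ψm.toLinearMap
  have hj : ∀ t, j t = i.toFun (Ψm t) := fun _ => rfl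
  have hjinj : Function.Injective j := hi.comp Ψm.injective
  have hqj : ∀ t, q.toFun (j t) = 0 := fun t =>
    LinearMap.mem_ker.1 (hiq ▸ LinearMap.mem_range_self i.toFun (Ψm t))
  have hjker : ∀ e, q.toFun e = 0 → ∃ t, j t = e := by
    intro e he
    obtain ⟨z, hz⟩ : e ∈ LinearMap.range i.toFun := hiq ▸ LinearMap.mem_ker.2 he
    exact ⟨Ψm.symm z, by rw [hj, LinearEquiv.apply_symm_apply, hz]⟩
  have hjρ : ∀ (u : D.Uχ p) t,
      j (((babyVerma p (aug D) m).action.baseChange A).hom u t) = ρ.hom u (j t) := by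
    have h0 : ∀ (x : D.g) t, j (((babyVerma p (aug D) m).action.baseChange A).hom (D.gen p x) t) =
        ρ.hom (D.gen p x) (j t) := by
      intro x t
      rw [hρgen, hj, hj, hΨm2, map_sub, i.map_smulU, map_smul]
    exact Action.map_hom _ ρ j.toAddMonoidHom (fun k w => j.map_smul _ w)
      (fun x w => h0 x w) (fun α _ w => h0 _ w)
  have hjp : ∀ (c : D.Gr) (φ : Module.Dual K D.h) t, j t ∈ E.piece c φ →
      t ∈ ((babyVerma p (aug D) m).piece c φ).baseChange A := fun c φ t ht =>
    (hΨm3 c φ t).1 (mem_piece_of_map_mem hE hi ht)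
  have hqρ : ∀ (u : D.Uχ p) e z, q.toFun e = θ z → q.toFun (ρ.hom u e) = θ (u • z) := by
    intro u
    induction u using Uχ_induction with
    | halg r =>
      intro e z h
      rw [ρ.hom_algebraMap, PreObj.algebraMap_smul, Algebra.algebraMap_self_apply, map_smul, ← h]
      exact q.toFun.map_smul _ e
    | hgen x =>
      intro e z h
      have h1 := hΨl2 x (1 ⊗ₜ z)
      rw [hρgen, map_sub, q.map_smulU, map_smul, h, hθ, hθ, ← h1]
      rfl
    | hadd u w hu hw =>
      intro e z h
      rw [map_add, LinearMap.add_apply, map_add, hu e z h, hw e z h, add_smul, map_add]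
    | hmul u w hu hw =>
      intro e z h
      rw [map_mul, Module.End.mul_apply, hu _ _ (hw e z h), mul_smul]
  -- the cocycle
  obtain ⟨r, hr⟩ := (j.restrictScalars K).exists_leftInverse_of_injective
    (LinearMap.ker_eq_bot.2 hjinj)
  let κ : D.Uχ p → (babyVerma p (aug D) l).carrier →ₗ[K]
      A ⊗[K] (babyVerma p (aug D) m).carrier := fun u =>
    r ∘ₗ ((ρ.hom u).restrictScalars K ∘ₗ σ - σ ∘ₗ (babyVerma p (aug D) l).action.hom u)
  -- The right side lies in the kernel of `q`, which is the image of `j`; on it the left inverse `r`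
  -- is a true inverse. All identities for `κ` are then checked after applying the injection `j`.
  have hκ : ∀ u z, j (κ u z) = ρ.hom u (σ z) - σ (u • z) := by
    intro u z
    obtain ⟨t, ht⟩ := hjker (ρ.hom u (σ z) - σ (u • z)) (by
      rw [map_sub, hqρ u _ _ (hqσ z), hqσ, sub_self])
    have h1 : κ u z = r (ρ.hom u (σ z) - σ (u • z)) := rfl
    have h2 : r (j t) = t := LinearMap.congr_fun hr t
    rw [h1, ← ht, h2]
  have hκadd : ∀ u w, κ (u + w) = κ u + κ w := by
    refine fun u w => LinearMap.ext fun z => hjinj ?_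
    rw [LinearMap.add_apply, map_add, hκ, hκ, hκ, map_add, LinearMap.add_apply, add_smul, map_add]
    abel
  have hκmul : ∀ u w z, κ (u * w) z =
      ((babyVerma p (aug D) m).action.baseChange A).hom u (κ w z) + κ u (w • z) := by
    refine fun u w z => hjinj ?_
    rw [map_add, hjρ, hκ, hκ, hκ, map_mul, Module.End.mul_apply, map_sub, mul_smul]
    abel
  have hκalg : ∀ k : K, κ (algebraMap K _ k) = 0 := by
    refine fun k => LinearMap.ext fun z => hjinj ?_
    rw [hκ, ρ.hom_algebraMap, PreObj.algebraMap_smul, Algebra.algebraMap_self_apply, map_smul,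
      LinearMap.zero_apply, map_zero]
    exact sub_self _
  -- Since `σ` is graded, `𝔥` acts on `z` and, after untwisting, on `σ z` by the same scalars.
  have hκh : ∀ (c : D.Gr) (φ : Module.Dual K D.h) (x : D.h),
      ∀ z ∈ (babyVerma p (aug D) l).piece c φ, κ (D.gen p (x : D.g)) z = 0 := by
    refine fun c φ x z hz => hjinj ?_
    rw [hκ, hρgen, hE.isWeight.h_smul c φ x _ (hσp (c, φ) z hz), hZw.h_smul c φ x z hz, hεh, aug_ι,
      zero_add, Algebra.algebraMap_self_apply, map_smul, map_zero, add_smul, add_sub_cancel_left,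
      algebraMap_smul, sub_self]
  have hκe : ∀ α ∈ D.R, ∀ (c : D.Gr) (φ : Module.Dual K D.h),
      ∀ z ∈ (babyVerma p (aug D) l).piece c φ, κ (D.gen p (D.e α)) z ∈
        ((babyVerma p (aug D) m).piece (D.cls α + c) (φ + D.d α)).baseChange A := by
    intro α hα c φ z hz
    refine hjp _ _ _ ?_
    rw [hκ, hρgen, hεe α hα, zero_smul, sub_zero]
    exact sub_mem (hE.e_smul α hα c φ _ (hσp (c, φ) z hz))
      (hσp (D.cls α + c, φ + D.d α) _ (hZw.e_smul α hα c φ z hz))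
  have hYwt : ∀ c φ, (babyVerma p (aug D) m).piece c φ ≠ ⊥ →
      ∃ μ τ : D.X, D.cls (μ + p • τ) = c ∧ D.d μ = φ := by
    intro c φ h
    obtain ⟨y, hy, hy0⟩ := (Submodule.ne_bot_iff _).1 h
    refine hE.weights c φ ((Submodule.ne_bot_iff _).2 ⟨j (1 ⊗ₜ y), i.map_piece _ _ _
      ((hΨm3 c φ _).2 (Submodule.tmul_mem_baseChange_of_mem _ hy)), fun h0 => hy0 ?_⟩)
    obtain ⟨s, hs⟩ := Module.Projective.exists_dual_eq_one K (one_ne_zero (α := A))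
    rw [map_eq_zero_iff j hjinj] at h0
    have := slice_tmul s (1 : A) y
    rw [h0, map_zero, hs, one_smul] at this
    exact this.symm
  have hZwt : ∀ c φ, (babyVerma p (aug D) l).piece c φ ≠ ⊥ →
      ∃ μ τ : D.X, D.cls (μ + p • τ) = c ∧ D.d μ = φ := by
    intro c φ h
    obtain ⟨z, hz, hz0⟩ := (Submodule.ne_bot_iff _).1 h
    refine hE.weights c φ ((Submodule.ne_bot_iff _).2 ⟨σ z, hσp (c, φ) z hz, fun h0 => hz0 ?_⟩)
    refine hθ0 z ?_
    rw [← hqσ, h0, map_zero]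
  -- the extensions over the ground field
  by_contra hsplit
  -- The slice of `κ` by `s` defines an extension over `K`, which splits by assumption. A maximal
  -- lift of the generator has the form `(w, v)`, and the first coordinates of `e_α (w, v) = 0` are
  -- these equations.
  have hlift : ∀ s : Module.Dual K A, ∃ w ∈ (babyVerma p (aug D) m).piece (D.cls l) (D.d l),
      ∀ α ∈ D.Rpos, D.gen p (D.e α) • w +
        slice s _ (κ (D.gen p (D.e α)) (hwVec p (aug D) l)) = 0 := by
    intro s
    let c : D.Uχ p → (babyVerma p (aug D) l).carrier →ₗ[K] (babyVerma p (aug D) m).carrier :=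
      fun u => slice s _ ∘ₗ κ u
    have hadd : ∀ u w, c (u + w) = c u + c w := fun u w => by
      simp only [c, hκadd, LinearMap.comp_add]
    have hmul : ∀ u w z, c (u * w) z = (babyVerma p (aug D) m).action.hom u (c w z) +
        c u ((babyVerma p (aug D) l).action.hom w z) := fun u w z => by
      simp only [c, LinearMap.comp_apply, hκmul, map_add, slice_baseChange_hom]
      rfl
    have halg : ∀ k : K, c (algebraMap K _ k) = 0 := fun k => by
      simp only [c, hκalg, LinearMap.comp_zero]
    have hobj := ofCocycle_isObj hYw hZw hYi hYt hZi hZt hYwt hZwt hadd hmul halg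
      (fun b φ x z hz => by
        simp only [c, LinearMap.comp_apply, hκh b φ x z hz, map_zero])
      (fun α hα b φ z hz => slice_mem (hκe α hα b φ z hz) s)
    let E' := PreObj.ofAction (Action.ofCocycle (babyVerma p (aug D) m).action
      (babyVerma p (aug D) l).action c hadd hmul halg)
      fun b φ => ((babyVerma p (aug D) m).piece b φ).prod ((babyVerma p (aug D) l).piece b φ)
    let i' : (babyVerma p (aug D) m).Mor E' :=
      ⟨LinearMap.inl K _ _, fun u y => Prod.ext (by
          change u • y = u • y + c u 0
          rw [map_zero, add_zero]) (by
          change 0 = u • (0 : (babyVerma p (aug D) l).carrier)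
          rw [smul_zero]),
        fun b φ y hy => ⟨hy, zero_mem _⟩⟩
    let q' : E'.Mor (babyVerma p (aug D) l) :=
      ⟨LinearMap.snd K _ _, fun u y => rfl, fun b φ y hy => hy.2⟩
    have hs : ∃ t : (babyVerma p (aug D) l).Mor E', q'.toFun ∘ₗ t.toFun = LinearMap.id := by
      by_contra hcon
      exact hsplit ⟨E', hobj, i', q', LinearMap.inl_injective, LinearMap.range_inl K _ _,
        LinearMap.snd_surjective, hcon⟩
    obtain ⟨⟨w, z⟩, hz, ⟨hw, -⟩, hwe⟩ := (exists_section_iff hobj.isWeight q').1 hs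
    obtain rfl : z = hwVec p (aug D) l := hz
    exact ⟨w, hw, fun α hα => congrArg Prod.fst (hwe α hα)⟩
  refine hns ((exists_section_iff hE.isWeight q).2 ?_)
  let β := Module.Basis.ofVectorSpace K A
  choose w hwp hwe using fun k => hlift (β.coord k)
  have hRfin : D.Rpos.Finite := D.finite_R.subset D.Rpos_subset_R
  choose J hJ0 hJ using fun α => exists_eq_sum_slice β
    (κ (D.gen p (D.e α)) (hwVec p (aug D) l))
  -- Infinitely many `w k` may be nonzero if `A` is infinite dimensional. Only finitely many are
  -- needed, since there are finitely many positive roots and each cocycle value has finitely many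
  -- nonzero coordinates.
  let S := hRfin.toFinset.biUnion J
  let t : A ⊗[K] (babyVerma p (aug D) m).carrier := ∑ k ∈ S, β k ⊗ₜ w k
  -- The defect `e_α σ(v)` is the image under `j` of the cocycle value, and `t` cancels it
  -- coordinate by coordinate with respect to `β`.
  refine ⟨σ (hwVec p (aug D) l) + j t, ?_, add_mem ?_ ?_, fun α hα => ?_⟩
  · rw [map_add, hqσ, hqj, add_zero, hθ, hΨl1]
  · exact hσp (D.cls l, D.d l) _ (hwVec_mem_piece (aug D) l)
  · exact i.map_piece _ _ _ ((hΨm3 _ _ _).2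
      (sum_mem fun k _ => Submodule.tmul_mem_baseChange_of_mem _ (hwp k)))
  · have hα' := D.Rpos_subset_R hα
    have h1 : ∀ e, ρ.hom (D.gen p (D.e α)) e = D.gen p (D.e α) • e := fun e => by
      rw [hρgen, hεe α hα', zero_smul, sub_zero]
    have h2 : D.gen p (D.e α) • σ (hwVec p (aug D) l) =
        j (κ (D.gen p (D.e α)) (hwVec p (aug D) l)) := by
      rw [hκ, h1, e_smul_hwVec _ _ hα, map_zero, sub_zero]
    rw [smul_add, h2, ← h1 (j t), ← hjρ, ← map_add]
    have h3 : κ (D.gen p (D.e α)) (hwVec p (aug D) l) =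
        ∑ k ∈ S, β k ⊗ₜ slice (β.coord k) _ (κ (D.gen p (D.e α)) (hwVec p (aug D) l)) := by
      conv_lhs => rw [← hJ α]
      refine Finset.sum_subset (Finset.subset_biUnion_of_mem J (hRfin.mem_toFinset.2 hα))
        fun k _ hk => ?_
      rw [hJ0 α k hk, TensorProduct.tmul_zero]
    rw [h3, map_sum, ← Finset.sum_add_distrib, Finset.sum_eq_zero fun k _ => ?_, map_zero]
    rw [Action.baseChange_hom_tmul, ← TensorProduct.tmul_add, PreObj.action_hom_apply, add_comm,
      hwe k α hα, TensorProduct.tmul_zero]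

/-! ### Blocks -/

/-- Blocks over `A` are the blocks over the ground field, with the augmentation as structure
map. -/
theorem sameBlock_iff_aug [Fact p.Prime] [Nontrivial A] [IsNoetherianRing A] (π : D.U0 →ₐ[K] A)
    (hπ : ∀ (α : D.X) (hα : α ∈ D.R) (hα' : -α ∈ D.R),
      π (UniversalEnvelopingAlgebra.ι K ⟨⁅D.e α, D.e (-α)⁆, D.lie_e_mem_h hα hα'⟩) = 0)
    (l m : D.X) : SameBlock p π l m ↔ SameBlock p (aug D) l m := by
  obtain ⟨ε, hεh, hεe, hεl⟩ := D.exists_extension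
    (π.toLinearMap ∘ₗ (UniversalEnvelopingAlgebra.ι K : D.h →ₗ⁅K⁆ D.U0).toLinearMap) hπ
  have hrel : (fun l m => HomNonzero p π l m ∨ ExtNonzero p π l m) =
      fun l m => HomNonzero p (aug D) l m ∨ ExtNonzero p (aug D) l m := by
    funext l m
    rw [homNonzero_iff_aug hεh hεe hεl,
      propext ⟨extNonzero_aug hεh hεe hεl, extNonzero_of_aug hεh hεe hεl⟩]
  rw [SameBlock, SameBlock, hrel]

end LeviDatum

/-- The residue map kills the `h_α` together with `π`, so over `A` and over `F` the blocks are those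
over `K` with the augmentation. -/
theorem mainTheorem6 {K : Type u} [Field K] [IsAlgClosed K] (p : ℕ) [Fact p.Prime] [CharP K p]
    {n : ℕ} (D : LeviDatum K n)
    {A : Type v} [CommRing A] [IsLocalRing A] [IsNoetherianRing A] [Algebra K A]
    (π : D.U0 →ₐ[K] A)
    (hπ : ∀ (α : D.X) (hα : α ∈ D.R) (hα' : -α ∈ D.R),
      π (UniversalEnvelopingAlgebra.ι K ⟨⁅D.e α, D.e (-α)⁆, D.lie_e_mem_h hα hα'⟩) = 0)
    (l m : D.X) :
    LeviDatum.SameBlock p π l m ↔ LeviDatum.SameBlock p (LeviDatum.residueMap π) l m := by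
  rw [LeviDatum.sameBlock_iff_aug π hπ, LeviDatum.sameBlock_iff_aug (LeviDatum.residueMap π)]
  intro α hα hα'
  rw [LeviDatum.residueMap, AlgHom.comp_apply, hπ α hα hα', map_zero]
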